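/- **Setting.** For a point $o=(o_x,o_y)$ in the plane, the *hierarchical grid* $\Gamma(o)$ consists of all cells $[o_x+i2^\ell,o_x+(i+1)2^\ell)\times[o_y+j2^\ell,o_y+(j+1)2^\ell)$ with $i,j,\ell\in\mathbb Z$. The *size* of an object is the side length of a smallest enclosing square. An object $D$ is *6-aligned* with $\Gamma$ if some cell $\sigma$ of $\Gamma$ satisfies $D\subset\sigma$ and $\mathrm{size}(\sigma)\le 6\,\mathrm{size}(D)$. Let $\Gamma=\Gamma(o)$ be a hierarchical grid (for instance one of the three shifted grids to which all disks in the unit square are distributed), let $\mathcal D(\Gamma)$ be a family of $n$ closed disks of positive radius that are 6-aligned with $\Gamma$, and let $\sigma_0$ be a cell of $\Gamma$ that contains all these disks. **Skip quadtree.** Let $P$ be the set of centers of the disks. The *compressed quadtree* with root cell $\sigma$ on a finite set $Q\subset\sigma$ is a single leaf, with region $\sigma$, if $|Q|\le 1$. Otherwise let $\tau$ be the smallest cell of $\Gamma$ containing $Q$. If $\tau\ne\sigma$ there is a leaf with the *donut* region $\sigma\setminus\tau$ (with *hole* $\tau$), and below $\tau$ the tree continues recursively in the four quadrants of $\tau$.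 The leaf regions form the *subdivision* of $\sigma$ defined by $Q$. Sort $P$ in Z-order (recursively, quadrants in the order NW, NE, SW, SE), let $P_0=P$, let $P_{i+1}$ be obtained from $P_i$ by deleting every other element, starting with the first, and let $t=\lfloor\log_2|P|\rfloor$, so that $|P_t|=1$ when $P\neq\emptyset$. The *skip quadtree* has as its nodes at level $i\in\{0,\dots,t\}$ the regions of the subdivision of $\sigma_0$ defined by $P_i$. Its root is $\sigma_0$ at level $t$, its leaves are the nodes at level $0$, and the parent of a node at level $i<t$ is the node at level $i+1$ whose region contains it. **Clique construction.** Build the skip quadtree. For each disk $D\in\mathcal D(\Gamma)$, follow from the root the nodes $\mu$ whose region $R_\mu$ contains the center of $D$, until a node $\nu$ is reached whose boundary is crossed by $D$ (that is, $D\not\subset R_\nu$) or that is a leaf, and assign $D$ to that node. The disks assigned to a leaf (which all have the same center) form one clique. The disks assigned to any other node $\nu$ are partitioned into at most $k$ stabbed cliques, where $k$ is a constant and a *stabbed clique* is a set of disks with a common point. If $R_\nu$ is a donut, the disks that meet its hole are treated separately from those that do not. The *flower* of a clique is the union of its disks. The *ply* of a family of sets is the maximum, over all points $q$ of the plane, of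 the number of its members containing $q$. **Lemma.** (a) There is a constant $k$ such that the construction, with at most $k$ cliques per node, can always be carried out, and one program computes the partition it yields in $O(n\log n)$ time, given $o$, $\sigma_0$ and the disks, on a real RAM extended with a unit-cost operation that returns the corner and the side length of the smallest cell of $\Gamma((0,0))$ containing two given points. (b) For every constant $k$, whichever cliques are chosen at the nodes (at most $k$ per node), the result is a partition of $\mathcal D(\Gamma)$ into stabbed cliques whose flowers have ply $O(\log n)$. The constants hidden in the $O$-notation in (a) are absolute, and those in (b) depend only on $k$. -/

import Mathlib

open Asymptotics Filter

noncomputable section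

/-! ## Hierarchical grids, sizes and alignment -/

/-- Points of the plane, given by their two coordinates. -/
abbrev Point : Type := ℝ × ℝ

/-- The index `(ℓ, i, j)` of a cell `σ(o, ℓ, i, j)` of a hierarchical grid. -/
@[ext]
structure Cell where
  level : ℤ
  i : ℤ
  j : ℤ

/-- The side length `2 ^ ℓ` of a cell. -/
def Cell.side (σ : Cell) : ℝ := (2 : ℝ) ^ σ.level

/-- The lower left corner of a cell of the hierarchical grid centered at `o`. -/
def Cell.corner (o : Point) (σ : Cell) : Point :=
  (o.1 + σ.i * σ.side, o.2 + σ.j * σ.side)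

/-- The half-open square `σ(o, ℓ, i, j)`. As `σ` varies over `Cell`, these are exactly the cells
of the hierarchical grid `Γ(o)` centered at `o`. -/
def Cell.toSet (o : Point) (σ : Cell) : Set Point :=
  Set.Ico (o.1 + σ.i * σ.side) (o.1 + (σ.i + 1) * σ.side) ×ˢ
    Set.Ico (o.2 + σ.j * σ.side) (o.2 + (σ.j + 1) * σ.side)

/-- The four quadrants of a cell, in the order north-west, north-east, south-west, south-east. -/
def Cell.quadrant (σ : Cell) (a : Fin 4) : Cell where
  level := σ.level - 1
  i := 2 * σ.i + ![0, 1, 0, 1] a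
  j := 2 * σ.j + ![1, 1, 0, 0] a

/-- The size of an object: the side length of a smallest enclosing square. -/
def objectSize (S : Set Point) : ℝ :=
  sInf {s : ℝ | 0 ≤ s ∧ ∃ x y : ℝ, S ⊆ Set.Icc x (x + s) ×ˢ Set.Icc y (y + s)}

/-- `S` is `c`-aligned with the hierarchical grid centered at `o`. -/
def IsAligned (c : ℝ) (o : Point) (S : Set Point) : Prop :=
  ∃ σ : Cell, S ⊆ σ.toSet o ∧ objectSize (σ.toSet o) ≤ c * objectSize S

/-- A disk in the plane, given by its center and its radius. -/
structure Disk where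
  center : Point
  radius : ℝ
  radius_pos : 0 < radius

/-- The set of points of a (closed, Euclidean) disk. -/
def Disk.toSet (D : Disk) : Set Point :=
  {p | (p.1 - D.center.1) ^ 2 + (p.2 - D.center.2) ^ 2 ≤ D.radius ^ 2}

/-! ## Compressed quadtrees and skip quadtrees -/

/-- `τ` is the smallest cell of the hierarchical grid centered at `o` that contains `P`. -/
def IsSmallestCell (o : Point) (P : Set Point) (τ : Cell) : Prop :=
  P ⊆ τ.toSet o ∧ ∀ τ' : Cell, P ⊆ τ'.toSet o → τ.toSet o ⊆ τ'.toSet o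

/-- The possible regions of a compressed-quadtree subdivision: cells, and donut cells
(an outer cell minus an inner cell, the hole). -/
inductive Region where
  | cell (σ : Cell)
  | donut (outer hole : Cell)

def Region.toSet (o : Point) : Region → Set Point
  | .cell σ => σ.toSet o
  | .donut outer hole => outer.toSet o \ hole.toSet o

/-- `IsLeafRegion o σ P R`: the region `R` belongs to a leaf of the compressed quadtree with root
cell `σ` on the point set `P ⊆ σ`, i.e. `R` is a region of the corresponding subdivision.
If `P` has at most one point, the tree is a single leaf. Otherwise let `τ` be the smallest cell
containing `P`; if `τ ≠ σ` then `σ \ τ` is a donut leaf, and below `τ` the tree continues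
recursively with the four quadrants of `τ`. -/
inductive IsLeafRegion (o : Point) : Cell → Set Point → Region → Prop
  | single {σ : Cell} {P : Set Point} (hP : P.Subsingleton) : IsLeafRegion o σ P (.cell σ)
  | donut {σ τ : Cell} {P : Set Point} (hP : P.Nontrivial) (hτ : IsSmallestCell o P τ)
      (hne : τ ≠ σ) : IsLeafRegion o σ P (.donut σ τ)
  | descend {σ τ : Cell} {P : Set Point} {R : Region} (hP : P.Nontrivial)
      (hτ : IsSmallestCell o P τ) (a : Fin 4)
      (h : IsLeafRegion o (τ.quadrant a) (P ∩ (τ.quadrant a).toSet o) R) : IsLeafRegion o σ P R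

/-- `p` strictly precedes `q` in the Z-order: some cell has `p` and `q` in different quadrants,
that of `p` coming first. -/
def ZLt (o : Point) (p q : Point) : Prop :=
  ∃ (σ : Cell) (a b : Fin 4), a < b ∧ p ∈ (σ.quadrant a).toSet o ∧ q ∈ (σ.quadrant b).toSet o

/-- Delete every other element of a list, starting with the first element. -/
def halve {α : Type} : List α → List α
  | [] => []
  | [_] => []
  | _ :: b :: l => b :: halve l

/-- The point set `P_i` of the halving sequence of the Z-sorted list `l` of the points of `P`. -/
def levelPoints (l : List Point) (i : ℕ) : Set Point := {p | p ∈ halve^[i] l}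

/-- `IsSkipNode o σ₀ l i R`: there is a node at level `i` with region `R` in the skip quadtree
with starting cell `σ₀` on the Z-sorted list of points `l`. The top level is
`t = ⌊log₂ |P|⌋`, the level at which exactly one point is left; level `0` holds the leaves. -/
def IsSkipNode (o : Point) (σ₀ : Cell) (l : List Point) (i : ℕ) (R : Region) : Prop :=
  i ≤ Nat.log 2 l.length ∧ IsLeafRegion o σ₀ (levelPoints l i) R

/-- The disk `D` is assigned to the node at level `i` with region `R`: this is the first node
on the search path of the center of `D` (from the root, at the top level, downwards) that is a
leaf or whose region does not contain `D` entirely, i.e. whose boundary is crossed by `D`. -/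
def IsAssigned (o : Point) (σ₀ : Cell) (l : List Point) (D : Disk) (i : ℕ) (R : Region) : Prop :=
  IsSkipNode o σ₀ l i R ∧ D.center ∈ R.toSet o ∧ (i = 0 ∨ ¬ D.toSet ⊆ R.toSet o) ∧
    ∀ (i' : ℕ) (R' : Region), i < i' → IsSkipNode o σ₀ l i' R' → D.center ∈ R'.toSet o →
      D.toSet ⊆ R'.toSet o

/-! ## Stabbed cliques, flowers and ply -/

/-- The disks with indices in `c` form a stabbed clique: some point lies in all of them. -/
def IsStabbed {n : ℕ} (d : Fin n → Disk) (c : Finset (Fin n)) : Prop :=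
  ∃ p : Point, ∀ i ∈ c, p ∈ (d i).toSet

/-- The flower of a clique: the union of its disks. -/
def flower {n : ℕ} (d : Fin n → Disk) (c : Finset (Fin n)) : Set Point :=
  ⋃ i ∈ c, (d i).toSet

/-- The ply of a family of objects: the maximum over all points `q` of the number of members of
the family that contain `q`. -/
def ply {ι : Type} (F : ι → Set Point) : ℕ∞ := ⨆ q : Point, {x : ι | q ∈ F x}.encard

/-- `IsCliqueConstruction k o σ₀ d C`: the partition `C` of the disks `d` is a possible result of
the clique construction on the hierarchical grid centered at `o` with starting cell `σ₀`, if at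
most `k` cliques are created per node of the skip quadtree. -/
def IsCliqueConstruction (k : ℕ) (o : Point) (σ₀ : Cell) {n : ℕ} (d : Fin n → Disk)
    (C : Finpartition (Finset.univ : Finset (Fin n))) : Prop :=
  ∃ l : List Point,
    -- `l` is the Z-sorted list of the disk centers, from which the skip quadtree is built
    l.Pairwise (ZLt o) ∧ (∀ p, p ∈ l ↔ ∃ x, (d x).center = p) ∧
    -- each clique consists of disks assigned to one and the same node
    (∀ c ∈ C.parts, ∃ i R, ∀ x ∈ c, IsAssigned o σ₀ l (d x) i R) ∧
    -- each clique is stabbed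
    (∀ c ∈ C.parts, IsStabbed d c) ∧
    -- at a leaf there is at most one clique, at every other node there are at most `k`
    (∀ i R, {c | c ∈ C.parts ∧ ∀ x ∈ c, IsAssigned o σ₀ l (d x) i R}.encard ≤
      if i = 0 then 1 else (k : ℕ∞)) ∧
    -- at a donut, the disks that meet the hole are treated separately from the others
    (∀ c ∈ C.parts, ∀ i outer hole,
      (∀ x ∈ c, IsAssigned o σ₀ l (d x) i (.donut outer hole)) →
        (∀ x ∈ c, ((d x).toSet ∩ hole.toSet o).Nonempty) ∨
        (∀ x ∈ c, Disjoint (d x).toSet (hole.toSet o)))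

/-- The inputs of the construction: a starting cell of the grid that contains all disks, all of
which are 6-aligned with the grid. -/
def IsAdmissible (o : Point) (σ₀ : Cell) {n : ℕ} (d : Fin n → Disk) : Prop :=
  ∀ x, (d x).toSet ⊆ σ₀.toSet o ∧ IsAligned 6 o (d x).toSet

/-! ## The real RAM, extended with an operation on cells of the standard hierarchical grid -/

/-- A state: natural-number registers and memory, real registers and memory. Registers are
addressed by constants of the program, memory is addressed indirectly. -/
structure RamState where
  nreg : ℕ → ℕ
  nmem : ℕ → ℕ
  rreg : ℕ → ℝ
  rmem : ℕ → ℝ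

open Classical in
/-- The extra operation: the corner coordinates and the side length of the smallest cell of the
hierarchical grid centered at the origin that contains both `p` and `q` (zeros if there is no
such cell). -/
def smallestCellOp (p q : Point) : ℝ × ℝ × ℝ :=
  if h : ∃ τ : Cell, IsSmallestCell 0 {p, q} τ then
    ((h.choose.corner 0).1, (h.choose.corner 0).2, h.choose.side)
  else (0, 0, 0)

/-- Elementary instructions; all arguments except the constants are register names, and the
first ones are the destinations. -/
inductive Instr where
  | nconst (a : ℕ) (v : ℕ)
  | nadd (a b c : ℕ)
  | nsub (a b c : ℕ)
  | nload (a b : ℕ)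
  | nstore (a b : ℕ)
  | rconst (a : ℕ) (v : ℚ)
  | radd (a b c : ℕ)
  | rsub (a b c : ℕ)
  | rmul (a b c : ℕ)
  | rdiv (a b c : ℕ)
  | rload (a b : ℕ)
  | rstore (a b : ℕ)
  | smallestCell (ax ay as px py qx qy : ℕ)

/-- The effect of an elementary instruction. -/
def Instr.run (s : RamState) : Instr → RamState
  | .nconst a v => { s with nreg := Function.update s.nreg a v }
  | .nadd a b c => { s with nreg := Function.update s.nreg a (s.nreg b + s.nreg c) }
  | .nsub a b c => { s with nreg := Function.update s.nreg a (s.nreg b - s.nreg c) }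
  | .nload a b => { s with nreg := Function.update s.nreg a (s.nmem (s.nreg b)) }
  | .nstore a b => { s with nmem := Function.update s.nmem (s.nreg a) (s.nreg b) }
  | .rconst a v => { s with rreg := Function.update s.rreg a (v : ℝ) }
  | .radd a b c => { s with rreg := Function.update s.rreg a (s.rreg b + s.rreg c) }
  | .rsub a b c => { s with rreg := Function.update s.rreg a (s.rreg b - s.rreg c) }
  | .rmul a b c => { s with rreg := Function.update s.rreg a (s.rreg b * s.rreg c) }
  | .rdiv a b c => { s with rreg := Function.update s.rreg a (s.rreg b / s.rreg c) }
  | .rload a b => { s with rreg := Function.update s.rreg a (s.rmem (s.nreg b)) }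
  | .rstore a b => { s with rmem := Function.update s.rmem (s.nreg a) (s.rreg b) }
  | .smallestCell ax ay as px py qx qy =>
      let r := smallestCellOp (s.rreg px, s.rreg py) (s.rreg qx, s.rreg qy)
      { s with rreg := Function.update (Function.update (Function.update s.rreg
          ax r.1) ay r.2.1) as r.2.2 }

/-- Tests: comparison of two natural-number registers or of two real registers. -/
inductive Test where
  | nlt (a b : ℕ)
  | rlt (a b : ℕ)

def Test.holds (s : RamState) : Test → Prop
  | .nlt a b => s.nreg a < s.nreg b
  | .rlt a b => s.rreg a < s.rreg b

/-- Programs: finite texts with branching and unbounded loops. -/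
inductive Prog where
  | skip
  | instr (a : Instr)
  | seq (A B : Prog)
  | ite (b : Test) (A B : Prog)
  | loop (b : Test) (A : Prog)

/-- `Exec A s m s'`: started in state `s`, the program `A` halts after exactly `m` steps in state
`s'`. Every instruction and every evaluation of a test is one step. -/
inductive Exec : Prog → RamState → ℕ → RamState → Prop
  | skip {s : RamState} : Exec .skip s 1 s
  | instr {s : RamState} (a : Instr) : Exec (.instr a) s 1 (a.run s)
  | seq {A B : Prog} {s s₁ s₂ : RamState} {m₁ m₂ : ℕ} (hA : Exec A s m₁ s₁)
      (hB : Exec B s₁ m₂ s₂) : Exec (.seq A B) s (m₁ + m₂) s₂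
  | ite_true {b : Test} {A B : Prog} {s s' : RamState} {m : ℕ} (hb : b.holds s)
      (h : Exec A s m s') : Exec (.ite b A B) s (m + 1) s'
  | ite_false {b : Test} {A B : Prog} {s s' : RamState} {m : ℕ} (hb : ¬ b.holds s)
      (h : Exec B s m s') : Exec (.ite b A B) s (m + 1) s'
  | loop_done {b : Test} {A : Prog} {s : RamState} (hb : ¬ b.holds s) : Exec (.loop b A) s 1 s
  | loop_step {b : Test} {A : Prog} {s s₁ s₂ : RamState} {m₁ m₂ : ℕ} (hb : b.holds s)
      (hA : Exec A s m₁ s₁) (hB : Exec (.loop b A) s₁ m₂ s₂) :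
      Exec (.loop b A) s (m₁ + m₂ + 1) s₂

/-- The real memory on input: center of the grid, corner and side length of the starting cell,
then center and radius of each of the `n` disks. All other memory is zero. -/
def inputReals (o : Point) (σ₀ : Cell) {n : ℕ} (d : Fin n → Disk) : List ℝ :=
  [o.1, o.2, (σ₀.corner o).1, (σ₀.corner o).2, σ₀.side] ++
    (List.ofFn d).flatMap fun D => [D.center.1, D.center.2, D.radius]

/-- The initial state: register `0` holds the number of disks. -/
def inputState (o : Point) (σ₀ : Cell) {n : ℕ} (d : Fin n → Disk) : RamState where
  nreg := Function.update (fun _ => 0) 0 n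
  nmem := fun _ => 0
  rreg := fun _ => 0
  rmem := fun a => (inputReals o σ₀ d).getD a 0

/-- The final state represents the partition `C`: for each disk, memory holds the number (less
than `n`) of its clique. -/
def Represents {n : ℕ} (s : RamState) (C : Finpartition (Finset.univ : Finset (Fin n))) : Prop :=
  (∀ x : Fin n, s.nmem x < n) ∧ ∀ x y : Fin n, s.nmem x = s.nmem y ↔ C.part x = C.part y

end

/-! ### Grid cells as a laminar family, their order, and compressed quadtrees -/

noncomputable section

/-! ## Cells -/

/-! Everything rests on two facts about the grid. Cells that share a point are nested, and each cell
is convex in the Z-order (`ZLt.mem_of_between`), so the points of a cell occupy an interval of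
positions in the sorted list. With positions counted from 1, level `i` of the skip quadtree keeps
the multiples of `2 ^ i`.

Ply. Fix a point `q` and a level `i`. A disk assigned at level `i` lies inside a region of level `i
+ 1`. Regions of one level are disjoint, so all such disks that contain `q` lie in the same region
`R`. It therefore suffices that `R` meets boundedly many regions of level `i` (`encard_regions_le`).
If `R` is a cell, it has at most one point of level `i + 1`; if it is a donut, its points of that
level all lie in the hole. Passing to level `i` adds at most one point before the first and one
after the last of the old points, apart from points between them. Hence the branching cells outside
the hole are spanned by pairs from three points (`exists_three_points`). This gives at most 37
regions, each with at most `k + 1` cliques, on each of `⌊log₂ n⌋ + 1` levels.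

Boundedly many cliques. If a 6-aligned disk crosses the boundary of a cell of side `s`, its aligning
cell is at least twice as large, so the radius is at least `s / 6` (`Disk.side_le_of_crosses`). Such
a disk contains one of 81 fixed grid points around the cell (`Disk.exists_gridPoint_mem`). At a
donut, a disk that meets the hole crosses the boundary of the hole, as its center lies outside;
every other disk assigned there crosses the boundary of the outer cell. This gives `162 = 2 * 81`
cliques per node.

Running time. No tree is built. The centers are sorted in Z-order and stripped of duplicates. A node
on the search path of a disk is represented by its outer cell and the first and last position of a
level point in that cell. By the interval property, going down one level requires the insertion of
only three candidate positions (`PathState.Valid.next`), hence constant time, and a disk takes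
`O(log n)`. Each disk receives a label of six real numbers: the outer cell, the level, whether it is
treated with the hole, and the index of a grid point. Equality of labels means membership in the
same clique (`HasLabel.equiv_iff`, `isCliqueConstruction_of_labels`). Sorting the labels
lexicographically and numbering the classes yields the output. The program is written in a small
command language over named registers, which `Cmd.compile` translates to the machine with constant
slowdown. -/

theorem Cell.side_pos (σ : Cell) : 0 < σ.side := by
  unfold Cell.side; positivity

/-- The cell of level `ℓ` that contains `p`. -/
def cellAt (o : Point) (ℓ : ℤ) (p : Point) : Cell :=
  ⟨ℓ, ⌊(p.1 - o.1) / (2 : ℝ) ^ ℓ⌋, ⌊(p.2 - o.2) / (2 : ℝ) ^ ℓ⌋⟩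

theorem Cell.mem_toSet {o p : Point} {σ : Cell} : p ∈ σ.toSet o ↔
    (o.1 + σ.i * σ.side ≤ p.1 ∧ p.1 < o.1 + (σ.i + 1) * σ.side) ∧
    (o.2 + σ.j * σ.side ≤ p.2 ∧ p.2 < o.2 + (σ.j + 1) * σ.side) := by
  simp [Cell.toSet, Set.mem_prod]

/-- Membership becomes an equation between floors, which reduces the nesting of cells to integer
division. -/
theorem Cell.mem_iff_cellAt {o p : Point} {σ : Cell} :
    p ∈ σ.toSet o ↔ cellAt o σ.level p = σ := by
  have h := σ.side_pos
  rw [Cell.mem_toSet, Cell.ext_iff]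
  simp only [cellAt, true_and, Int.floor_eq_iff]
  change _ ↔ (_ ≤ _ / σ.side ∧ _ / σ.side < _) ∧ (_ ≤ _ / σ.side ∧ _ / σ.side < _)
  rw [le_div_iff₀ h, div_lt_iff₀ h, le_div_iff₀ h, div_lt_iff₀ h]
  constructor <;> rintro ⟨⟨_, _⟩, _, _⟩ <;> refine ⟨⟨?_, ?_⟩, ?_, ?_⟩ <;> linarith

theorem mem_cellAt (o : Point) (ℓ : ℤ) (p : Point) : p ∈ (cellAt o ℓ p).toSet o :=
  Cell.mem_iff_cellAt.2 rfl

theorem floor_div_zpow_add (x : ℝ) (ℓ : ℤ) (k : ℕ) :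
    ⌊x / (2 : ℝ) ^ (ℓ + k)⌋ = ⌊x / (2 : ℝ) ^ ℓ⌋ / ((2 ^ k : ℕ) : ℤ) := by
  rw [← Int.floor_div_natCast]
  congr 1
  rw [zpow_add₀ (by norm_num), div_mul_eq_div_div]
  push_cast
  simp

/-- The indices at a coarser level are integer quotients of those at a finer level. This is the
source of laminarity. -/
theorem cellAt_mono {o p q : Point} {ℓ ℓ' : ℤ} (h : cellAt o ℓ p = cellAt o ℓ q) (hl : ℓ ≤ ℓ') :
    cellAt o ℓ' p = cellAt o ℓ' q := by
  obtain ⟨k, rfl⟩ := Int.le.dest hl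
  simp only [cellAt, Cell.mk.injEq, true_and] at h ⊢
  simp only [floor_div_zpow_add, h, and_self]

theorem Cell.subset_of_level_le {o p : Point} {σ τ : Cell} (h1 : p ∈ σ.toSet o)
    (h2 : p ∈ τ.toSet o) (hl : σ.level ≤ τ.level) : σ.toSet o ⊆ τ.toSet o := by
  intro q hq
  rw [Cell.mem_iff_cellAt] at *
  rw [← h2]
  exact cellAt_mono (hq.trans h1.symm) hl

theorem Cell.eq_of_level_eq {o p : Point} {σ τ : Cell} (h1 : p ∈ σ.toSet o)
    (h2 : p ∈ τ.toSet o) (hl : σ.level = τ.level) : σ = τ := by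
  rw [Cell.mem_iff_cellAt] at *
  rw [← h1, ← h2, hl]

theorem Cell.corner_mem (o : Point) (σ : Cell) : σ.corner o ∈ σ.toSet o := by
  have := σ.side_pos
  rw [Cell.mem_toSet]
  simp only [Cell.corner]
  refine ⟨⟨le_rfl, ?_⟩, le_rfl, ?_⟩ <;> nlinarith

theorem Cell.side_quadrant (σ : Cell) (a : Fin 4) : (σ.quadrant a).side = σ.side / 2 := by
  simp only [Cell.side, Cell.quadrant]
  rw [zpow_sub_one₀ (by norm_num)]
  rfl

theorem Cell.level_quadrant (σ : Cell) (a : Fin 4) : (σ.quadrant a).level = σ.level - 1 := rfl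

theorem Cell.quadrant_injective (σ : Cell) : Function.Injective σ.quadrant := by
  intro a b h
  simp only [Cell.quadrant, Cell.mk.injEq, true_and, add_right_inj] at h
  fin_cases a <;> fin_cases b <;> simp_all

theorem Cell.exists_quadrant {o p : Point} {τ : Cell} (h : p ∈ τ.toSet o) :
    ∃ a, p ∈ (τ.quadrant a).toSet o := by
  have hs := τ.side_pos
  simp only [Cell.mem_toSet, Cell.side_quadrant] at *
  obtain ⟨⟨h1, h2⟩, h3, h4⟩ := h
  by_cases hx : o.1 + (τ.i + 1 / 2) * τ.side ≤ p.1 <;>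
    by_cases hy : o.2 + (τ.j + 1 / 2) * τ.side ≤ p.2
  · refine ⟨1, ⟨?_, ?_⟩, ?_, ?_⟩ <;> simp [Cell.quadrant] <;> linarith
  · refine ⟨3, ⟨?_, ?_⟩, ?_, ?_⟩ <;> simp [Cell.quadrant] <;> linarith
  · refine ⟨0, ⟨?_, ?_⟩, ?_, ?_⟩ <;> simp [Cell.quadrant] <;> linarith
  · refine ⟨2, ⟨?_, ?_⟩, ?_, ?_⟩ <;> simp [Cell.quadrant] <;> linarith

theorem Cell.quadrant_subset (o : Point) (τ : Cell) (a : Fin 4) :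
    (τ.quadrant a).toSet o ⊆ τ.toSet o := by
  intro p h
  have hs := τ.side_pos
  simp only [Cell.mem_toSet, Cell.side_quadrant] at *
  obtain ⟨⟨h1, h2⟩, h3, h4⟩ := h
  refine ⟨⟨?_, ?_⟩, ?_, ?_⟩ <;> fin_cases a <;> simp [Cell.quadrant] at * <;> linarith

theorem Cell.quadrant_unique {o p : Point} {τ : Cell} {a b : Fin 4}
    (ha : p ∈ (τ.quadrant a).toSet o) (hb : p ∈ (τ.quadrant b).toSet o) : a = b :=
  τ.quadrant_injective (Cell.eq_of_level_eq ha hb rfl)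

theorem Cell.subset_quadrant {o p : Point} {σ τ : Cell} {a : Fin 4} (h1 : p ∈ σ.toSet o)
    (h2 : p ∈ (τ.quadrant a).toSet o) (hl : σ.level < τ.level) :
    σ.toSet o ⊆ (τ.quadrant a).toSet o :=
  Cell.subset_of_level_le h1 h2 (by rw [Cell.level_quadrant]; omega)

/-- If `τ` had smaller level, it would fit into one quadrant of `σ` and miss the corners of the
others. -/
theorem Cell.level_le_of_subset {o : Point} {σ τ : Cell} (h : σ.toSet o ⊆ τ.toSet o) :
    σ.level ≤ τ.level := by
  by_contra hl
  push Not at hl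
  have hc := σ.corner_mem o
  obtain ⟨a, ha⟩ := Cell.exists_quadrant hc
  have h1 := Cell.subset_quadrant (h hc) ha hl
  obtain ⟨b, hb⟩ := exists_ne a
  have h2 := (σ.quadrant b).corner_mem o
  exact hb (Cell.quadrant_unique h2 (h1 (h (σ.quadrant_subset o b h2))))

theorem Cell.toSet_injective (o : Point) : Function.Injective (Cell.toSet o) := by
  intro σ τ h
  exact Cell.eq_of_level_eq (σ.corner_mem o) (h ▸ σ.corner_mem o)
    (le_antisymm (Cell.level_le_of_subset h.le) (Cell.level_le_of_subset h.ge))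

theorem Cell.not_subset_quadrant (o : Point) (σ : Cell) (a : Fin 4) :
    ¬ σ.toSet o ⊆ (σ.quadrant a).toSet o := by
  intro h
  have := Cell.level_le_of_subset h
  rw [Cell.level_quadrant] at this
  omega

theorem IsSmallestCell.unique {o : Point} {P : Set Point} {τ τ' : Cell}
    (h : IsSmallestCell o P τ) (h' : IsSmallestCell o P τ') : τ = τ' :=
  Cell.toSet_injective o (Set.Subset.antisymm (h.2 _ h'.1) (h'.2 _ h.1))

theorem IsSmallestCell.not_subset_quadrant {o : Point} {P : Set Point} {τ : Cell}
    (h : IsSmallestCell o P τ) (a : Fin 4) : ¬ P ⊆ (τ.quadrant a).toSet o :=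
  fun h' => τ.not_subset_quadrant o a (h.2 _ h')

/-- A cell of smaller level around `p` stays inside the quadrant of `p` and misses `q`. This is the
working criterion for smallest cells. -/
theorem isSmallestCell_of_quadrant_ne {o p q : Point} {P : Set Point} {τ : Cell} {a b : Fin 4}
    (hP : P ⊆ τ.toSet o) (hp : p ∈ P) (hq : q ∈ P) (ha : p ∈ (τ.quadrant a).toSet o)
    (hb : q ∈ (τ.quadrant b).toSet o) (hab : a ≠ b) : IsSmallestCell o P τ := by
  refine ⟨hP, fun τ' h => ?_⟩
  by_contra hn
  have hl : τ'.level < τ.level := by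
    by_contra hl
    push Not at hl
    exact hn (Cell.subset_of_level_le (hP hp) (h hp) hl)
  exact hab (Cell.quadrant_unique (Cell.subset_quadrant (h hp) ha hl (h hq)) hb)

theorem cellAt_ne_of_ne {o p q : Point} (h : p ≠ q) :
    ∃ b : ℤ, ∀ ℓ, cellAt o ℓ p = cellAt o ℓ q → b ≤ ℓ := by
  have hd : 0 < max |p.1 - q.1| |p.2 - q.2| := by
    by_contra hn
    push Not at hn
    have h1 := (le_max_left _ _).trans hn
    have h2 := (le_max_right _ _).trans hn
    exact h (Prod.ext (sub_eq_zero.1 (abs_nonpos_iff.1 h1)) (sub_eq_zero.1 (abs_nonpos_iff.1 h2)))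
  -- A common cell of level `-b` would force both coordinate differences to be at most `2 ^ (-b)`.
  obtain ⟨b, hb⟩ := exists_pow_lt_of_lt_one hd (by norm_num : (1 / 2 : ℝ) < 1)
  refine ⟨-b, fun ℓ hl => ?_⟩
  by_contra hlt
  push Not at hlt
  have h1 := cellAt_mono hl hlt.le
  have hp := mem_cellAt o (-b) p
  have hq := mem_cellAt o (-b) q
  rw [← h1] at hq
  have hs : (cellAt o (-(b : ℤ)) p).side = (1 / 2 : ℝ) ^ b := by simp [Cell.side, cellAt]
  rw [Cell.mem_toSet, hs] at hp hq
  obtain ⟨⟨_, _⟩, _, _⟩ := hp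
  obtain ⟨⟨_, _⟩, _, _⟩ := hq
  have : max |p.1 - q.1| |p.2 - q.2| ≤ (1 / 2) ^ b := by
    refine max_le (abs_le.2 ⟨?_, ?_⟩) (abs_le.2 ⟨?_, ?_⟩) <;> linarith
  linarith

/-- Two distinct points bound the level of a common cell from below, so a least level exists. A
containing cell has to be given: points on different sides of a coordinate axis through `o` lie in
no common cell at any level. -/
theorem exists_isSmallestCell {o : Point} {P : Set Point} {σ : Cell} (hP : P.Nontrivial)
    (h : P ⊆ σ.toSet o) : ∃ τ, IsSmallestCell o P τ := by
  obtain ⟨p, hp, q, hq, hpq⟩ := hP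
  obtain ⟨b, hb⟩ := cellAt_ne_of_ne (o := o) hpq
  obtain ⟨ℓ, hl, hmin⟩ := Int.exists_least_of_bdd (P := fun ℓ => P ⊆ (cellAt o ℓ p).toSet o)
    ⟨b, fun ℓ hl => hb ℓ (Cell.mem_iff_cellAt.1 (hl hq)).symm⟩
    ⟨σ.level, by rw [Cell.mem_iff_cellAt.1 (h hp)]; exact h⟩
  refine ⟨_, hl, fun τ hτ => ?_⟩
  refine Cell.subset_of_level_le (hl hp) (hτ hp) (hmin τ.level ?_)
  rw [Cell.mem_iff_cellAt.1 (hτ hp)]; exact hτ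

theorem IsSmallestCell.exists_quadrant_ne {o p q : Point} {τ : Cell}
    (h : IsSmallestCell o {p, q} τ) : ∃ a b, p ∈ (τ.quadrant a).toSet o ∧
      q ∈ (τ.quadrant b).toSet o ∧ a ≠ b := by
  obtain ⟨a, ha⟩ := Cell.exists_quadrant (h.1 (by simp : p ∈ ({p, q} : Set Point)))
  obtain ⟨b, hb⟩ := Cell.exists_quadrant (h.1 (by simp : q ∈ ({p, q} : Set Point)))
  refine ⟨a, b, ha, hb, ?_⟩
  rintro rfl
  exact h.not_subset_quadrant a (by rintro x (rfl | rfl) <;> assumption)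

/-! ## The Z-order -/

theorem Cell.subset_or_subset {o p : Point} {σ τ : Cell} (h1 : p ∈ σ.toSet o)
    (h2 : p ∈ τ.toSet o) : σ.toSet o ⊆ τ.toSet o ∨ τ.toSet o ⊆ σ.toSet o :=
  (le_total σ.level τ.level).imp (Cell.subset_of_level_le h1 h2) (Cell.subset_of_level_le h2 h1)

theorem ZLt.isSmallestCell {o p q : Point} {σ : Cell} {a b : Fin 4} (hab : a ≠ b)
    (hp : p ∈ (σ.quadrant a).toSet o) (hq : q ∈ (σ.quadrant b).toSet o) :
    IsSmallestCell o {p, q} σ := by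
  refine isSmallestCell_of_quadrant_ne ?_ (by simp) (by simp) hp hq hab
  rintro x (rfl | rfl)
  exacts [σ.quadrant_subset o a hp, σ.quadrant_subset o b hq]

theorem ZLt.ne {o p q : Point} (h : ZLt o p q) : p ≠ q := by
  rintro rfl
  obtain ⟨σ, a, b, hab, hp, hq⟩ := h
  exact hab.ne (Cell.quadrant_unique hp hq)

theorem ZLt.asymm {o p q : Point} (h : ZLt o p q) : ¬ ZLt o q p := by
  obtain ⟨σ, a, b, hab, hp, hq⟩ := h
  rintro ⟨σ', a', b', hab', hp', hq'⟩
  have h1 := ZLt.isSmallestCell hab.ne hp hq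
  have h2 := ZLt.isSmallestCell hab'.ne hp' hq'
  rw [Set.pair_comm] at h2
  obtain rfl := h1.unique h2
  obtain rfl := Cell.quadrant_unique hp hq'
  obtain rfl := Cell.quadrant_unique hp' hq
  exact lt_asymm hab hab'

/-- The coarser of the two separating cells separates `p` from `r` as well, because the finer one
lies in a single quadrant of it. At equal levels the two cells coincide. -/
theorem ZLt.trans {o p q r : Point} (h : ZLt o p q) (h' : ZLt o q r) : ZLt o p r := by
  obtain ⟨σ, a, b, hab, hp, hq⟩ := h
  obtain ⟨σ', a', b', hab', hq', hr⟩ := h'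
  rcases lt_trichotomy σ.level σ'.level with hl | hl | hl
  · exact ⟨σ', a', b', hab',
      Cell.subset_quadrant (σ.quadrant_subset o _ hq) hq' hl (σ.quadrant_subset o _ hp), hr⟩
  · obtain rfl := Cell.eq_of_level_eq (σ.quadrant_subset o _ hq) (σ'.quadrant_subset o _ hq') hl
    obtain rfl := Cell.quadrant_unique hq hq'
    exact ⟨σ, a, b', hab.trans hab', hp, hr⟩
  · exact ⟨σ, a, b, hab, hp,
      Cell.subset_quadrant (σ'.quadrant_subset o _ hq') hq hl (σ'.quadrant_subset o _ hr)⟩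

theorem ZLt.total {o p q : Point} {σ : Cell} (hp : p ∈ σ.toSet o) (hq : q ∈ σ.toSet o)
    (h : p ≠ q) : ZLt o p q ∨ ZLt o q p := by
  obtain ⟨τ, hτ⟩ := exists_isSmallestCell (P := {p, q}) (σ := σ)
    ⟨p, by simp, q, by simp, h⟩ (by rintro x (rfl | rfl) <;> assumption)
  obtain ⟨a, b, ha, hb, hab⟩ := hτ.exists_quadrant_ne
  rcases lt_or_gt_of_ne hab with h | h
  exacts [Or.inl ⟨τ, a, b, h, ha, hb⟩, Or.inr ⟨τ, b, a, h, hb, ha⟩]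

/-- Cells are convex in the Z-order. If `q` were outside `σ`, the cell separating `p` and `q` would
be larger than `σ`, so `r` would lie in the same quadrant as `p`. That cell would also separate `q`
from `r`, in the wrong order. -/
theorem ZLt.mem_of_between {o p q r : Point} {σ : Cell} (hpq : ZLt o p q) (hqr : ZLt o q r)
    (hp : p ∈ σ.toSet o) (hr : r ∈ σ.toSet o) : q ∈ σ.toSet o := by
  by_contra hn
  obtain ⟨τ, a, b, hab, ha, hb⟩ := hpq
  obtain ⟨τ', b', c, hbc, hb', hc⟩ := hqr
  have hpτ := τ.quadrant_subset o _ ha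
  have hl : σ.level < τ.level := by
    by_contra hl
    push Not at hl
    exact hn (Cell.subset_of_level_le hpτ hp hl (τ.quadrant_subset o _ hb))
  have hra := Cell.subset_quadrant hp ha hl hr
  have h1 := ZLt.isSmallestCell hab.ne' hb hra
  obtain rfl := h1.unique (ZLt.isSmallestCell hbc.ne hb' hc)
  obtain rfl := Cell.quadrant_unique hb hb'
  obtain rfl := Cell.quadrant_unique hra hc
  exact lt_asymm hab hbc

end

noncomputable section

/-! ## The regions of a compressed quadtree -/

/-- `σ` is the root cell `σ₀` or a quadrant of the smallest cell containing some points of `Q`. -/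
def IsNode (o : Point) (σ₀ : Cell) (Q : Set Point) (σ : Cell) : Prop :=
  σ = σ₀ ∨ ∃ (τ : Cell) (a : Fin 4), (Q ∩ τ.toSet o).Nontrivial ∧
    IsSmallestCell o (Q ∩ τ.toSet o) τ ∧ σ = τ.quadrant a

/-- `R` is the region left at a cell `σ` when the tree below it is cut off. -/
def IsRegionOf (o : Point) (Q : Set Point) (σ : Cell) (R : Region) : Prop :=
  ((Q ∩ σ.toSet o).Subsingleton ∧ R = .cell σ) ∨
    ∃ τ, (Q ∩ σ.toSet o).Nontrivial ∧ IsSmallestCell o (Q ∩ σ.toSet o) τ ∧ τ ≠ σ ∧ R = .donut σ τ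

/-- The cell or the outer cell of a region. -/
def Region.outer : Region → Cell
  | .cell σ => σ
  | .donut σ _ => σ

theorem IsRegionOf.outer_eq {o : Point} {Q : Set Point} {σ : Cell} {R : Region}
    (h : IsRegionOf o Q σ R) : R.outer = σ := by
  rcases h with ⟨_, rfl⟩ | ⟨τ, _, _, _, rfl⟩ <;> rfl

theorem IsRegionOf.unique {o : Point} {Q : Set Point} {σ : Cell} {R R' : Region}
    (h : IsRegionOf o Q σ R) (h' : IsRegionOf o Q σ R') : R = R' := by
  rcases h with ⟨h1, rfl⟩ | ⟨τ, h1, h2, h3, rfl⟩ <;>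
    rcases h' with ⟨h1', rfl⟩ | ⟨τ', h1', h2', h3', rfl⟩
  · rfl
  · exact absurd h1 (Set.not_subsingleton_iff.2 h1')
  · exact absurd h1' (Set.not_subsingleton_iff.2 h1)
  · rw [h2.unique h2']

theorem Region.toSet_subset_outer (o : Point) (R : Region) : R.toSet o ⊆ R.outer.toSet o := by
  cases R
  · exact subset_rfl
  · exact Set.sdiff_subset

theorem IsSmallestCell.mono {o : Point} {Q Q' : Set Point} {τ : Cell} (hQ : Q ⊆ Q')
    (h : IsSmallestCell o (Q ∩ τ.toSet o) τ) : IsSmallestCell o (Q' ∩ τ.toSet o) τ :=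
  ⟨Set.inter_subset_right, fun τ' h' => h.2 τ' ((Set.inter_subset_inter_left _ hQ).trans h')⟩

/-- A cell that branches on few points still branches on more, so the cells of one level of the skip
quadtree reappear at all levels below. -/
theorem IsNode.mono {o : Point} {σ₀ σ : Cell} {Q Q' : Set Point} (hQ : Q ⊆ Q')
    (h : IsNode o σ₀ Q σ) : IsNode o σ₀ Q' σ := by
  rcases h with rfl | ⟨τ, a, h1, h2, rfl⟩
  · exact Or.inl rfl
  · exact Or.inr ⟨τ, a, h1.mono (Set.inter_subset_inter_left _ hQ), h2.mono hQ, rfl⟩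

theorem IsNode.subset {o : Point} {σ₀ σ : Cell} {Q : Set Point} (hQ : Q ⊆ σ₀.toSet o)
    (h : IsNode o σ₀ Q σ) : σ.toSet o ⊆ σ₀.toSet o := by
  rcases h with rfl | ⟨τ, a, h1, h2, rfl⟩
  · exact subset_rfl
  · exact (τ.quadrant_subset o a).trans (h2.2 _ (Set.inter_subset_left.trans hQ))

theorem IsLeafRegion.exists_isNode {o : Point} {σ₀ : Cell} {Q : Set Point} {R : Region}
    (h : IsLeafRegion o σ₀ Q R) (hQ : Q ⊆ σ₀.toSet o) :
    ∃ σ, IsNode o σ₀ Q σ ∧ IsRegionOf o Q σ R := by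
  induction h with
  | single hP => exact ⟨_, Or.inl rfl, Or.inl ⟨hP.anti Set.inter_subset_left, rfl⟩⟩
  | donut hP hτ hne =>
    refine ⟨_, Or.inl rfl, Or.inr ⟨_, ?_, ?_, hne, rfl⟩⟩ <;>
      rwa [Set.inter_eq_left.2 hQ]
  | @descend σ τ P R hP hτ a h ih =>
    obtain ⟨ρ, h1, h2⟩ := ih Set.inter_subset_right
    have hρ := h1.subset Set.inter_subset_right
    refine ⟨ρ, ?_, ?_⟩
    · rcases h1 with rfl | h1
      · refine Or.inr ⟨τ, a, ?_, ?_, rfl⟩ <;> rwa [Set.inter_eq_left.2 hτ.1]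
      · exact (IsNode.mono Set.inter_subset_left (σ₀ := σ) (Or.inr h1))
    · rwa [IsRegionOf, Set.inter_assoc, Set.inter_eq_right.2 hρ] at h2

/-- Induction on the number of points. The branching cell above `σ` is either the smallest cell `ρ`
of `Q`, and one descent suffices, or it lies in a quadrant of `ρ`, which holds fewer points because
`ρ` is smallest. -/
theorem IsNode.isLeafRegion_of_inter {o : Point} {σ₀ σ : Cell} {Q : Set Point} {R : Region}
    (hfin : Q.Finite) (hQ : Q ⊆ σ₀.toSet o) (h : IsNode o σ₀ Q σ)
    (hR : IsLeafRegion o σ (Q ∩ σ.toSet o) R) : IsLeafRegion o σ₀ Q R := by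
  induction hn : Q.ncard using Nat.strong_induction_on generalizing Q σ₀ with
  | _ n ih =>
  rcases h with rfl | ⟨τ, a, h1, h2, rfl⟩
  · rwa [Set.inter_eq_left.2 hQ] at hR
  · have hnt := h1.mono Set.inter_subset_left
    obtain ⟨ρ, hρ⟩ := exists_isSmallestCell hnt hQ
    have hτρ : τ.toSet o ⊆ ρ.toSet o := h2.2 _ (Set.inter_subset_left.trans hρ.1)
    by_cases he : τ = ρ
    · subst he
      exact .descend hnt hρ a hR
    · obtain ⟨b, hb⟩ := Cell.exists_quadrant (hτρ (τ.corner_mem o))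
      have hl : τ.level < ρ.level := by
        refine lt_of_le_of_ne (Cell.level_le_of_subset hτρ) fun hl => he ?_
        exact Cell.eq_of_level_eq (τ.corner_mem o) (hτρ (τ.corner_mem o)) hl
      have hτb := Cell.subset_quadrant (τ.corner_mem o) hb hl
      have e1 : Q ∩ (ρ.quadrant b).toSet o ∩ τ.toSet o = Q ∩ τ.toSet o := by
        rw [Set.inter_assoc, Set.inter_eq_right.2 hτb]
      have e2 : Q ∩ (ρ.quadrant b).toSet o ∩ (τ.quadrant a).toSet o =
          Q ∩ (τ.quadrant a).toSet o := by
        rw [Set.inter_assoc, Set.inter_eq_right.2 ((τ.quadrant_subset o a).trans hτb)]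
      refine .descend hnt hρ b (ih _ ?_ (hfin.subset Set.inter_subset_left)
        Set.inter_subset_right (Or.inr ⟨τ, a, ?_, ?_, rfl⟩) ?_ rfl)
      · rw [← hn]
        refine Set.ncard_lt_ncard ⟨Set.inter_subset_left, fun h => ?_⟩ hfin
        exact hρ.not_subset_quadrant b (h.trans Set.inter_subset_right)
      · rwa [e1]
      · rwa [e1]
      · rwa [e2]

/-- The recursive tree is replaced by a local description, which only looks at a cell and the points
in it. Different levels can be compared and the search verified without following recursions. -/
theorem isLeafRegion_iff {o : Point} {σ₀ : Cell} {Q : Set Point} {R : Region} (hfin : Q.Finite)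
    (hQ : Q ⊆ σ₀.toSet o) :
    IsLeafRegion o σ₀ Q R ↔ ∃ σ, IsNode o σ₀ Q σ ∧ IsRegionOf o Q σ R := by
  refine ⟨fun h => h.exists_isNode hQ, fun ⟨σ, h1, h2⟩ => h1.isLeafRegion_of_inter hfin hQ ?_⟩
  rcases h2 with ⟨h3, rfl⟩ | ⟨τ, h3, h4, h5, rfl⟩
  exacts [.single h3, .donut h3 h4 h5]

/-- The regions at a cell and at a proper subcell are disjoint. -/
theorem IsNode.eq_of_mem {o p : Point} {σ₀ σ σ' : Cell} {Q : Set Point} {R : Region}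
    (hQ : Q ⊆ σ₀.toSet o) (hσ : IsNode o σ₀ Q σ) (hp : p ∈ σ.toSet o) (hσ' : σ'.toSet o ⊆ σ₀.toSet o)
    (hR : IsRegionOf o Q σ' R) (hpR : p ∈ R.toSet o) (hsub : σ.toSet o ⊆ σ'.toSet o) : σ = σ' := by
  by_contra hne
  have hl : σ.level < σ'.level := by
    refine lt_of_le_of_ne (Cell.level_le_of_subset hsub) fun hl => hne ?_
    exact Cell.eq_of_level_eq hp (hsub hp) hl
  rcases hσ with rfl | ⟨τ, a, h1, h2, rfl⟩
  · exact hne (Cell.toSet_injective o (hsub.antisymm hσ'))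
  -- A node cell strictly below `σ'` is a quadrant of a branching cell `τ` inside `σ'`. So `σ'`
  -- contains two points, its region is a donut, and `τ` lies in the hole.
  · have hτ : τ.toSet o ⊆ σ'.toSet o := by
      refine Cell.subset_of_level_le (τ.quadrant_subset o a hp) (hsub hp) ?_
      rw [Cell.level_quadrant] at hl
      omega
    have h3 : Q ∩ τ.toSet o ⊆ Q ∩ σ'.toSet o := Set.inter_subset_inter_right _ hτ
    rcases hR with ⟨h4, rfl⟩ | ⟨τ', h4, h5, h6, rfl⟩
    · exact absurd (h1.mono h3) (Set.not_nontrivial_iff.2 h4)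
    · exact hpR.2 (h2.2 _ (h3.trans h5.1) (τ.quadrant_subset o a hp))

theorem IsLeafRegion.unique {o p : Point} {σ₀ : Cell} {Q : Set Point} {R R' : Region}
    (hQ : Q ⊆ σ₀.toSet o) (h : IsLeafRegion o σ₀ Q R) (h' : IsLeafRegion o σ₀ Q R')
    (hp : p ∈ R.toSet o) (hp' : p ∈ R'.toSet o) : R = R' := by
  obtain ⟨σ, h1, h2⟩ := h.exists_isNode hQ
  obtain ⟨σ', h1', h2'⟩ := h'.exists_isNode hQ
  have hs : p ∈ σ.toSet o := h2.outer_eq ▸ R.toSet_subset_outer o hp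
  have hs' : p ∈ σ'.toSet o := h2'.outer_eq ▸ R'.toSet_subset_outer o hp'
  have : σ = σ' := by
    rcases Cell.subset_or_subset hs hs' with hl | hl
    · exact h1.eq_of_mem hQ hs (h1'.subset hQ) h2' hp' hl
    · exact (h1'.eq_of_mem hQ hs' (h1.subset hQ) h2 hp hl).symm
  subst this
  exact h2.unique h2'

theorem exists_isLeafRegion {o p : Point} {σ₀ : Cell} {Q : Set Point} (hfin : Q.Finite)
    (hQ : Q ⊆ σ₀.toSet o) (hp : p ∈ σ₀.toSet o) : ∃ R, IsLeafRegion o σ₀ Q R ∧ p ∈ R.toSet o := by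
  induction hn : Q.ncard using Nat.strong_induction_on generalizing Q σ₀ with
  | _ n ih =>
  rcases Q.subsingleton_or_nontrivial with h | h
  · exact ⟨_, .single h, hp⟩
  · obtain ⟨τ, hτ⟩ := exists_isSmallestCell h hQ
    by_cases hpτ : p ∈ τ.toSet o
    · obtain ⟨a, ha⟩ := Cell.exists_quadrant hpτ
      obtain ⟨R, h1, h2⟩ := ih (Q ∩ (τ.quadrant a).toSet o).ncard (by
        rw [← hn]
        refine Set.ncard_lt_ncard ⟨Set.inter_subset_left, fun h => ?_⟩ hfin
        exact hτ.not_subset_quadrant a (h.trans Set.inter_subset_right))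
        (hfin.subset Set.inter_subset_left) Set.inter_subset_right ha rfl
      exact ⟨R, .descend h hτ a h1, h2⟩
    · refine ⟨_, .donut h hτ ?_, hp, hpτ⟩
      rintro rfl
      exact hpτ hp

/-! ## The smallest cell containing two points -/

open Classical in
/-- The smallest cell containing both `p` and `q`, if there is one. -/
def lcc (o p q : Point) : Cell :=
  if h : ∃ τ, IsSmallestCell o {p, q} τ then h.choose else ⟨0, 0, 0⟩

theorem lcc_eq {o p q : Point} {τ : Cell} (h : IsSmallestCell o {p, q} τ) : lcc o p q = τ := by
  have h' : ∃ τ, IsSmallestCell o {p, q} τ := ⟨τ, h⟩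
  rw [lcc, dif_pos h']
  exact h'.choose_spec.unique h

theorem isSmallestCell_lcc {o p q : Point} {σ : Cell} (hp : p ∈ σ.toSet o) (hq : q ∈ σ.toSet o)
    (h : p ≠ q) : IsSmallestCell o {p, q} (lcc o p q) := by
  obtain ⟨τ, hτ⟩ := exists_isSmallestCell (P := {p, q}) (σ := σ)
    ⟨p, by simp, q, by simp, h⟩ (by rintro x (rfl | rfl) <;> assumption)
  rwa [lcc_eq hτ]

/-- A nontrivial set has the same smallest cell as two of its points. -/
theorem IsSmallestCell.exists_pair {o : Point} {Q : Set Point} {τ : Cell}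
    (h : IsSmallestCell o Q τ) (hQ : Q.Nontrivial) :
    ∃ p ∈ Q, ∃ q ∈ Q, p ≠ q ∧ IsSmallestCell o {p, q} τ := by
  obtain ⟨p, hp⟩ := hQ.nonempty
  obtain ⟨a, ha⟩ := Cell.exists_quadrant (h.1 hp)
  obtain ⟨q, hq, hqa⟩ := Set.not_subset.1 (h.not_subset_quadrant a)
  obtain ⟨b, hb⟩ := Cell.exists_quadrant (h.1 hq)
  have hab : a ≠ b := by
    rintro rfl
    exact hqa hb
  refine ⟨p, hp, q, hq, ?_, ZLt.isSmallestCell hab ha hb⟩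
  rintro rfl
  exact hqa ha

end

/-! ### Consecutive levels of the skip quadtree and the bound on the ply -/

noncomputable section

/-! ## The levels of a skip quadtree -/

theorem getElem?_halve {α : Type} (l : List α) (m : ℕ) : (halve l)[m]? = l[2 * m + 1]? := by
  induction l using halve.induct generalizing m with
  | case1 => simp [halve]
  | case2 => simp [halve]
  | case3 a b l ih =>
    cases m with
    | zero => simp [halve]
    | succ m => simp [halve, ih, show 2 * (m + 1) + 1 = (2 * m + 1) + 1 + 1 by ring]

/-- Halving keeps the even positions when positions are counted from 1, so `i` halvings keep the
multiples of `2 ^ i`. -/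
theorem getElem?_iterate_halve {α : Type} (l : List α) (i m : ℕ) :
    (halve^[i] l)[m]? = l[(m + 1) * 2 ^ i - 1]? := by
  induction i generalizing m with
  | zero => simp
  | succ i ih =>
    rw [Function.iterate_succ_apply', getElem?_halve, ih]
    congr 1
    ring_nf

/-- The point at position `u` of a list, positions being counted from `1`. -/
def pnt (l : List Point) (u : ℕ) : Point := l.getD (u - 1) 0

theorem mem_levelPoints {l : List Point} {i : ℕ} {p : Point} :
    p ∈ levelPoints l i ↔ ∃ u, 1 ≤ u ∧ u ≤ l.length ∧ 2 ^ i ∣ u ∧ pnt l u = p := by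
  simp only [levelPoints, Set.mem_ofPred_eq, List.mem_iff_getElem?, getElem?_iterate_halve]
  constructor
  · rintro ⟨m, hm⟩
    obtain ⟨h1, h2⟩ := List.getElem?_eq_some_iff.1 hm
    have : 0 < (m + 1) * 2 ^ i := by positivity
    refine ⟨(m + 1) * 2 ^ i, this, by omega, Dvd.intro_left _ rfl, ?_⟩
    rw [pnt, List.getD_eq_getElem?_getD, hm]
    rfl
  · rintro ⟨u, h1, h2, ⟨m, rfl⟩, h3⟩
    have hm : m ≠ 0 := by
      rintro rfl
      simp at h1
    obtain ⟨m, rfl⟩ : ∃ m', m = m' + 1 := ⟨m - 1, by omega⟩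
    refine ⟨m, ?_⟩
    rw [mul_comm] at h1 h2 h3
    rw [← h3, pnt, List.getD_eq_getElem?_getD, List.getElem?_eq_getElem (by omega)]
    rfl

theorem levelPoints_anti (l : List Point) {i i' : ℕ} (h : i ≤ i') :
    levelPoints l i' ⊆ levelPoints l i := by
  intro p hp
  obtain ⟨u, h1, h2, h3, h4⟩ := mem_levelPoints.1 hp
  exact mem_levelPoints.2 ⟨u, h1, h2, (pow_dvd_pow 2 h).trans h3, h4⟩

theorem levelPoints_finite (l : List Point) (i : ℕ) : (levelPoints l i).Finite :=
  List.finite_toSet _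

theorem levelPoints_top (l : List Point) : levelPoints l (Nat.log 2 l.length + 1) = ∅ := by
  refine Set.eq_empty_iff_forall_notMem.2 fun p hp => ?_
  obtain ⟨u, h1, h2, h3, -⟩ := mem_levelPoints.1 hp
  have := Nat.le_of_dvd (by omega) h3
  have := Nat.lt_pow_succ_log_self (b := 2) (by norm_num) l.length
  omega

theorem levelPoints_subset {l : List Point} {σ₀ : Cell} {o : Point}
    (h : ∀ p ∈ l, p ∈ σ₀.toSet o) (i : ℕ) : levelPoints l i ⊆ σ₀.toSet o :=
  fun p hp => h p (levelPoints_anti l (Nat.zero_le i) hp)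

theorem zLt_pnt {o : Point} {l : List Point} (hl : l.Pairwise (ZLt o)) {u v : ℕ} (h1 : 1 ≤ u)
    (h2 : u < v) (h3 : v ≤ l.length) : ZLt o (pnt l u) (pnt l v) := by
  rw [pnt, pnt, List.getD_eq_getElem _ _ (by omega), List.getD_eq_getElem _ _ (by omega)]
  exact List.pairwise_iff_getElem.1 hl _ _ _ _ (by omega)

theorem pnt_injective {o : Point} {l : List Point} (hl : l.Pairwise (ZLt o)) {u v : ℕ}
    (h1 : 1 ≤ u) (h2 : u ≤ l.length) (h3 : 1 ≤ v) (h4 : v ≤ l.length) (h : pnt l u = pnt l v) :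
    u = v := by
  rcases lt_trichotomy u v with h' | h' | h'
  · exact absurd h (zLt_pnt hl h1 h' h4).ne
  · exact h'
  · exact absurd h.symm (zLt_pnt hl h3 h' h2).ne

/-- `u` is a position in `l`, and its point lies in `σ`. -/
def PosIn (o : Point) (l : List Point) (σ : Cell) (u : ℕ) : Prop :=
  1 ≤ u ∧ u ≤ l.length ∧ pnt l u ∈ σ.toSet o

theorem PosIn.between {o : Point} {l : List Point} (hl : l.Pairwise (ZLt o)) {σ : Cell}
    {u v w : ℕ} (hu : PosIn o l σ u) (hw : PosIn o l σ w) (h1 : u ≤ v) (h2 : v ≤ w) :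
    PosIn o l σ v := by
  refine ⟨hu.1.trans h1, h2.trans hw.2.1, ?_⟩
  rcases h1.eq_or_lt with rfl | h1
  · exact hu.2.2
  rcases h2.eq_or_lt with rfl | h2
  · exact hw.2.2
  exact (zLt_pnt hl hu.1 h1 (h2.le.trans hw.2.1)).mem_of_between
    (zLt_pnt hl (hu.1.trans h1.le) h2 hw.2.1) hu.2.2 hw.2.2

/-- `f` and `g` are the extreme multiples of `2 * w` in `σ`. A multiple `u < f` of `w` other than `f
- w` is at most `f - 2 * w`. By convexity `f - 2 * w` then also belongs to `σ`, against the choice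
of `f`. The argument above `g` is symmetric. -/
theorem PosIn.refine {o : Point} {l : List Point} (hl : l.Pairwise (ZLt o)) {σ : Cell}
    {w f g u : ℕ} (hf : PosIn o l σ f) (hg : PosIn o l σ g)
    (hfd : 2 * w ∣ f) (hgd : 2 * w ∣ g) (hmin : ∀ v, 2 * w ∣ v → PosIn o l σ v → f ≤ v ∧ v ≤ g)
    (hu : PosIn o l σ u) (hud : w ∣ u) : u + w = f ∨ u = g + w ∨ (f ≤ u ∧ u ≤ g) := by
  obtain ⟨a, rfl⟩ := hud
  obtain ⟨b, rfl⟩ := hfd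
  obtain ⟨c, rfl⟩ := hgd
  by_contra hn
  push Not at hn
  obtain ⟨h1, h2, h3⟩ := hn
  rcases lt_or_ge (w * a) (2 * w * b) with h | h
  · have h4 : a < 2 * b := by
      have : w * a < w * (2 * b) := by linarith
      exact Nat.lt_of_mul_lt_mul_left this
    have h5 : a + 1 ≠ 2 * b := fun h => h1 (by linear_combination w * h)
    obtain ⟨b, rfl⟩ : ∃ b', b = b' + 1 := ⟨b - 1, by omega⟩
    have h6 : w * a ≤ w * (2 * b) := Nat.mul_le_mul_left _ (by omega)
    have h7 : 2 * w * b ≤ 2 * w * (b + 1) := Nat.mul_le_mul_left _ (by omega)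
    have h8 := hmin (2 * w * b) (Dvd.intro _ rfl) (hu.between hl hf (by linarith) h7)
    have : 0 < w := Nat.pos_of_ne_zero (by rintro rfl; simp at h)
    nlinarith
  · have h := h3 h
    have h4 : 2 * c < a := by
      have : w * (2 * c) < w * a := by linarith
      exact Nat.lt_of_mul_lt_mul_left this
    have h5 : a ≠ 2 * c + 1 := fun h => h2 (by subst h; ring)
    have h6 : w * (2 * (c + 1)) ≤ w * a := Nat.mul_le_mul_left _ (by omega)
    have h7 : 2 * w * c ≤ 2 * w * (c + 1) := Nat.mul_le_mul_left _ (by omega)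
    have h8 := hmin (2 * w * (c + 1)) (Dvd.intro _ rfl) (hg.between hl hu h7 (by linarith))
    have : 0 < w := Nat.pos_of_ne_zero (by rintro rfl; simp at h)
    nlinarith

/-- The positions in `σ` form an interval around `j` that contains no multiple of `2 * w`, so it
fits strictly between `c` and `c + 2 * w`. The midpoint is the only multiple of `w` there. -/
theorem PosIn.refine_empty {o : Point} {l : List Point} (hl : l.Pairwise (ZLt o)) {σ : Cell}
    {w c j u : ℕ} (hnone : ∀ v, 2 * w ∣ v → ¬ PosIn o l σ v) (hj : PosIn o l σ j)
    (hcd : 2 * w ∣ c) (h1 : c ≤ j) (h2 : j < c + 2 * w) (hu : PosIn o l σ u) (hud : w ∣ u) :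
    u = c + w := by
  obtain ⟨a, rfl⟩ := hud
  obtain ⟨b, rfl⟩ := hcd
  rcases lt_or_ge (2 * b) a with h | h
  · rcases Nat.lt_or_ge a (2 * b + 2) with h' | h'
    · obtain rfl : a = 2 * b + 1 := by omega
      ring
    · refine absurd (hj.between hl hu ?_ ?_) (hnone (2 * w * (b + 1)) (Dvd.intro _ rfl))
      · linarith
      · have : w * (2 * b + 2) ≤ w * a := Nat.mul_le_mul_left _ h'
        linarith
  · refine absurd (hu.between hl hj ?_ h1) (hnone (2 * w * b) (Dvd.intro _ rfl))
    have : w * a ≤ w * (2 * b) := Nat.mul_le_mul_left _ h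
    linarith

theorem PosIn.eq_of_empty {o : Point} {l : List Point} (hl : l.Pairwise (ZLt o)) {σ : Cell}
    {w u v : ℕ} (hw : 0 < w) (hnone : ∀ v, 2 * w ∣ v → ¬ PosIn o l σ v) (hu : PosIn o l σ u)
    (hud : w ∣ u) (hv : PosIn o l σ v) (hvd : w ∣ v) : u = v := by
  have h0 : 0 < 2 * w := by omega
  have h1 : u / (2 * w) * (2 * w) ≤ u := Nat.div_mul_le_self _ _
  have h2 : u < u / (2 * w) * (2 * w) + 2 * w := by
    have := Nat.lt_div_mul_add (a := u) h0
    omega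
  rw [hu.refine_empty hl hnone (Dvd.intro_left _ rfl) h1 h2 hu hud,
    hu.refine_empty hl hnone (Dvd.intro_left _ rfl) h1 h2 hv hvd]

theorem mem_levelPoints_inter {o : Point} {l : List Point} {σ : Cell} {i : ℕ} {p : Point} :
    p ∈ levelPoints l i ∩ σ.toSet o ↔ ∃ u, PosIn o l σ u ∧ 2 ^ i ∣ u ∧ pnt l u = p := by
  rw [Set.mem_inter_iff, mem_levelPoints]
  constructor
  · rintro ⟨⟨u, h1, h2, h3, rfl⟩, h⟩
    exact ⟨u, ⟨h1, h2, h⟩, h3, rfl⟩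
  · rintro ⟨u, ⟨h1, h2, h⟩, h3, rfl⟩
    exact ⟨⟨u, h1, h2, h3, rfl⟩, h⟩

/-- Below a region of level `i + 1`, the smallest cells of level `i` are spanned by three points. -/
theorem exists_three_points {o : Point} {l : List Point} (hl : l.Pairwise (ZLt o))
    {i : ℕ} {σ : Cell} {R : Region}
    (hR : IsRegionOf o (levelPoints l (i + 1)) σ R) :
    ∃ F : Finset Point, F.card ≤ 3 ∧ ∀ c ∈ R.toSet o, ∀ τ : Cell, c ∈ τ.toSet o →
      τ.toSet o ⊆ σ.toSet o → (levelPoints l i ∩ τ.toSet o).Nontrivial →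
      IsSmallestCell o (levelPoints l i ∩ τ.toSet o) τ → ∃ p ∈ F, ∃ q ∈ F, lcc o p q = τ := by
  classical
  set w := 2 ^ i
  have hw0 : 0 < w := by positivity
  have hw2 : 2 ^ (i + 1) = 2 * w := by rw [pow_succ]; ring
  -- With no point of level `i + 1` in `σ`, there is at most one of level `i`, and no cell inside
  -- `σ` branches.
  by_cases hE : ∀ v, 2 * w ∣ v → ¬ PosIn o l σ v
  · refine ⟨∅, by simp, fun c _ τ _ hτ hnt _ => ?_⟩
    exfalso
    obtain ⟨p, hp, q, hq, hpq⟩ := hnt.mono (Set.inter_subset_inter_right _ hτ)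
    obtain ⟨u, hu, hud, rfl⟩ := mem_levelPoints_inter.1 hp
    obtain ⟨v, hv, hvd, rfl⟩ := mem_levelPoints_inter.1 hq
    exact hpq (by rw [hu.eq_of_empty hl hw0 hE hud hv hvd])
  · push Not at hE
    let S : Finset ℕ := (Finset.range (l.length + 1)).filter fun v => 2 * w ∣ v ∧ PosIn o l σ v
    have hS : ∀ v, v ∈ S ↔ 2 * w ∣ v ∧ PosIn o l σ v := by
      intro v
      simp only [S, Finset.mem_filter, Finset.mem_range, and_iff_right_iff_imp]
      exact fun h => by have := h.2.2.1; omega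
    have hne : S.Nonempty := by
      obtain ⟨v, h1, h2⟩ := hE
      exact ⟨v, (hS v).2 ⟨h1, h2⟩⟩
    obtain ⟨hfd, hf⟩ := (hS _).1 (S.min'_mem hne)
    obtain ⟨hgd, hg⟩ := (hS _).1 (S.max'_mem hne)
    have hmin : ∀ v, 2 * w ∣ v → PosIn o l σ v → S.min' hne ≤ v ∧ v ≤ S.max' hne := fun v h1 h2 =>
      ⟨S.min'_le _ ((hS v).2 ⟨h1, h2⟩), S.le_max' _ ((hS v).2 ⟨h1, h2⟩)⟩
    have hfg := (hmin _ hgd hg).1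
    set f := S.min' hne
    set g := S.max' hne
    have hpf : pnt l f ∈ levelPoints l (i + 1) ∩ σ.toSet o :=
      mem_levelPoints_inter.2 ⟨f, hf, hw2 ▸ hfd, rfl⟩
    have hpg : pnt l g ∈ levelPoints l (i + 1) ∩ σ.toSet o :=
      mem_levelPoints_inter.2 ⟨g, hg, hw2 ▸ hgd, rfl⟩
    -- The two new neighbours of the old points, and `f` as a representative of everything from `f`
    -- to `g`. If `g + w` exceeds the length of the list, `pnt` returns a default point; a
    -- superfluous element of the set does no harm.
    refine ⟨{pnt l (f - w), pnt l f, pnt l (g + w)}, Finset.card_le_three, ?_⟩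
    intro c hc τ hcτ hτσ hnt hτ
    obtain ⟨p, hp, q, hq, hpq, hτpq⟩ := hτ.exists_pair hnt
    have key : ∀ p ∈ levelPoints l i ∩ τ.toSet o, p = pnt l (f - w) ∨ p = pnt l (g + w) ∨
        ∃ u, f ≤ u ∧ u ≤ g ∧ pnt l u = p := by
      intro p hp
      obtain ⟨u, hu, hud, rfl⟩ := mem_levelPoints_inter.1 (Set.inter_subset_inter_right _ hτσ hp)
      rcases hf.refine hl hg hfd hgd hmin hu hud with h | h | h
      · left; rw [← h, Nat.add_sub_cancel]
      · right; left; rw [h]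
      · exact Or.inr (Or.inr ⟨u, h.1, h.2, rfl⟩)
    rcases hR with ⟨h4, rfl⟩ | ⟨ρ, h4, h5, h6, rfl⟩
    · have hfg' : f = g := pnt_injective hl hf.1 hf.2.1 hg.1 hg.2.1 (h4 hpf hpg)
      have : ∀ p ∈ levelPoints l i ∩ τ.toSet o,
          p ∈ ({pnt l (f - w), pnt l f, pnt l (g + w)} : Finset Point) := by
        intro p hp
        rcases key p hp with h | h | ⟨u, h1, h2, h⟩
        · simp [h]
        · simp [h]
        · obtain rfl : u = f := by omega
          simp [h]
      exact ⟨p, this p hp, q, this q hq, lcc_eq hτpq⟩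
    · have hρf := h5.1 hpf
      have hρ : ∀ u, f ≤ u → u ≤ g → pnt l u ∈ ρ.toSet o := fun u h1 h2 =>
        (PosIn.between hl (σ := ρ) ⟨hf.1, hf.2.1, hρf⟩ ⟨hg.1, hg.2.1, h5.1 hpg⟩ h1 h2).2.2
      have hout : ∀ p ∈ levelPoints l i ∩ τ.toSet o, p ∉ ρ.toSet o →
          p ∈ ({pnt l (f - w), pnt l f, pnt l (g + w)} : Finset Point) := by
        intro p hp hpρ
        rcases key p hp with h | h | ⟨u, h1, h2, rfl⟩
        · simp [h]
        · simp [h]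
        · exact absurd (hρ u h1 h2) hpρ
      have hfF : pnt l f ∈ ({pnt l (f - w), pnt l f, pnt l (g + w)} : Finset Point) := by simp
      have hτρ : ¬ τ.toSet o ⊆ ρ.toSet o := fun h => hc.2 (h hcτ)
      obtain ⟨a, b, ha, hb, hab⟩ := hτpq.exists_quadrant_ne
      -- Since `τ` contains `c`, which is not in the hole `ρ`, it is strictly larger than `ρ` as
      -- soon as the two meet. Then `ρ` lies in one quadrant of `τ`, and `f` can replace any point
      -- of the hole in a pair that spans `τ`.
      have swap : ∀ p a, p ∈ τ.toSet o → p ∈ ρ.toSet o → p ∈ (τ.quadrant a).toSet o →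
          pnt l f ∈ (τ.quadrant a).toSet o := by
        intro p a hpτ hpρ ha
        refine Cell.subset_quadrant hpρ ha ?_ hρf
        by_contra hl'
        push Not at hl'
        exact hτρ (Cell.subset_of_level_le hpτ hpρ hl')
      by_cases hpρ : p ∈ ρ.toSet o <;> by_cases hqρ : q ∈ ρ.toSet o
      · exact absurd (hτpq.2 ρ (by rintro x (rfl | rfl) <;> assumption)) hτρ
      · exact ⟨_, hfF, q, hout q hq hqρ, lcc_eq (ZLt.isSmallestCell hab (swap p a hp.2 hpρ ha) hb)⟩
      · exact ⟨p, hout p hp hpρ, _, hfF, lcc_eq (ZLt.isSmallestCell hab ha (swap q b hq.2 hqρ hb))⟩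
      · exact ⟨p, hout p hp hpρ, q, hout q hq hqρ, lcc_eq hτpq⟩

/-- A region of level `i + 1` meets at most `37` regions of level `i`. -/
theorem encard_regions_le {o : Point} {σ₀ : Cell} {l : List Point} (hl : l.Pairwise (ZLt o))
    (hσ₀ : ∀ p ∈ l, p ∈ σ₀.toSet o) {i : ℕ} {R : Region}
    (hR : IsLeafRegion o σ₀ (levelPoints l (i + 1)) R) :
    {R' | IsLeafRegion o σ₀ (levelPoints l i) R' ∧ (R.toSet o ∩ R'.toSet o).Nonempty}.encard
      ≤ 37 := by
  classical
  have hQ := levelPoints_subset hσ₀ (i + 1)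
  have hQ' := levelPoints_subset hσ₀ i
  obtain ⟨σ, h1, h2⟩ := hR.exists_isNode hQ
  obtain ⟨F, hF, hF'⟩ := exists_three_points hl h2
  -- The outer cell of `R` itself, and four quadrants for each of at most nine pairs: `1 + 9 * 4 =
  -- 37`.
  let T : Finset Cell := insert σ ((F ×ˢ F ×ˢ (Finset.univ : Finset (Fin 4))).image
    fun x => (lcc o x.1 x.2.1).quadrant x.2.2)
  have hT : T.card ≤ 37 := by
    refine (Finset.card_insert_le _ _).trans (Nat.succ_le_succ (Finset.card_image_le.trans ?_))
    rw [Finset.card_product, Finset.card_product, Finset.card_univ, Fintype.card_fin]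
    nlinarith
  refine le_trans ?_ ((Set.encard_coe_eq_coe_finsetCard T).le.trans (by exact_mod_cast hT))
  -- At a fixed level a region is determined by its outer cell, so it is enough to count outer
  -- cells.
  refine Set.encard_le_encard_of_injOn (f := Region.outer) ?_ ?_
  · rintro R' ⟨hR', c, hc, hc'⟩
    obtain ⟨σ', h1', h2'⟩ := hR'.exists_isNode hQ'
    rw [h2'.outer_eq, Finset.mem_coe, Finset.mem_insert]
    by_cases he : σ' = σ
    · exact Or.inl he
    right
    have hcσ : c ∈ σ.toSet o := h2.outer_eq ▸ R.toSet_subset_outer o hc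
    have hcσ' : c ∈ σ'.toSet o := h2'.outer_eq ▸ R'.toSet_subset_outer o hc'
    -- `σ` is still a node cell at the finer level. A node cell inside `σ'` that contains a point of
    -- the region at `σ'` must be `σ'`.
    have hσσ : ¬ σ.toSet o ⊆ σ'.toSet o := fun h => he
      ((h1.mono (levelPoints_anti l i.le_succ)).eq_of_mem hQ' hcσ (h1'.subset hQ') h2' hc' h).symm
    have hlev : σ'.level < σ.level := by
      by_contra hl
      push Not at hl
      exact hσσ (Cell.subset_of_level_le hcσ hcσ' hl)
    rcases h1' with rfl | ⟨τ, a, h3, h4, rfl⟩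
    · exact absurd (h1.subset hQ) hσσ
    · have hcτ := τ.quadrant_subset o a hcσ'
      have hτσ : τ.toSet o ⊆ σ.toSet o := Cell.subset_of_level_le hcτ hcσ (by
        rw [Cell.level_quadrant] at hlev; omega)
      obtain ⟨p, hp, q, hq, rfl⟩ := hF' c hc τ hcτ hτσ h3 h4
      exact Finset.mem_image.2 ⟨(p, q, a), by simp [hp, hq], rfl⟩
  · rintro R' ⟨hR', -⟩ R'' ⟨hR'', -⟩ he
    obtain ⟨σ', h1', h2'⟩ := hR'.exists_isNode hQ'
    obtain ⟨σ'', h1'', h2''⟩ := hR''.exists_isNode hQ'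
    rw [h2'.outer_eq, h2''.outer_eq] at he
    subst he
    exact h2'.unique h2''

/-! ## The ply of the flowers -/

theorem Disk.center_mem (D : Disk) : D.center ∈ D.toSet := by
  simp [Disk.toSet, sq_nonneg]

/-- Below the top level this is the parent region, whose boundary the disk does not cross. The level
above the top has no points and the single region `σ₀`, so that the top level needs no separate
treatment. -/
theorem IsAssigned.exists_region_above {o : Point} {σ₀ : Cell} {l : List Point}
    (hσ₀ : ∀ p ∈ l, p ∈ σ₀.toSet o) {D : Disk} (hD : D.toSet ⊆ σ₀.toSet o) {i : ℕ} {R : Region}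
    (h : IsAssigned o σ₀ l D i R) :
    ∃ R', IsLeafRegion o σ₀ (levelPoints l (i + 1)) R' ∧ D.toSet ⊆ R'.toSet o := by
  rcases h.1.1.lt_or_eq with hi | rfl
  · obtain ⟨R', h1, h2⟩ := exists_isLeafRegion (levelPoints_finite l (i + 1))
      (levelPoints_subset hσ₀ _) (hD D.center_mem)
    exact ⟨R', h1, h.2.2.2 (i + 1) R' i.lt_succ_self ⟨hi, h1⟩ h2⟩
  · refine ⟨.cell σ₀, .single ?_, hD⟩
    rw [levelPoints_top]
    exact Set.subsingleton_empty

theorem Set.encard_biUnion_finset_le {α ι : Type*} (s : Finset ι) (f : ι → Set α) (b : ℕ∞)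
    (h : ∀ i ∈ s, (f i).encard ≤ b) : (⋃ i ∈ s, f i).encard ≤ s.card * b := by
  classical
  induction s using Finset.induction_on with
  | empty => simp
  | insert a s ha ih =>
    rw [Finset.set_biUnion_insert, Finset.card_insert_of_notMem ha]
    refine (Set.encard_union_le _ _).trans ?_
    push_cast
    rw [add_mul, one_mul, add_comm]
    exact add_le_add (ih fun i hi => h i (Finset.mem_insert_of_mem hi))
      (h a (Finset.mem_insert_self _ _))

theorem Set.encard_biUnion_le {α ι : Type*} (s : Set ι) (f : ι → Set α) (a : ℕ) (b : ℕ∞)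
    (hs : s.encard ≤ a) (h : ∀ i ∈ s, (f i).encard ≤ b) : (⋃ i ∈ s, f i).encard ≤ a * b := by
  have hfin := Set.finite_of_encard_le_coe hs
  have h1 := Set.encard_biUnion_finset_le hfin.toFinset f b (by simpa using h)
  simp only [Set.Finite.mem_toFinset] at h1
  refine h1.trans ?_
  rw [← Set.Finite.coe_toFinset hfin, Set.encard_coe_eq_coe_finsetCard] at hs
  gcongr

theorem length_le_of_pairwise_zLt {n : ℕ} {o : Point} {l : List Point} {d : Fin n → Disk}
    (hl : l.Pairwise (ZLt o)) (hmem : ∀ p, p ∈ l ↔ ∃ x, (d x).center = p) : l.length ≤ n := by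
  classical
  have hnd : l.Nodup := hl.imp fun h => h.ne
  rw [← List.toFinset_card_of_nodup hnd]
  have : l.toFinset ⊆ Finset.univ.image fun x => (d x).center := by
    intro p hp
    simpa [hmem] using hp
  exact (Finset.card_le_card this).trans (Finset.card_image_le.trans (by simp))

/-- Disks of one level that contain `q` all lie in the region of the next higher level that contains
`q`. The nodes they are assigned to are then among the at most 37 regions that meet it. -/
theorem ply_flower_le {k n : ℕ} {o : Point} {σ₀ : Cell} {d : Fin n → Disk}
    (had : IsAdmissible o σ₀ d) {C : Finpartition (Finset.univ : Finset (Fin n))}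
    (hC : IsCliqueConstruction k o σ₀ d C) :
    ply (fun c : C.parts => flower d c) ≤ ((Nat.log 2 n + 1) * (37 * (k + 1)) : ℕ) := by
  classical
  obtain ⟨l, hl, hmem, hass, -, hnum, -⟩ := hC
  have hσ₀ : ∀ p ∈ l, p ∈ σ₀.toSet o := by
    intro p hp
    obtain ⟨x, rfl⟩ := (hmem p).1 hp
    exact (had x).1 (d x).center_mem
  have hln := length_le_of_pairwise_zLt hl hmem
  refine iSup_le fun q => ?_
  let A : ℕ → Region → Set (Finset (Fin n)) := fun i R =>
    {c | c ∈ C.parts ∧ ∀ x ∈ c, IsAssigned o σ₀ l (d x) i R}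
  let B : ℕ → Set Region := fun i => {R | ∃ x, q ∈ (d x).toSet ∧ IsAssigned o σ₀ l (d x) i R}
  -- `k + 1` covers both limits, `1` at a leaf and `k` elsewhere, even if `k = 0`.
  have hA : ∀ i R, (A i R).encard ≤ ((k + 1 : ℕ) : ℕ∞) := by
    intro i R
    refine (hnum i R).trans ?_
    split_ifs
    · exact_mod_cast Nat.le_add_left 1 k
    · exact_mod_cast Nat.le_succ k
  have hB : ∀ i, (B i).encard ≤ (37 : ℕ) := by
    intro i
    by_cases hne : (B i).Nonempty
    · obtain ⟨R₀, x, hq, hx⟩ := hne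
      obtain ⟨R', h1, h2⟩ := hx.exists_region_above hσ₀ (had x).1
      refine (Set.encard_le_encard ?_).trans (encard_regions_le hl hσ₀ h1)
      rintro R ⟨y, hqy, hy⟩
      obtain ⟨R'', h1', h2'⟩ := hy.exists_region_above hσ₀ (had y).1
      obtain rfl := h1.unique (levelPoints_subset hσ₀ _) h1' (h2 hq) (h2' hqy)
      exact ⟨hy.1.2, _, h2' (d y).center_mem, hy.2.1⟩
    · rw [Set.not_nonempty_iff_eq_empty.1 hne]
      simp
  have hsub : (Subtype.val '' {c : C.parts | q ∈ flower d c}) ⊆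
      ⋃ i ∈ Finset.range (Nat.log 2 n + 1), ⋃ R ∈ B i, A i R := by
    rintro _ ⟨⟨c, hc⟩, hq, rfl⟩
    simp only [flower, Set.mem_ofPred_eq, Set.mem_iUnion] at hq
    obtain ⟨x, hx, hq⟩ := hq
    obtain ⟨i, R, hi⟩ := hass c hc
    simp only [Set.mem_iUnion, Finset.mem_range]
    have := (hi x hx).1.1.trans (Nat.log_mono_right hln)
    exact ⟨i, by omega, R, ⟨x, hq, hi x hx⟩, hc, hi⟩
  rw [← Subtype.val_injective.encard_image]
  refine (Set.encard_le_encard hsub).trans ?_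
  refine (Set.encard_biUnion_finset_le _ _ _ fun i _ =>
    Set.encard_biUnion_le (B i) (A i) 37 _ (hB i) fun R _ => hA i R).trans ?_
  rw [Finset.card_range]
  norm_cast

theorem isBigO_natLog : (fun n : ℕ => ((Nat.log 2 n + 1 : ℕ) : ℝ)) =O[atTop]
    (fun n : ℕ => Real.log n) := by
  -- One summand for the integer logarithm, the other for the additive `1`, which is at most `log n
  -- / log 2` once `n ≥ 2`.
  refine IsBigO.of_bound (1 / Real.log 2 + 1 / Real.log 2) ?_
  filter_upwards [eventually_ge_atTop 2] with n hn
  have h2 : 0 < Real.log 2 := Real.log_pos (by norm_num)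
  have hn2 : Real.log 2 ≤ Real.log n := Real.log_le_log (by norm_num) (by exact_mod_cast hn)
  rw [Real.norm_of_nonneg (by positivity), Real.norm_of_nonneg (h2.le.trans hn2), add_mul]
  push_cast
  refine add_le_add ?_ ?_
  · have := Real.natLog_le_logb n 2
    rw [Real.logb, Nat.cast_ofNat] at this
    rw [one_div, inv_mul_eq_div]
    exact this
  · rw [one_div, inv_mul_eq_div, le_div_iff₀ h2]
    linarith

theorem ply_part (k : ℕ) : ∃ L : ℕ → ℕ,
      (fun n : ℕ => (L n : ℝ)) =O[atTop] (fun n : ℕ => Real.log n) ∧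
      ∀ (n : ℕ) (o : Point) (σ₀ : Cell) (d : Fin n → Disk), IsAdmissible o σ₀ d →
        ∀ C : Finpartition (Finset.univ : Finset (Fin n)), IsCliqueConstruction k o σ₀ d C →
          (∀ c ∈ C.parts, IsStabbed d c) ∧
          ply (fun c : C.parts => flower d c) ≤ L n := by
  refine ⟨fun n => (Nat.log 2 n + 1) * (37 * (k + 1)), ?_, fun n o σ₀ d had C hC =>
    ⟨?_, ply_flower_le had hC⟩⟩
  · have := isBigO_natLog.const_mul_left (37 * (k + 1))
    refine this.congr_left fun n => ?_
    push_cast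
    ring
  · obtain ⟨l, -, -, -, h, -⟩ := hC
    exact h

end

/-! ### Disks against cells, stabbing points, and labels -/

noncomputable section

/-! ## Disks and cells -/

theorem Cell.mem_iff_corner {o p : Point} {σ : Cell} : p ∈ σ.toSet o ↔
    ((σ.corner o).1 ≤ p.1 ∧ p.1 < (σ.corner o).1 + σ.side) ∧
    ((σ.corner o).2 ≤ p.2 ∧ p.2 < (σ.corner o).2 + σ.side) := by
  rw [Cell.mem_toSet]
  simp only [Cell.corner, add_mul, one_mul, add_assoc]

theorem Disk.subset_cell_iff {o : Point} {σ : Cell} {D : Disk} : D.toSet ⊆ σ.toSet o ↔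
    ((σ.corner o).1 ≤ D.center.1 - D.radius ∧ D.center.1 + D.radius < (σ.corner o).1 + σ.side) ∧
    ((σ.corner o).2 ≤ D.center.2 - D.radius ∧
      D.center.2 + D.radius < (σ.corner o).2 + σ.side) := by
  have hr := D.radius_pos
  constructor
  · intro h
    have h1 := h (show (D.center.1 - D.radius, D.center.2) ∈ D.toSet by simp [Disk.toSet])
    have h2 := h (show (D.center.1 + D.radius, D.center.2) ∈ D.toSet by simp [Disk.toSet])
    have h3 := h (show (D.center.1, D.center.2 - D.radius) ∈ D.toSet by simp [Disk.toSet])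
    have h4 := h (show (D.center.1, D.center.2 + D.radius) ∈ D.toSet by simp [Disk.toSet])
    rw [Cell.mem_iff_corner] at h1 h2 h3 h4
    exact ⟨⟨h1.1.1, h2.1.2⟩, h3.2.1, h4.2.2⟩
  · rintro ⟨⟨h1, h2⟩, h3, h4⟩ p hp
    have hp' : (p.1 - D.center.1) ^ 2 + (p.2 - D.center.2) ^ 2 ≤ D.radius ^ 2 := hp
    have hx : |p.1 - D.center.1| ≤ D.radius :=
      abs_le_of_sq_le_sq (by nlinarith [sq_nonneg (p.2 - D.center.2)]) hr.le
    have hy : |p.2 - D.center.2| ≤ D.radius :=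
      abs_le_of_sq_le_sq (by nlinarith [sq_nonneg (p.1 - D.center.1)]) hr.le
    rw [abs_le] at hx hy
    rw [Cell.mem_iff_corner]
    refine ⟨⟨?_, ?_⟩, ?_, ?_⟩ <;> linarith

/-- The distance of `c` from the interval `[X, X + s]`. -/
def gapTo (X s c : ℝ) : ℝ := if c < X then X - c else if c < X + s then 0 else c - (X + s)

theorem gapTo_nonneg {X s c : ℝ} : 0 ≤ gapTo X s c := by
  unfold gapTo
  split_ifs <;> linarith

theorem sq_gapTo_le {X s c x : ℝ} (h1 : X ≤ x) (h2 : x < X + s) : gapTo X s c ^ 2 ≤ (x - c) ^ 2 := by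
  unfold gapTo
  split_ifs
  · nlinarith
  · nlinarith [sq_nonneg (x - c)]
  · nlinarith

theorem sq_gapTo_lt {X s c x : ℝ} (h2 : x < X + s) (h3 : ¬ c < X + s) (hs : 0 < s) :
    gapTo X s c ^ 2 < (x - c) ^ 2 := by
  unfold gapTo
  split_ifs
  · linarith
  · nlinarith

/-- The test for a disk with center `(a, b)` and radius `r` to meet a half-open square. -/
def DiskMeets (X Y s a b r : ℝ) : Prop :=
  gapTo X s a ^ 2 + gapTo Y s b ^ 2 < r ^ 2 ∨
    (¬ r ^ 2 < gapTo X s a ^ 2 + gapTo Y s b ^ 2 ∧ a < X + s ∧ b < Y + s)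

theorem exists_near {X s c ε : ℝ} (hs : 0 < s) (hε : 0 < ε) (hεs : ε ≤ s) :
    ∃ x, X ≤ x ∧ x < X + s ∧ (x - c) ^ 2 ≤ (gapTo X s c + ε) ^ 2 := by
  unfold gapTo
  split_ifs with h1 h2
  · exact ⟨X, le_rfl, by linarith, by nlinarith⟩
  · exact ⟨c, by linarith, h2, by nlinarith⟩
  · exact ⟨X + s - ε, by linarith, by linarith, le_of_eq (by ring)⟩

theorem exists_nearest {X s c : ℝ} (hs : 0 < s) (h : c < X + s) :
    ∃ x, X ≤ x ∧ x < X + s ∧ (x - c) ^ 2 = gapTo X s c ^ 2 := by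
  unfold gapTo
  split_ifs with h1
  · exact ⟨X, le_rfl, by linarith, by ring⟩
  · exact ⟨c, by linarith, h, by ring⟩

/-- The cell lacks its right and upper sides, so its distance from the center need not be attained.
If the center lies to the left of the right side and below the upper one, a nearest point exists and
equality of distance and radius is allowed. Otherwise the inequality must be strict, and a nearly
nearest point serves. -/
theorem Disk.inter_cell_nonempty_iff {o : Point} {σ : Cell} {D : Disk} :
    (D.toSet ∩ σ.toSet o).Nonempty ↔ DiskMeets (σ.corner o).1 (σ.corner o).2 σ.side
      D.center.1 D.center.2 D.radius := by
  have hs := σ.side_pos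
  have hr := D.radius_pos
  set X := (σ.corner o).1 with hX
  set Y := (σ.corner o).2 with hY
  set u := gapTo X σ.side D.center.1 with hu
  set v := gapTo Y σ.side D.center.2 with hv
  have hu0 : 0 ≤ u := gapTo_nonneg
  have hv0 : 0 ≤ v := gapTo_nonneg
  constructor
  · rintro ⟨p, hp, hpσ⟩
    have hp' : (p.1 - D.center.1) ^ 2 + (p.2 - D.center.2) ^ 2 ≤ D.radius ^ 2 := hp
    obtain ⟨⟨h1, h2⟩, h3, h4⟩ := Cell.mem_iff_corner.1 hpσ
    have e1 := sq_gapTo_le (c := D.center.1) h1 h2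
    have e2 := sq_gapTo_le (c := D.center.2) h3 h4
    by_cases hx : D.center.1 < X + σ.side
    · by_cases hy : D.center.2 < Y + σ.side
      · exact Or.inr ⟨by rw [not_lt]; linarith, hx, hy⟩
      · have := sq_gapTo_lt h4 hy hs
        exact Or.inl (by linarith)
    · have := sq_gapTo_lt h2 hx hs
      exact Or.inl (by linarith)
  · rintro (h | ⟨h, hx, hy⟩)
    · set δ := D.radius ^ 2 - (u ^ 2 + v ^ 2) with hδ
      have hδ0 : 0 < δ := by rw [hδ]; linarith
      -- Moving both coordinates by `ε` raises the squared distance by at most `2 * ε * (u + v) + 2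
      -- * ε ^ 2`, which is at most `2 * ε * (u + v + 1)` for `ε ≤ 1`.
      obtain ⟨ε, h0, h1, h2, h3⟩ : ∃ ε : ℝ, 0 < ε ∧ ε ≤ σ.side ∧ ε ≤ 1 ∧
          ε * (2 * (u + v + 1)) ≤ δ := by
        refine ⟨min σ.side (min 1 (δ / (2 * (u + v + 1)))), by positivity, min_le_left _ _,
          (min_le_right _ _).trans (min_le_left _ _), ?_⟩
        rw [← le_div_iff₀ (by positivity)]
        exact (min_le_right _ _).trans (min_le_right _ _)
      obtain ⟨x, hx1, hx2, hx3⟩ := exists_near (X := X) (c := D.center.1) hs h0 h1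
      obtain ⟨y, hy1, hy2, hy3⟩ := exists_near (X := Y) (c := D.center.2) hs h0 h1
      refine ⟨(x, y), ?_, Cell.mem_iff_corner.2 ⟨⟨hx1, hx2⟩, hy1, hy2⟩⟩
      change (x - D.center.1) ^ 2 + (y - D.center.2) ^ 2 ≤ D.radius ^ 2
      rw [← hu] at hx3
      rw [← hv] at hy3
      nlinarith
    · obtain ⟨x, hx1, hx2, hx3⟩ := exists_nearest hs hx
      obtain ⟨y, hy1, hy2, hy3⟩ := exists_nearest hs hy
      refine ⟨(x, y), ?_, Cell.mem_iff_corner.2 ⟨⟨hx1, hx2⟩, hy1, hy2⟩⟩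
      change (x - D.center.1) ^ 2 + (y - D.center.2) ^ 2 ≤ D.radius ^ 2
      rw [hx3, hy3]
      exact not_lt.1 h

theorem Disk.objectSize_le (D : Disk) : objectSize D.toSet ≤ 2 * D.radius := by
  have hr := D.radius_pos
  refine csInf_le ⟨0, fun s hs => hs.1⟩ ⟨by linarith, D.center.1 - D.radius,
    D.center.2 - D.radius, fun p hp => ?_⟩
  have hp' : (p.1 - D.center.1) ^ 2 + (p.2 - D.center.2) ^ 2 ≤ D.radius ^ 2 := hp
  have hx := abs_le.1 (abs_le_of_sq_le_sq (a := p.1 - D.center.1)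
    (by nlinarith [sq_nonneg (p.2 - D.center.2)]) hr.le)
  have hy := abs_le.1 (abs_le_of_sq_le_sq (a := p.2 - D.center.2)
    (by nlinarith [sq_nonneg (p.1 - D.center.1)]) hr.le)
  refine ⟨⟨?_, ?_⟩, ?_, ?_⟩ <;> linarith

theorem Cell.side_le_objectSize (o : Point) (σ : Cell) : σ.side ≤ objectSize (σ.toSet o) := by
  have hs := σ.side_pos
  refine le_csInf ⟨σ.side, hs.le, (σ.corner o).1, (σ.corner o).2, fun p hp => ?_⟩ ?_
  · obtain ⟨⟨h1, h2⟩, h3, h4⟩ := Cell.mem_iff_corner.1 hp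
    exact ⟨⟨h1, h2.le⟩, h3, h4.le⟩
  · rintro s ⟨-, x, y, h⟩
    -- The far sides are missing from the cell, so its width is only approached by points at
    -- distance `σ.side - ε` from the corner.
    refine le_of_forall_pos_sub_le fun ε hε => ?_
    by_cases hεs : ε ≤ σ.side
    · have h1 := (h (σ.corner_mem o)).1.1
      have h2 := (h (show ((σ.corner o).1 + (σ.side - ε), (σ.corner o).2) ∈ σ.toSet o by
        rw [Cell.mem_iff_corner]
        refine ⟨⟨?_, ?_⟩, ?_, ?_⟩ <;> simp <;> linarith)).1.2
      simp only at h2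
      linarith
    · have h1 := (h (σ.corner_mem o)).1
      have := h1.1.trans h1.2
      linarith

/-- A disk that crosses the boundary of a cell is large compared to the cell. -/
theorem Disk.side_le_of_crosses {o : Point} {σ : Cell} {D : Disk} (hal : IsAligned 6 o D.toSet)
    (h1 : (D.toSet ∩ σ.toSet o).Nonempty) (h2 : ¬ D.toSet ⊆ σ.toSet o) :
    σ.side ≤ 6 * D.radius := by
  obtain ⟨ρ, hρ, hsz⟩ := hal
  have h3 := (ρ.side_le_objectSize o).trans (hsz.trans
    (mul_le_mul_of_nonneg_left D.objectSize_le (by norm_num)))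
  obtain ⟨p, hp, hpσ⟩ := h1
  -- The aligning cell `ρ` shares a point with `σ` but is not inside it, so it is at least twice as
  -- large: twice the side of `σ` is at most `6 * (2 * r)`.
  have hl : σ.level + 1 ≤ ρ.level := by
    by_contra hl
    exact h2 (hρ.trans (Cell.subset_of_level_le (hρ hp) hpσ (by omega)))
  have h4 : σ.side * 2 ≤ ρ.side := by
    unfold Cell.side
    rw [← zpow_add_one₀ (by norm_num)]
    exact zpow_le_zpow_right₀ (by norm_num) hl
  linarith

/-- The Euclidean triangle inequality in squared form, by Cauchy–Schwarz. It is stated with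
coordinates because `ℝ × ℝ` carries the maximum norm. -/
theorem sq_add_sq_le_of_add {a b c d α β : ℝ} (hα : 0 ≤ α) (hβ : 0 ≤ β)
    (h1 : a ^ 2 + b ^ 2 ≤ α ^ 2) (h2 : c ^ 2 + d ^ 2 ≤ β ^ 2) :
    (a + c) ^ 2 + (b + d) ^ 2 ≤ (α + β) ^ 2 := by
  have h3 : a * c + b * d ≤ α * β := by
    refine le_of_abs_le (abs_le_of_sq_le_sq ?_ (by positivity))
    calc (a * c + b * d) ^ 2 ≤ (a ^ 2 + b ^ 2) * (c ^ 2 + d ^ 2) := by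
          nlinarith [sq_nonneg (a * d - b * c)]
      _ ≤ α ^ 2 * β ^ 2 := mul_le_mul h1 h2 (by positivity) (by positivity)
      _ = (α * β) ^ 2 := by ring
  nlinarith

/-- The points of a grid of width `s / 6` around the square with corner `(X, Y)` and side `s`. -/
def gridPoint (X Y s : ℝ) (t : ℕ) : Point :=
  (X + (2 * ((t / 9 : ℕ) : ℚ) - 1 : ℚ) * s / 12, Y + (2 * ((t % 9 : ℕ) : ℚ) - 1 : ℚ) * s / 12)

/-- The enlarged interval splits into eight pieces of length `s / 6` whose midpoints are the grid
coordinates. The ninth index is needed only at the closed right end. -/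
theorem exists_grid_near {X s e : ℝ} (hs : 0 < s) (h1 : X - s / 6 ≤ e) (h2 : e ≤ X + s + s / 6) :
    ∃ a : ℕ, a < 9 ∧ (X + (2 * (a : ℝ) - 1) * s / 12 - e) ^ 2 ≤ (s / 12) ^ 2 := by
  have h0 : 0 ≤ (e - X + s / 6) / (s / 6) := div_nonneg (by linarith) (by linarith)
  have h3 := Nat.floor_le h0
  have h4 := Nat.lt_floor_add_one ((e - X + s / 6) / (s / 6))
  refine ⟨⌊(e - X + s / 6) / (s / 6)⌋₊, ?_, ?_⟩
  · rw [Nat.floor_lt h0, div_lt_iff₀ (by linarith)]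
    push_cast
    linarith
  · set a : ℝ := ((⌊(e - X + s / 6) / (s / 6)⌋₊ : ℕ) : ℝ)
    rw [le_div_iff₀ (by linarith)] at h3
    rw [div_lt_iff₀ (by linarith)] at h4
    exact sq_le_sq' (by linarith) (by linarith)

/-- `D` contains a disk of radius `s / 6` whose center is within `s / 6` of `p`, hence in the
enlarged square. A grid point differs from that center by at most `s / 12` in each coordinate, which
is a distance below `s / 6`. -/
theorem Disk.exists_gridPoint_mem {X Y s : ℝ} {D : Disk} {p : Point} (hp : p ∈ D.toSet)
    (hx : X ≤ p.1 ∧ p.1 ≤ X + s) (hy : Y ≤ p.2 ∧ p.2 ≤ Y + s) (hs : 0 < s)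
    (hr : s ≤ 6 * D.radius) : ∃ t < 81, gridPoint X Y s t ∈ D.toSet := by
  have hr0 := D.radius_pos
  have hp' : (p.1 - D.center.1) ^ 2 + (p.2 - D.center.2) ^ 2 ≤ D.radius ^ 2 := hp
  have hpx := abs_le.1 (abs_le_of_sq_le_sq (a := p.1 - D.center.1)
    (by nlinarith [sq_nonneg (p.2 - D.center.2)]) hr0.le)
  have hpy := abs_le.1 (abs_le_of_sq_le_sq (a := p.2 - D.center.2)
    (by nlinarith [sq_nonneg (p.1 - D.center.1)]) hr0.le)
  -- The fraction of the way from `p` to the center of `D`: then `(1 - l) * r = r - s / 6` bounds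
  -- the remaining distance to the center.
  set l := s / 6 / D.radius with hl
  have hlr : l * D.radius = s / 6 := by rw [hl]; field_simp
  have hl0 : 0 ≤ l := by positivity
  have hl1 : l ≤ 1 := by rw [hl, div_le_one hr0]; linarith
  obtain ⟨a, ha, hax⟩ := exists_grid_near (X := X) (e := p.1 + l * (D.center.1 - p.1)) hs
    (by nlinarith) (by nlinarith)
  obtain ⟨b, hb, hby⟩ := exists_grid_near (X := Y) (e := p.2 + l * (D.center.2 - p.2)) hs
    (by nlinarith) (by nlinarith)
  refine ⟨a * 9 + b, by omega, ?_⟩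
  have e1 : (a * 9 + b) / 9 = a := by omega
  have e2 : (a * 9 + b) % 9 = b := by omega
  simp only [gridPoint, e1, e2, Disk.toSet, Set.mem_ofPred_eq]
  push_cast
  have h1 := sq_add_sq_le_of_add (α := s / 6) (β := (1 - l) * D.radius) (by positivity)
    (mul_nonneg (by linarith) hr0.le)
    (show (X + (2 * (a : ℝ) - 1) * s / 12 - (p.1 + l * (D.center.1 - p.1))) ^ 2 +
        (Y + (2 * (b : ℝ) - 1) * s / 12 - (p.2 + l * (D.center.2 - p.2))) ^ 2 ≤ (s / 6) ^ 2 by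
      have := add_le_add hax hby
      nlinarith)
    (show ((1 - l) * (p.1 - D.center.1)) ^ 2 + ((1 - l) * (p.2 - D.center.2)) ^ 2 ≤
        ((1 - l) * D.radius) ^ 2 by
      have := mul_le_mul_of_nonneg_left hp' (sq_nonneg (1 - l))
      linarith)
  have e3 : s / 6 + (1 - l) * D.radius = D.radius := by linarith
  rw [e3] at h1
  convert h1 using 2
  · ring
  · ring

/-! ## The clique construction from labels -/

theorem IsAssigned.unique {o : Point} {σ₀ : Cell} {l : List Point}
    (hσ₀ : ∀ p ∈ l, p ∈ σ₀.toSet o) {D : Disk} {i i' : ℕ} {R R' : Region}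
    (h : IsAssigned o σ₀ l D i R) (h' : IsAssigned o σ₀ l D i' R') : i = i' ∧ R = R' := by
  have hi : i = i' := by
    rcases lt_trichotomy i i' with hlt | he | hlt
    · rcases h'.2.2.1 with h0 | h0
      · omega
      · exact absurd (h.2.2.2 i' R' hlt h'.1 h'.2.1) h0
    · exact he
    · rcases h.2.2.1 with h0 | h0
      · omega
      · exact absurd (h'.2.2.2 i R hlt h.1 h.2.1) h0
  subst hi
  exact ⟨rfl, h.1.2.unique (levelPoints_subset hσ₀ _) h'.1.2 h.2.1 h'.2.1⟩

theorem IsLeafRegion.eq_of_level_zero {o : Point} {σ₀ : Cell} {l : List Point} {R : Region}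
    {p q : Point} (hσ₀ : ∀ p ∈ l, p ∈ σ₀.toSet o) (h : IsLeafRegion o σ₀ (levelPoints l 0) R)
    (hp : p ∈ l) (hpR : p ∈ R.toSet o) (hq : q ∈ l) (hqR : q ∈ R.toSet o) : p = q := by
  obtain ⟨σ, -, ⟨h1, rfl⟩ | ⟨τ, h1, h2, h3, rfl⟩⟩ := h.exists_isNode (levelPoints_subset hσ₀ 0)
  · exact h1 ⟨hp, hpR⟩ ⟨hq, hqR⟩
  · exact absurd (h2.1 ⟨hp, hpR.1⟩) hpR.2

/-- The points in the outer cell of a donut all lie in its hole. Hence no disk is assigned to a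
donut at level 0, and the single clique of a leaf cannot conflict with the separate treatment of the
hole. -/
theorem IsLeafRegion.ne_donut_of_level_zero {o : Point} {σ₀ : Cell} {l : List Point}
    {p : Point} {ρ τ : Cell} (hσ₀ : ∀ p ∈ l, p ∈ σ₀.toSet o)
    (h : IsLeafRegion o σ₀ (levelPoints l 0) (.donut ρ τ))
    (hp : p ∈ l) : p ∉ (Region.donut ρ τ).toSet o := by
  intro hpR
  obtain ⟨σ, -, ⟨h1, h2⟩ | ⟨τ', h1, h2, h3, h4⟩⟩ := h.exists_isNode (levelPoints_subset hσ₀ 0)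
  · cases h2
  · cases h4
    exact hpR.2 (h2.1 ⟨hp, hpR.1⟩)

/-- Reduces the construction to labelling each disk with its node, a type (1 for disks treated with
the hole) and the index of a stabbing point. A node has `162 = 2 * 81` possible pairs of type and
index. At level 0 only one pair is allowed, and there the common center stabs the clique. -/
theorem isCliqueConstruction_of_labels {n : ℕ} {o : Point} {σ₀ : Cell} {d : Fin n → Disk}
    (had : IsAdmissible o σ₀ d) {l : List Point} (hl : l.Pairwise (ZLt o))
    (hmem : ∀ p, p ∈ l ↔ ∃ x, (d x).center = p)
    {lev : Fin n → ℕ} {reg : Fin n → Region} {ty idx : Fin n → ℕ}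
    (hass : ∀ x, IsAssigned o σ₀ l (d x) (lev x) (reg x))
    (hty : ∀ x, ty x < 2) (hidx : ∀ x, idx x < 81)
    (hzero : ∀ x, lev x = 0 → ty x = 0 ∧ idx x = 0)
    (hmeet : ∀ x ρ τ, reg x = .donut ρ τ → ty x = 1 → ((d x).toSet ∩ τ.toSet o).Nonempty)
    (hdisj : ∀ x ρ τ, reg x = .donut ρ τ → lev x ≠ 0 → ty x = 0 →
      Disjoint (d x).toSet (τ.toSet o))
    (pt : Region → ℕ → ℕ → Point)
    (hpt : ∀ x, lev x ≠ 0 → pt (reg x) (ty x) (idx x) ∈ (d x).toSet)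
    {C : Finpartition (Finset.univ : Finset (Fin n))}
    (hC : ∀ x y, C.part x = C.part y ↔
      lev x = lev y ∧ reg x = reg y ∧ ty x = ty y ∧ idx x = idx y) :
    IsCliqueConstruction 162 o σ₀ d C := by
  have hσ₀ : ∀ p ∈ l, p ∈ σ₀.toSet o := by
    intro p hp
    obtain ⟨x, rfl⟩ := (hmem p).1 hp
    exact (had x).1 (d x).center_mem
  have hcl : ∀ x, (d x).center ∈ l := fun x => (hmem _).2 ⟨x, rfl⟩
  have hpart : ∀ c ∈ C.parts, ∀ x ∈ c, C.part x = c := fun c hc x hx => C.part_eq_of_mem hc hx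
  have hsame : ∀ c ∈ C.parts, ∀ x ∈ c, ∀ y ∈ c,
      lev x = lev y ∧ reg x = reg y ∧ ty x = ty y ∧ idx x = idx y := fun c hc x hx y hy =>
    (hC x y).1 ((hpart c hc x hx).trans (hpart c hc y hy).symm)
  have hne : ∀ c ∈ C.parts, ∃ x, x ∈ c := fun c hc => C.nonempty_of_mem_parts hc
  refine ⟨l, hl, hmem, ?_, ?_, ?_, ?_⟩
  · intro c hc
    obtain ⟨x, hx⟩ := hne c hc
    refine ⟨lev x, reg x, fun y hy => ?_⟩
    obtain ⟨h1, h2, -⟩ := hsame c hc x hx y hy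
    rw [h1, h2]
    exact hass y
  · intro c hc
    obtain ⟨x, hx⟩ := hne c hc
    by_cases h0 : lev x = 0
    · refine ⟨(d x).center, fun y hy => ?_⟩
      obtain ⟨h1, h2, -⟩ := hsame c hc x hx y hy
      have hx' := hass x
      have hy' := hass y
      rw [← h1, ← h2, h0] at hy'
      rw [h0] at hx'
      rw [IsLeafRegion.eq_of_level_zero hσ₀ hx'.1.2 (hcl x) hx'.2.1 (hcl y) hy'.2.1]
      exact (d y).center_mem
    · refine ⟨pt (reg x) (ty x) (idx x), fun y hy => ?_⟩
      obtain ⟨h1, h2, h3, h4⟩ := hsame c hc x hx y hy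
      rw [h2, h3, h4]
      exact hpt y (h1 ▸ h0)
  · intro i R
    have hassR : ∀ x, IsAssigned o σ₀ l (d x) i R → lev x = i ∧ reg x = R := fun x h =>
      (hass x).unique hσ₀ h
    -- The cliques of one node inject into the pairs of type and index, through a representative of
    -- each.
    have key : ∀ T : Finset (ℕ × ℕ), (∀ x, lev x = i → (ty x, idx x) ∈ T) →
        {c | c ∈ C.parts ∧ ∀ x ∈ c, IsAssigned o σ₀ l (d x) i R}.encard ≤ T.card := by
      intro T hT
      rcases isEmpty_or_nonempty (Fin n) with hn | hn
      · refine (Set.encard_eq_zero.2 (Set.eq_empty_of_forall_notMem fun c hc => ?_)).le.trans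
          zero_le
        exact hn.elim (hne c hc.1).choose
      choose! f hf using hne
      rw [← Set.encard_coe_eq_coe_finsetCard]
      refine Set.encard_le_encard_of_injOn (f := fun c => (ty (f c), idx (f c))) ?_ ?_
      · rintro c ⟨hc, hc'⟩
        exact hT _ (hassR _ (hc' _ (hf c hc))).1
      · rintro c ⟨hc, hc'⟩ c' ⟨hc₂, hc₂'⟩ he
        simp only [Prod.mk.injEq] at he
        obtain ⟨h1, h2⟩ := hassR _ (hc' _ (hf c hc))
        obtain ⟨h3, h4⟩ := hassR _ (hc₂' _ (hf c' hc₂))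
        rw [← hpart c hc _ (hf c hc), ← hpart c' hc₂ _ (hf c' hc₂), hC]
        exact ⟨h1.trans h3.symm, h2.trans h4.symm, he.1, he.2⟩
    split_ifs with h0
    · refine (key {(0, 0)} fun x hx => ?_).trans (by simp)
      obtain ⟨h1, h2⟩ := hzero x (hx.trans h0)
      simp [h1, h2]
    · refine (key (Finset.range 2 ×ˢ Finset.range 81) fun x _ => ?_).trans (by simp)
      simp [hty x, hidx x]
  · intro c hc i ρ τ hc'
    obtain ⟨x, hx⟩ := hne c hc
    obtain ⟨h1, h2⟩ := (hass x).unique hσ₀ (hc' x hx)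
    have hl0 : lev x ≠ 0 := by
      intro h0
      have hx' := hass x
      rw [h0, h2] at hx'
      exact hx'.1.2.ne_donut_of_level_zero hσ₀ (hcl x) hx'.2.1
    rcases Nat.lt_or_ge (ty x) 1 with ht | ht
    · right
      intro y hy
      obtain ⟨g1, g2, g3, g4⟩ := hsame c hc x hx y hy
      exact hdisj y ρ τ (g2 ▸ h2) (g1 ▸ hl0) (by omega)
    · left
      intro y hy
      obtain ⟨g1, g2, g3, g4⟩ := hsame c hc x hx y hy
      exact hmeet y ρ τ (g2 ▸ h2) (by have := hty x; omega)

end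

/-! ### Following a search path with two positions instead of tree pointers -/

noncomputable section

/-! ## Following a search path -/

/-- The cell of half the size of `τ` that contains `p`. -/
def quadOf (o : Point) (τ : Cell) (p : Point) : Cell := cellAt o (τ.level - 1) p

theorem exists_quadOf_eq {o p : Point} {τ : Cell} (h : p ∈ τ.toSet o) :
    ∃ a, quadOf o τ p = τ.quadrant a ∧ p ∈ (τ.quadrant a).toSet o := by
  obtain ⟨a, ha⟩ := Cell.exists_quadrant h
  exact ⟨a, Cell.mem_iff_cellAt.1 ha, ha⟩

/-- A node on the search path of a point: the (outer) cell of its region, and the first and the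
last position in `l` of the points of the current level in this cell (`0` if there are none). -/
structure PathState where
  cell : Cell
  f : ℕ
  g : ℕ

/-- The region described by a state. -/
def PathState.region (o : Point) (l : List Point) (st : PathState) : Region :=
  if st.f < st.g then .donut st.cell (lcc o (pnt l st.f) (pnt l st.g)) else .cell st.cell

open Classical in
/-- The state of the search path of `p` after insertion of the point at position `z`. -/
def PathState.ins (o : Point) (l : List Point) (p : Point) (st : PathState) (z : ℕ) : PathState :=
  if 1 ≤ z ∧ z ≤ l.length ∧ pnt l z ∈ st.cell.toSet o then
    if st.f = 0 then ⟨st.cell, z, z⟩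
    else if st.f ≤ z ∧ z ≤ st.g then st
    else
      if p ∈ (lcc o (pnt l (min st.f z)) (pnt l (max st.g z))).toSet o then
        if pnt l z ∈ (quadOf o (lcc o (pnt l (min st.f z)) (pnt l (max st.g z))) p).toSet o then
          ⟨quadOf o (lcc o (pnt l (min st.f z)) (pnt l (max st.g z))) p, z, z⟩
        else if pnt l st.f ∈
            (quadOf o (lcc o (pnt l (min st.f z)) (pnt l (max st.g z))) p).toSet o then
          ⟨quadOf o (lcc o (pnt l (min st.f z)) (pnt l (max st.g z))) p, st.f, st.g⟩
        else ⟨quadOf o (lcc o (pnt l (min st.f z)) (pnt l (max st.g z))) p, 0, 0⟩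
      else ⟨st.cell, min st.f z, max st.g z⟩
  else st

/-- `st` describes the node containing `p` in the tree on the points at the positions in `U`. -/
structure PathState.Valid (o : Point) (l : List Point) (σ₀ : Cell) (p : Point) (U : Set ℕ)
    (st : PathState) : Prop where
  pos : ∀ u ∈ U, 1 ≤ u ∧ u ≤ l.length
  mem : p ∈ st.cell.toSet o
  node : IsNode o σ₀ (pnt l '' U) st.cell
  range : ∀ u ∈ U, pnt l u ∈ st.cell.toSet o → st.f ≤ u ∧ u ≤ st.g
  ends : (st.f = 0 ∧ st.g = 0) ∨ (st.f ∈ U ∧ st.g ∈ U ∧ pnt l st.f ∈ st.cell.toSet o ∧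
    pnt l st.g ∈ st.cell.toSet o ∧ st.f ≤ st.g)
  hole : st.f < st.g → p ∉ (lcc o (pnt l st.f) (pnt l st.g)).toSet o

variable {o p : Point} {l : List Point} {σ₀ : Cell} {U : Set ℕ} {st : PathState}

theorem PathState.Valid.posIn (h : st.Valid o l σ₀ p U) {u : ℕ} (hu : u ∈ U) {σ : Cell}
    (hσ : pnt l u ∈ σ.toSet o) : PosIn o l σ u :=
  ⟨(h.pos u hu).1, (h.pos u hu).2, hσ⟩

theorem pnt_ne (hl : l.Pairwise (ZLt o)) {u v : ℕ} (h1 : 1 ≤ u) (h2 : u < v) (h3 : v ≤ l.length) :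
    pnt l u ≠ pnt l v :=
  (zLt_pnt hl h1 h2 h3).ne

theorem isSmallestCell_lcc_pnt (hl : l.Pairwise (ZLt o)) {σ : Cell} {u v : ℕ} (hu : PosIn o l σ u)
    (hv : PosIn o l σ v) (h : u < v) :
    IsSmallestCell o {pnt l u, pnt l v} (lcc o (pnt l u) (pnt l v)) :=
  isSmallestCell_lcc hu.2.2 hv.2.2 (pnt_ne hl hu.1 h hv.2.1)

theorem PathState.Valid.mono {U' : Set ℕ} (h : st.Valid o l σ₀ p U) (hU : U ⊆ U')
    (hpos : ∀ u ∈ U', 1 ≤ u ∧ u ≤ l.length)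
    (hr : ∀ u ∈ U', pnt l u ∈ st.cell.toSet o → st.f ≤ u ∧ u ≤ st.g) : st.Valid o l σ₀ p U' where
  pos := hpos
  mem := h.mem
  node := h.node.mono (Set.image_mono hU)
  range := hr
  ends := h.ends.imp_right fun ⟨h1, h2, h3⟩ => ⟨hU h1, hU h2, h3⟩
  hole := h.hole

theorem isNode_quadOf {Q : Set Point} {q r : Point} {τ : Cell} (hq : q ∈ Q) (hr : r ∈ Q)
    (hτ : IsSmallestCell o {q, r} τ) (hqr : q ≠ r) (hp : p ∈ τ.toSet o) :
    IsNode o σ₀ Q (quadOf o τ p) := by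
  obtain ⟨a, ha, -⟩ := exists_quadOf_eq hp
  have hqτ : q ∈ τ.toSet o := hτ.1 (by simp)
  have hrτ : r ∈ τ.toSet o := hτ.1 (by simp)
  refine Or.inr ⟨τ, a, ⟨q, ⟨hq, hqτ⟩, r, ⟨hr, hrτ⟩, hqr⟩, ⟨Set.inter_subset_right, ?_⟩, ha⟩
  intro τ' h
  refine hτ.2 τ' ?_
  rintro x (rfl | rfl)
  exacts [h ⟨hq, hqτ⟩, h ⟨hr, hrτ⟩]

/-- A new point outside the cell, or between the first and last positions, changes nothing.
Otherwise let `τ` be the new smallest cell. If `p` is not in `τ`, the hole becomes `τ`. If it is,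
then `τ` exceeds the old hole, so the old points share one quadrant of `τ` while the new point lies
in another. The quadrant of `p` thus inherits the new point alone, or the old points unchanged, or
nothing, and one descent is enough. -/
theorem PathState.Valid.ins (hl : l.Pairwise (ZLt o)) (h : st.Valid o l σ₀ p U) (z : ℕ) :
    (st.ins o l p z).Valid o l σ₀ p (U ∪ {u | u = z ∧ 1 ≤ z ∧ z ≤ l.length}) ∧
      (st.ins o l p z).cell.toSet o ⊆ st.cell.toSet o := by
  have hU : U ⊆ U ∪ {u | u = z ∧ 1 ≤ z ∧ z ≤ l.length} := Set.subset_union_left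
  have hpos : ∀ u ∈ U ∪ {u | u = z ∧ 1 ≤ z ∧ z ≤ l.length}, 1 ≤ u ∧ u ≤ l.length := by
    rintro u (hu | ⟨rfl, h1, h2⟩)
    exacts [h.pos u hu, ⟨h1, h2⟩]
  unfold PathState.ins
  by_cases hz : 1 ≤ z ∧ z ≤ l.length ∧ pnt l z ∈ st.cell.toSet o
  swap
  · rw [if_neg hz]
    refine ⟨h.mono hU hpos ?_, subset_rfl⟩
    rintro u (hu | ⟨rfl, h1, h2⟩) hσ
    exacts [h.range u hu hσ, absurd ⟨h1, h2, hσ⟩ hz]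
  rw [if_pos hz]
  have hzU : z ∈ U ∪ {u | u = z ∧ 1 ≤ z ∧ z ≤ l.length} := Or.inr ⟨rfl, hz.1, hz.2.1⟩
  have hzI : PosIn o l st.cell z := hz
  by_cases hf0 : st.f = 0
  · rw [if_pos hf0]
    have hg0 : st.g = 0 := by
      rcases h.ends with h1 | ⟨h1, -⟩
      · exact h1.2
      · have := (h.pos _ h1).1
        omega
    refine ⟨⟨hpos, h.mem, h.node.mono (Set.image_mono hU), ?_, Or.inr ⟨hzU, hzU, hz.2.2, hz.2.2,
      le_rfl⟩, fun h => absurd h (lt_irrefl _)⟩, subset_rfl⟩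
    rintro u (hu | ⟨rfl, -⟩) hσ
    · have := h.range u hu hσ
      have := (h.pos u hu).1
      omega
    · exact ⟨le_rfl, le_rfl⟩
  rw [if_neg hf0]
  obtain ⟨hfU, hgU, hf, hg, hfg⟩ := h.ends.resolve_left fun h1 => hf0 h1.1
  by_cases hb : st.f ≤ z ∧ z ≤ st.g
  · rw [if_pos hb]
    refine ⟨h.mono hU hpos ?_, subset_rfl⟩
    rintro u (hu | ⟨rfl, h1, h2⟩) hσ
    exacts [h.range u hu hσ, hb]
  rw [if_neg hb]
  have hfI := h.posIn hfU hf
  have hgI := h.posIn hgU hg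
  set f' := min st.f z with hf'
  set g' := max st.g z with hg'
  have hlt : f' < g' := by omega
  have hf'I : PosIn o l st.cell f' := by
    rcases min_choice st.f z with e | e <;> rw [hf', e] <;> assumption
  have hg'I : PosIn o l st.cell g' := by
    rcases max_choice st.g z with e | e <;> rw [hg', e] <;> assumption
  have hf'U : f' ∈ U ∪ {u | u = z ∧ 1 ≤ z ∧ z ≤ l.length} := by
    rcases min_choice st.f z with e | e <;> rw [hf', e]
    exacts [hU hfU, hzU]
  have hg'U : g' ∈ U ∪ {u | u = z ∧ 1 ≤ z ∧ z ≤ l.length} := by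
    rcases max_choice st.g z with e | e <;> rw [hg', e]
    exacts [hU hgU, hzU]
  have hτ := isSmallestCell_lcc_pnt hl hf'I hg'I hlt
  set τ := lcc o (pnt l f') (pnt l g') with hτdef
  have hne := pnt_ne hl hf'I.1 hlt hg'I.2.1
  by_cases hpτ : p ∈ τ.toSet o
  swap
  · rw [if_neg hpτ]
    refine ⟨⟨hpos, h.mem, h.node.mono (Set.image_mono hU), ?_, Or.inr ⟨hf'U, hg'U, hf'I.2.2,
      hg'I.2.2, hlt.le⟩, fun _ => hpτ⟩, subset_rfl⟩
    rintro u (hu | ⟨rfl, -⟩) hσ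
    · have := h.range u hu hσ
      change f' ≤ u ∧ u ≤ g'
      omega
    · change f' ≤ u ∧ u ≤ g'
      omega
  rw [if_pos hpτ]
  obtain ⟨a, ha, hpa⟩ := exists_quadOf_eq hpτ
  have hnode : IsNode o σ₀ (pnt l '' (U ∪ {u | u = z ∧ 1 ≤ z ∧ z ≤ l.length})) (quadOf o τ p) :=
    isNode_quadOf (Set.mem_image_of_mem _ hf'U) (Set.mem_image_of_mem _ hg'U) hτ hne hpτ
  rw [ha] at hnode ⊢
  have hτσ : τ.toSet o ⊆ st.cell.toSet o :=
    hτ.2 _ (by rintro x (rfl | rfl); exacts [hf'I.2.2, hg'I.2.2])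
  have hqσ := (τ.quadrant_subset o a).trans hτσ
  have hf'τ : PosIn o l τ f' := ⟨hf'I.1, hf'I.2.1, hτ.1 (by simp)⟩
  have hg'τ : PosIn o l τ g' := ⟨hg'I.1, hg'I.2.1, hτ.1 (by simp)⟩
  have hfτ : PosIn o l τ st.f := hf'τ.between hl hg'τ (by omega) (by omega)
  have hgτ : PosIn o l τ st.g := hf'τ.between hl hg'τ (by omega) (by omega)
  -- the points between the two ends lie in a common quadrant
  have hsame : ∀ u, st.f ≤ u → u ≤ st.g → ∀ v, st.f ≤ v → v ≤ st.g → ∀ b,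
      pnt l u ∈ (τ.quadrant b).toSet o → pnt l v ∈ (τ.quadrant b).toSet o := by
    intro u hu1 hu2 v hv1 hv2 b hub
    rcases hfg.eq_or_lt with he | hfg'
    · obtain rfl : u = v := by omega
      exact hub
    · have hρ := isSmallestCell_lcc_pnt hl hfI hgI hfg'
      have hpρ := h.hole hfg'
      set ρ := lcc o (pnt l st.f) (pnt l st.g)
      have hρI : ∀ u, st.f ≤ u → u ≤ st.g → pnt l u ∈ ρ.toSet o := fun u h1 h2 =>
        (PosIn.between hl (σ := ρ) ⟨hfI.1, hfI.2.1, hρ.1 (by simp)⟩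
          ⟨hgI.1, hgI.2.1, hρ.1 (by simp)⟩ h1 h2).2.2
      refine Cell.subset_quadrant (hρI u hu1 hu2) hub ?_ (hρI v hv1 hv2)
      -- A hole at least as large as `τ` would contain `τ`, and with it `p`.
      by_contra hlev
      push Not at hlev
      exact hpρ (Cell.subset_of_level_le hfτ.2.2 (hρI _ le_rfl hfg) hlev hpτ)
  by_cases hzσ : pnt l z ∈ (τ.quadrant a).toSet o
  · rw [if_pos hzσ]
    refine ⟨⟨hpos, hpa, hnode, ?_, Or.inr ⟨hzU, hzU, hzσ, hzσ, le_rfl⟩,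
      fun h => absurd h (lt_irrefl _)⟩, hqσ⟩
    rintro u (hu | ⟨rfl, -⟩) hσ
    -- An old point in the quadrant of the new one would bring both ends into that quadrant, and `τ`
    -- would not be smallest.
    · exfalso
      obtain ⟨h1, h2⟩ := h.range u hu (hqσ hσ)
      refine hτ.not_subset_quadrant a ?_
      have hall : ∀ v, st.f ≤ v → v ≤ st.g → pnt l v ∈ (τ.quadrant a).toSet o := fun v h3 h4 =>
        hsame u h1 h2 v h3 h4 a hσ
      rintro x (rfl | rfl)
      · rcases min_choice st.f z with e | e <;> rw [hf', e]
        exacts [hall _ le_rfl hfg, hzσ]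
      · rcases max_choice st.g z with e | e <;> rw [hg', e]
        exacts [hall _ hfg le_rfl, hzσ]
    · exact ⟨le_rfl, le_rfl⟩
  rw [if_neg hzσ]
  by_cases hfσ : pnt l st.f ∈ (τ.quadrant a).toSet o
  · rw [if_pos hfσ]
    refine ⟨⟨hpos, hpa, hnode, ?_, Or.inr ⟨hU hfU, hU hgU, hfσ,
      hsame _ le_rfl hfg _ hfg le_rfl a hfσ, hfg⟩, h.hole⟩, hqσ⟩
    rintro u (hu | ⟨rfl, -⟩) hσ
    exacts [h.range u hu (hqσ hσ), absurd hσ hzσ]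
  · rw [if_neg hfσ]
    refine ⟨⟨hpos, hpa, hnode, ?_, Or.inl ⟨rfl, rfl⟩, fun h => absurd h (lt_irrefl _)⟩, hqσ⟩
    rintro u (hu | ⟨rfl, -⟩) hσ
    · obtain ⟨h1, h2⟩ := h.range u hu (hqσ hσ)
      exact absurd (hsame u h1 h2 _ le_rfl hfg a hσ) hfσ
    · exact absurd hσ hzσ

/-- The positions of the points of the level of width `w`. -/
def mults (l : List Point) (w : ℕ) : Set ℕ := {u | (1 ≤ u ∧ u ≤ l.length) ∧ w ∣ u}

theorem image_mults (l : List Point) (i : ℕ) : pnt l '' mults l (2 ^ i) = levelPoints l i := by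
  ext p
  rw [mem_levelPoints]
  constructor
  · rintro ⟨u, ⟨⟨h1, h2⟩, h3⟩, rfl⟩
    exact ⟨u, h1, h2, h3, rfl⟩
  · rintro ⟨u, h1, h2, h3, rfl⟩
    exact ⟨u, ⟨⟨h1, h2⟩, h3⟩, rfl⟩

/-- The next state on a search path. -/
def PathState.next (o : Point) (l : List Point) (p : Point) (st : PathState) (w c : ℕ) :
    PathState :=
  ((st.ins o l p (st.f - w)).ins o l p (st.g + w)).ins o l p (c + w)

/-- Besides positions between `f` and `g`, the refinement of a level can add only `f - w` and `g +
w` to a nonempty cell, and only `c + w` to an empty one. All three are inserted in every case: an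
extra position of the level does no harm, and position 0, which results from truncated subtraction,
is ignored. The other multiples of `w` are then shown to lie in the recorded range. -/
theorem PathState.Valid.next (hl : l.Pairwise (ZLt o)) {w c j : ℕ}
    (h : st.Valid o l σ₀ p (mults l (2 * w))) (hj : 1 ≤ j ∧ j ≤ l.length) (hpj : pnt l j = p)
    (hc : 2 * w ∣ c) (h1 : c ≤ j) (h2 : j < c + 2 * w) :
    (st.next o l p w c).Valid o l σ₀ p (mults l w) := by
  obtain ⟨v1, s1⟩ := h.ins hl (st.f - w)
  obtain ⟨v2, s2⟩ := v1.ins hl (st.g + w)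
  obtain ⟨v3, s3⟩ := v2.ins hl (c + w)
  set st3 := st.next o l p w c with hst3
  change st3.Valid o l σ₀ p _ at v3
  change st3.cell.toSet o ⊆ _ at s3
  have hsub := s3.trans (s2.trans s1)
  have hw2 : ∀ u, 2 * w ∣ u → w ∣ u := fun u hu => (Dvd.intro_left 2 rfl).trans hu
  have hends : (st.f = 0 ∧ st.g = 0) ∨ (2 * w ∣ st.f ∧ 2 * w ∣ st.g) :=
    h.ends.imp_right fun h => ⟨h.1.2, h.2.1.2⟩
  refine v3.mono ?_ (fun u hu => hu.1) ?_
  · have hfd : w ∣ st.f := by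
      rcases hends with e | e
      · rw [e.1]; exact dvd_zero w
      · exact hw2 _ e.1
    have hgd : w ∣ st.g := by
      rcases hends with e | e
      · rw [e.2]; exact dvd_zero w
      · exact hw2 _ e.2
    rintro u (((hu | ⟨rfl, hu⟩) | ⟨rfl, hu⟩) | ⟨rfl, hu⟩)
    · exact ⟨hu.1, hw2 _ hu.2⟩
    · exact ⟨hu, Nat.dvd_sub hfd dvd_rfl⟩
    · exact ⟨hu, dvd_add hgd dvd_rfl⟩
    · exact ⟨hu, dvd_add (hw2 _ hc) dvd_rfl⟩
  · rintro u ⟨hu, hud⟩ huσ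
    have huI : PosIn o l st.cell u := ⟨hu.1, hu.2, hsub huσ⟩
    have hin : u = st.f - w ∨ u = st.g + w ∨ u = c + w → st3.f ≤ u ∧ u ≤ st3.g := by
      rintro (e | e | e)
      · exact v3.range u (Or.inl (Or.inl (Or.inr ⟨e, e ▸ hu⟩))) huσ
      · exact v3.range u (Or.inl (Or.inr ⟨e, e ▸ hu⟩)) huσ
      · exact v3.range u (Or.inr ⟨e, e ▸ hu⟩) huσ
    rcases h.ends with ⟨hf0, hg0⟩ | ⟨hfU, hgU, hf, hg, hfg⟩
    -- The cell has no point of the coarser level but contains `p`, at position `j` between `c` and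
    -- `c + 2 * w`.
    · refine hin (Or.inr (Or.inr ?_))
      refine PosIn.refine_empty hl ?_ (j := j) ⟨hj.1, hj.2, hpj ▸ h.mem⟩ hc h1 h2 huI hud
      intro v hvd hv
      have := h.range v ⟨⟨hv.1, hv.2.1⟩, hvd⟩ hv.2.2
      have := hv.1
      omega
    · have hfI := h.posIn hfU hf
      have hgI := h.posIn hgU hg
      rcases hfI.refine hl hgI hfU.2 hgU.2 (fun v hvd hv => h.range v ⟨⟨hv.1, hv.2.1⟩, hvd⟩ hv.2.2)
        huI hud with e | e | e
      · exact hin (Or.inl (by omega))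
      · exact hin (Or.inr (Or.inl e))
      -- A position strictly between `f` and `g` lies in the old hole. If the final cell contains
      -- it, the cell and the hole are nested; as `p` is in the cell but not in the hole, the cell
      -- contains the whole hole and both ends.
      · have hfg3 : pnt l st.f ∈ st3.cell.toSet o ∧ pnt l st.g ∈ st3.cell.toSet o := by
          rcases hfg.eq_or_lt with he | hfg'
          · obtain rfl : u = st.f := by omega
            exact ⟨huσ, he ▸ huσ⟩
          · have hρ := isSmallestCell_lcc_pnt hl hfI hgI hfg'
            have hpρ := h.hole hfg'
            set ρ := lcc o (pnt l st.f) (pnt l st.g)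
            have hfρ : PosIn o l ρ st.f := ⟨hfI.1, hfI.2.1, hρ.1 (by simp)⟩
            have hgρ : PosIn o l ρ st.g := ⟨hgI.1, hgI.2.1, hρ.1 (by simp)⟩
            have huρ := (hfρ.between hl hgρ e.1 e.2).2.2
            have hρσ : ρ.toSet o ⊆ st3.cell.toSet o := by
              rcases Cell.subset_or_subset huρ huσ with hs | hs
              · exact hs
              · exact absurd (hs v3.mem) hpρ
            exact ⟨hρσ hfρ.2.2, hρσ hgρ.2.2⟩
        have hf3 := v3.range _ (Or.inl (Or.inl (Or.inl hfU))) hfg3.1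
        have hg3 := v3.range _ (Or.inl (Or.inl (Or.inl hgU))) hfg3.2
        omega

/-- By convexity, a cell that contains the first and the last point contains all points between, so
two points determine the hole. -/
theorem PathState.Valid.isRegionOf (hl : l.Pairwise (ZLt o)) (h : st.Valid o l σ₀ p U) :
    IsRegionOf o (pnt l '' U) st.cell (st.region o l) ∧ p ∈ (st.region o l).toSet o := by
  unfold PathState.region
  split_ifs with hlt
  · obtain ⟨hfU, hgU, hf, hg, hfg⟩ := h.ends.resolve_left fun h1 => by omega
    have hfI := h.posIn hfU hf
    have hgI := h.posIn hgU hg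
    have hρ := isSmallestCell_lcc_pnt hl hfI hgI hlt
    have hpρ := h.hole hlt
    set ρ := lcc o (pnt l st.f) (pnt l st.g)
    have hfρ : PosIn o l ρ st.f := ⟨hfI.1, hfI.2.1, hρ.1 (by simp)⟩
    have hgρ : PosIn o l ρ st.g := ⟨hgI.1, hgI.2.1, hρ.1 (by simp)⟩
    refine ⟨Or.inr ⟨ρ, ?_, ⟨?_, fun τ' hτ' => hρ.2 τ' ?_⟩, ?_, rfl⟩, h.mem, hpρ⟩
    · exact ⟨_, ⟨Set.mem_image_of_mem _ hfU, hf⟩, _, ⟨Set.mem_image_of_mem _ hgU, hg⟩,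
        pnt_ne hl hfI.1 hlt hgI.2.1⟩
    · rintro _ ⟨⟨u, hu, rfl⟩, huσ⟩
      obtain ⟨h1, h2⟩ := h.range u hu huσ
      exact (hfρ.between hl hgρ h1 h2).2.2
    · rintro x (rfl | rfl)
      exacts [hτ' ⟨Set.mem_image_of_mem _ hfU, hf⟩, hτ' ⟨Set.mem_image_of_mem _ hgU, hg⟩]
    · intro e
      exact hpρ (e ▸ h.mem)
  · refine ⟨Or.inl ⟨?_, rfl⟩, h.mem⟩
    rintro _ ⟨⟨u, hu, rfl⟩, huσ⟩ _ ⟨⟨v, hv, rfl⟩, hvσ⟩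
    have h1 := h.range u hu huσ
    have h2 := h.range v hv hvσ
    obtain rfl : u = v := by omega
    rfl

theorem PathState.Valid.isLeafRegion (hl : l.Pairwise (ZLt o)) (hσ₀ : ∀ p ∈ l, p ∈ σ₀.toSet o)
    {i : ℕ} (h : st.Valid o l σ₀ p (mults l (2 ^ i))) :
    IsLeafRegion o σ₀ (levelPoints l i) (st.region o l) ∧ p ∈ (st.region o l).toSet o := by
  obtain ⟨h1, h2⟩ := h.isRegionOf hl
  have h3 := h.node
  rw [image_mults] at h1 h3
  exact ⟨(isLeafRegion_iff (levelPoints_finite l i) (levelPoints_subset hσ₀ i)).2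
    ⟨_, h3, h1⟩, h2⟩

theorem PathState.valid_init (hp : p ∈ σ₀.toSet o) :
    (PathState.mk σ₀ 0 0).Valid o l σ₀ p (mults l (2 ^ (Nat.log 2 l.length + 1))) := by
  have : mults l (2 ^ (Nat.log 2 l.length + 1)) = ∅ := by
    refine Set.eq_empty_iff_forall_notMem.2 fun u ⟨⟨h1, h2⟩, h3⟩ => ?_
    have := Nat.le_of_dvd (by omega) h3
    have := Nat.lt_pow_succ_log_self (b := 2) (by norm_num) l.length
    omega
  rw [this]
  exact ⟨by simp, hp, Or.inl rfl, by simp, Or.inl ⟨rfl, rfl⟩, fun h => absurd h (lt_irrefl _)⟩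

end

/-! ### A command language on the extended real RAM, with cost bounds -/

noncomputable section

/-! ## Programs over named registers -/

/-- The contents of the named registers and of the memory. -/
structure St where
  (n top src k i j m e w N pb rb wb t x q c f g z u v fl kx : ℕ)
  (bX bY bS tX tY tS qX qY qS lev tl ty ix : ℝ)
  nm : ℕ → ℕ
  rm : ℕ → ℝ

/-- The named registers of a machine state; all other registers are scratch registers. -/
def St.of (s : RamState) : St where
  n := s.nreg 0
  top := s.nreg 1
  src := s.nreg 2
  k := s.nreg 3
  i := s.nreg 4
  j := s.nreg 5
  m := s.nreg 6
  e := s.nreg 7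
  w := s.nreg 8
  N := s.nreg 9
  pb := s.nreg 10
  rb := s.nreg 11
  wb := s.nreg 12
  t := s.nreg 13
  x := s.nreg 14
  q := s.nreg 15
  c := s.nreg 16
  f := s.nreg 17
  g := s.nreg 18
  z := s.nreg 19
  u := s.nreg 20
  v := s.nreg 21
  fl := s.nreg 22
  kx := s.nreg 23
  bX := s.rreg 0
  bY := s.rreg 1
  bS := s.rreg 2
  tX := s.rreg 3
  tY := s.rreg 4
  tS := s.rreg 5
  qX := s.rreg 6
  qY := s.rreg 7
  qS := s.rreg 8
  lev := s.rreg 9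
  tl := s.rreg 10
  ty := s.rreg 11
  ix := s.rreg 12
  nm := s.nmem
  rm := s.rmem

/-- `s'` agrees with `s` on the registers below `b` and on the memory. -/
structure Keeps (b : ℕ) (s s' : RamState) : Prop where
  nreg : ∀ r < b, s'.nreg r = s.nreg r
  rreg : ∀ r < b, s'.rreg r = s.rreg r
  nmem : s'.nmem = s.nmem
  rmem : s'.rmem = s.rmem

theorem Keeps.trans {b b' : ℕ} {s s' s'' : RamState} (h : Keeps b s s') (h' : Keeps b' s' s'')
    (hb : b ≤ b') : Keeps b s s'' :=
  ⟨fun r hr => (h'.nreg r (by omega)).trans (h.nreg r hr),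
    fun r hr => (h'.rreg r (by omega)).trans (h.rreg r hr), h'.nmem.trans h.nmem,
    h'.rmem.trans h.rmem⟩

theorem Keeps.of_eq {b : ℕ} {s s' : RamState} (h : Keeps b s s') (hb : 24 ≤ b) :
    St.of s' = St.of s := by
  simp only [St.of, h.nmem, h.rmem]
  congr 1 <;> first | exact h.nreg _ (by omega) | exact h.rreg _ (by omega)

theorem Keeps.nset {b r v : ℕ} (s : RamState) (h : b ≤ r) :
    Keeps b s { s with nreg := Function.update s.nreg r v } :=
  ⟨fun _ hr => Function.update_of_ne (by omega) _ _, fun _ _ => rfl, rfl, rfl⟩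

theorem Keeps.rset {b r : ℕ} {v : ℝ} (s : RamState) (h : b ≤ r) :
    Keeps b s { s with rreg := Function.update s.rreg r v } :=
  ⟨fun _ _ => rfl, fun _ hr => Function.update_of_ne (by omega) _ _, rfl, rfl⟩

/-- The program halts within `c` steps in a state with the property `Q`. -/
def Halts (A : Prog) (s : RamState) (c : ℕ) (Q : RamState → Prop) : Prop :=
  ∃ m s', Exec A s m s' ∧ m ≤ c ∧ Q s'

theorem Halts.mono {A : Prog} {s : RamState} {c c' : ℕ} {Q Q' : RamState → Prop}
    (h : Halts A s c Q) (hc : c ≤ c') (hQ : ∀ s', Q s' → Q' s') : Halts A s c' Q' := by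
  obtain ⟨m, s', h1, h2, h3⟩ := h
  exact ⟨m, s', h1, h2.trans hc, hQ s' h3⟩

theorem Halts.instr {a : Instr} {s : RamState} {Q : RamState → Prop} (h : Q (a.run s)) :
    Halts (.instr a) s 1 Q := ⟨1, _, .instr a, le_rfl, h⟩

theorem Halts.seq {A B : Prog} {s : RamState} {c c' : ℕ} {Q : RamState → Prop}
    (h : Halts A s c fun s' => Halts B s' c' Q) : Halts (.seq A B) s (c + c') Q := by
  obtain ⟨m, s', h1, h2, m', s'', h3, h4, h5⟩ := h
  exact ⟨m + m', s'', .seq h1 h3, by omega, h5⟩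

theorem Halts.ite {b : Test} {A B : Prog} {s : RamState} {c : ℕ} {Q : RamState → Prop}
    (hA : b.holds s → Halts A s c Q) (hB : ¬ b.holds s → Halts B s c Q) :
    Halts (.ite b A B) s (c + 1) Q := by
  by_cases hb : b.holds s
  · obtain ⟨m, s', h1, h2, h3⟩ := hA hb
    exact ⟨m + 1, s', .ite_true hb h1, by omega, h3⟩
  · obtain ⟨m, s', h1, h2, h3⟩ := hB hb
    exact ⟨m + 1, s', .ite_false hb h1, by omega, h3⟩

/-- `f` can be computed in constant time, using only scratch registers. -/
@[fun_prop]
def NC (f : St → ℕ) : Prop := ∀ b, 24 ≤ b → ∃ A c, ∀ s,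
  Halts A s c fun s' => Keeps b s s' ∧ s'.nreg b = f (.of s)

/-- `f` can be computed in constant time, using only scratch registers. -/
@[fun_prop]
def RC (f : St → ℝ) : Prop := ∀ b, 24 ≤ b → ∃ A c, ∀ s,
  Halts A s c fun s' => Keeps b s s' ∧ s'.rreg b = f (.of s)

open Classical in
/-- `P` can be decided in constant time, using only scratch registers. -/
@[fun_prop]
def BC (P : St → Prop) : Prop := NC fun s => if P s then 1 else 0

theorem NC.of_reg {f : St → ℕ} (r : ℕ) (hr : r < 24) (h : ∀ s, f (.of s) = s.nreg r) : NC f := by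
  intro b hb
  -- There is no copy instruction; a register is copied by adding it to zero.
  refine ⟨.seq (.instr (.nconst b 0)) (.instr (.nadd b r b)), _, fun s => .seq (.instr (.instr ?_))⟩
  refine ⟨(Keeps.nset s le_rfl).trans (Keeps.nset _ le_rfl) le_rfl, ?_⟩
  simp [Instr.run, h, Function.update_of_ne (show r ≠ b by omega)]

theorem RC.of_reg {f : St → ℝ} (r : ℕ) (hr : r < 24) (h : ∀ s, f (.of s) = s.rreg r) : RC f := by
  intro b hb
  refine ⟨.seq (.instr (.rconst b 0)) (.instr (.radd b r b)), _, fun s => .seq (.instr (.instr ?_))⟩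
  refine ⟨(Keeps.rset s le_rfl).trans (Keeps.rset _ le_rfl) le_rfl, ?_⟩
  simp [Instr.run, h, Function.update_of_ne (show r ≠ b by omega)]

@[fun_prop]
theorem NC.const (v : ℕ) : NC fun _ => v := fun b _ =>
  ⟨.instr (.nconst b v), _, fun s => .instr ⟨Keeps.nset s le_rfl, by simp [Instr.run]⟩⟩

theorem RC.const_rat (v : ℚ) : RC fun _ => (v : ℝ) := fun b _ =>
  ⟨.instr (.rconst b v), _, fun s => .instr ⟨Keeps.rset s le_rfl, by simp [Instr.run]⟩⟩

/-- The first operand waits in register `b` while the second is computed with scratch registers from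
`b + 1` on. The scratch registers thus act as an evaluation stack, which is why computability is
required for every `b`. -/
theorem NC.binop {f g : St → ℕ} (hf : NC f) (hg : NC g) (op : ℕ → ℕ → ℕ)
    (ins : ℕ → ℕ → ℕ → Instr) (h : ∀ a b c s, (ins a b c).run s =
      { s with nreg := Function.update s.nreg a (op (s.nreg b) (s.nreg c)) }) :
    NC fun s => op (f s) (g s) := by
  intro b hb
  obtain ⟨A, c, hA⟩ := hf b hb
  obtain ⟨B, c', hB⟩ := hg (b + 1) (by omega)
  refine ⟨.seq A (.seq B (.instr (ins b b (b + 1)))), c + (c' + 1), fun s => .seq ((hA s).mono le_rfl ?_)⟩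
  rintro s₁ ⟨k1, v1⟩
  refine .seq ((hB s₁).mono le_rfl ?_)
  rintro s₂ ⟨k2, v2⟩
  refine .instr ?_
  rw [h]
  refine ⟨(k1.trans k2 (by omega)).trans (Keeps.nset s₂ le_rfl) le_rfl, ?_⟩
  rw [k1.of_eq hb] at v2
  simp [v2, k2.nreg b (by omega), v1]

theorem RC.binop {f g : St → ℝ} (hf : RC f) (hg : RC g) (op : ℝ → ℝ → ℝ)
    (ins : ℕ → ℕ → ℕ → Instr) (h : ∀ a b c s, (ins a b c).run s =
      { s with rreg := Function.update s.rreg a (op (s.rreg b) (s.rreg c)) }) :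
    RC fun s => op (f s) (g s) := by
  intro b hb
  obtain ⟨A, c, hA⟩ := hf b hb
  obtain ⟨B, c', hB⟩ := hg (b + 1) (by omega)
  refine ⟨.seq A (.seq B (.instr (ins b b (b + 1)))), c + (c' + 1), fun s => .seq ((hA s).mono le_rfl ?_)⟩
  rintro s₁ ⟨k1, v1⟩
  refine .seq ((hB s₁).mono le_rfl ?_)
  rintro s₂ ⟨k2, v2⟩
  refine .instr ?_
  rw [h]
  refine ⟨(k1.trans k2 (by omega)).trans (Keeps.rset s₂ le_rfl) le_rfl, ?_⟩
  rw [k1.of_eq hb] at v2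
  simp [v2, k2.rreg b (by omega), v1]

@[fun_prop]
theorem NC.add {f g : St → ℕ} (hf : NC f) (hg : NC g) : NC fun s => f s + g s :=
  hf.binop hg (· + ·) .nadd fun _ _ _ _ => rfl

@[fun_prop]
theorem NC.sub {f g : St → ℕ} (hf : NC f) (hg : NC g) : NC fun s => f s - g s :=
  hf.binop hg (· - ·) .nsub fun _ _ _ _ => rfl

@[fun_prop]
theorem RC.add {f g : St → ℝ} (hf : RC f) (hg : RC g) : RC fun s => f s + g s :=
  hf.binop hg (· + ·) .radd fun _ _ _ _ => rfl

@[fun_prop]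
theorem RC.sub {f g : St → ℝ} (hf : RC f) (hg : RC g) : RC fun s => f s - g s :=
  hf.binop hg (· - ·) .rsub fun _ _ _ _ => rfl

@[fun_prop]
theorem RC.mul {f g : St → ℝ} (hf : RC f) (hg : RC g) : RC fun s => f s * g s :=
  hf.binop hg (· * ·) .rmul fun _ _ _ _ => rfl

@[fun_prop]
theorem RC.div {f g : St → ℝ} (hf : RC f) (hg : RC g) : RC fun s => f s / g s :=
  hf.binop hg (· / ·) .rdiv fun _ _ _ _ => rfl

@[fun_prop]
theorem NC.load {f : St → ℕ} (hf : NC f) : NC fun s => s.nm (f s) := by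
  intro b hb
  obtain ⟨A, c, hA⟩ := hf b hb
  refine ⟨.seq A (.instr (.nload b b)), c + 1, fun s => .seq ((hA s).mono le_rfl ?_)⟩
  rintro s₁ ⟨k1, v1⟩
  exact .instr ⟨k1.trans (Keeps.nset s₁ le_rfl) le_rfl, by simp [Instr.run, v1, k1.nmem, St.of]⟩

@[fun_prop]
theorem RC.load {f : St → ℕ} (hf : NC f) : RC fun s => s.rm (f s) := by
  intro b hb
  obtain ⟨A, c, hA⟩ := hf b hb
  refine ⟨.seq A (.instr (.rload b b)), c + 1, fun s => .seq ((hA s).mono le_rfl ?_)⟩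
  rintro s₁ ⟨k1, v1⟩
  exact .instr ⟨k1.trans (Keeps.rset s₁ le_rfl) le_rfl, by simp [Instr.run, v1, k1.rmem, St.of]⟩

/-- Machine tests only compare registers, so the truth value in `b` is compared with a zero in `b +
1`. -/
theorem BC.run {P : St → Prop} (h : BC P) {b : ℕ} (hb : 24 ≤ b) : ∃ A c, ∀ s,
    Halts A s c fun s' => Keeps b s s' ∧ ((Test.nlt (b + 1) b).holds s' ↔ P (.of s)) := by
  obtain ⟨A, c, hA⟩ := h b hb
  refine ⟨.seq A (.instr (.nconst (b + 1) 0)), c + 1, fun s => .seq ((hA s).mono le_rfl ?_)⟩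
  rintro s₁ ⟨k1, v1⟩
  refine .instr ⟨k1.trans (Keeps.nset s₁ (by omega)) le_rfl, ?_⟩
  simp only [Test.holds, Instr.run, Function.update_self,
    Function.update_of_ne (show b ≠ b + 1 by omega), v1]
  split_ifs with hP <;> simp [hP]

@[fun_prop]
theorem NC.ite {P : St → Prop} [∀ s, Decidable (P s)] {f g : St → ℕ} (hP : BC P) (hf : NC f)
    (hg : NC g) : NC fun s => if P s then f s else g s := by
  intro b hb
  obtain ⟨A, c, hA⟩ := hP.run hb
  obtain ⟨B, c', hB⟩ := hf b hb
  obtain ⟨C, c'', hC⟩ := hg b hb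
  refine ⟨.seq A (.ite (.nlt (b + 1) b) B C), c + (max c' c'' + 1), fun s => .seq
    ((hA s).mono le_rfl ?_)⟩
  rintro s₁ ⟨k1, v1⟩
  refine .ite (fun h => (hB s₁).mono (le_max_left _ _) ?_)
    (fun h => (hC s₁).mono (le_max_right _ _) ?_) <;>
  · rintro s₂ ⟨k2, v2⟩
    rw [v1] at h
    refine ⟨k1.trans k2 le_rfl, ?_⟩
    simp [v2, k1.of_eq hb, h]

@[fun_prop]
theorem RC.ite {P : St → Prop} [∀ s, Decidable (P s)] {f g : St → ℝ} (hP : BC P) (hf : RC f)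
    (hg : RC g) : RC fun s => if P s then f s else g s := by
  intro b hb
  obtain ⟨A, c, hA⟩ := hP.run hb
  obtain ⟨B, c', hB⟩ := hf b hb
  obtain ⟨C, c'', hC⟩ := hg b hb
  refine ⟨.seq A (.ite (.nlt (b + 1) b) B C), c + (max c' c'' + 1), fun s => .seq
    ((hA s).mono le_rfl ?_)⟩
  rintro s₁ ⟨k1, v1⟩
  refine .ite (fun h => (hB s₁).mono (le_max_left _ _) ?_)
    (fun h => (hC s₁).mono (le_max_right _ _) ?_) <;>
  · rintro s₂ ⟨k2, v2⟩
    rw [v1] at h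
    refine ⟨k1.trans k2 le_rfl, ?_⟩
    simp [v2, k1.of_eq hb, h]

@[fun_prop]
theorem BC.nlt {f g : St → ℕ} (hf : NC f) (hg : NC g) : BC fun s => f s < g s := by
  intro b hb
  obtain ⟨A, c, hA⟩ := hf b hb
  obtain ⟨B, c', hB⟩ := hg (b + 1) (by omega)
  refine ⟨.seq A (.seq B (.ite (.nlt b (b + 1)) (.instr (.nconst b 1)) (.instr (.nconst b 0)))), c + (c' + (1 + 1)),
    fun s => .seq ((hA s).mono le_rfl ?_)⟩
  rintro s₁ ⟨k1, v1⟩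
  refine .seq ((hB s₁).mono le_rfl ?_)
  rintro s₂ ⟨k2, v2⟩
  rw [k1.of_eq hb] at v2
  have hk := k1.trans k2 (by omega)
  refine .ite (fun h => .instr ?_) (fun h => .instr ?_) <;>
  · refine ⟨hk.trans (Keeps.nset s₂ le_rfl) le_rfl, ?_⟩
    rw [Test.holds, v2, k2.nreg b (by omega), v1] at h
    simp [Instr.run, h]

@[fun_prop]
theorem BC.rlt {f g : St → ℝ} (hf : RC f) (hg : RC g) : BC fun s => f s < g s := by
  intro b hb
  obtain ⟨A, c, hA⟩ := hf b hb
  obtain ⟨B, c', hB⟩ := hg (b + 1) (by omega)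
  refine ⟨.seq A (.seq B (.ite (.rlt b (b + 1)) (.instr (.nconst b 1)) (.instr (.nconst b 0)))), c + (c' + (1 + 1)),
    fun s => .seq ((hA s).mono le_rfl ?_)⟩
  rintro s₁ ⟨k1, v1⟩
  refine .seq ((hB s₁).mono le_rfl ?_)
  rintro s₂ ⟨k2, v2⟩
  rw [k1.of_eq hb] at v2
  have hk := k1.trans k2 (by omega)
  refine .ite (fun h => .instr ?_) (fun h => .instr ?_) <;>
  · refine ⟨hk.trans (Keeps.nset s₂ le_rfl) le_rfl, ?_⟩
    rw [Test.holds, v2, k2.rreg b (by omega), v1] at h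
    simp [Instr.run, h]

theorem BC.congr {P Q : St → Prop} (h : BC P) (hPQ : ∀ s, P s ↔ Q s) : BC Q := by
  rwa [show Q = P from funext fun s => propext (hPQ s).symm]

@[fun_prop]
theorem BC.not {P : St → Prop} (h : BC P) : BC fun s => ¬ P s := by
  classical
  have : NC fun s => if P s then 0 else 1 := .ite h (.const 0) (.const 1)
  exact (BC.nlt (.const 0) this).congr fun s => by split_ifs <;> simp_all

@[fun_prop]
theorem BC.and {P Q : St → Prop} (hP : BC P) (hQ : BC Q) : BC fun s => P s ∧ Q s := by
  classical
  have : NC fun s => if P s then (if Q s then 1 else 0) else 0 := .ite hP hQ (.const 0)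
  exact (BC.nlt (.const 0) this).congr fun s => by split_ifs <;> simp_all

@[fun_prop]
theorem BC.or {P Q : St → Prop} (hP : BC P) (hQ : BC Q) : BC fun s => P s ∨ Q s :=
  (hP.not.and hQ.not).not.congr fun s => by tauto

@[fun_prop]
theorem BC.nle {f g : St → ℕ} (hf : NC f) (hg : NC g) : BC fun s => f s ≤ g s :=
  (BC.nlt hg hf).not.congr fun _ => not_lt

@[fun_prop]
theorem BC.rle {f g : St → ℝ} (hf : RC f) (hg : RC g) : BC fun s => f s ≤ g s :=
  (BC.rlt hg hf).not.congr fun _ => not_lt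

@[fun_prop]
theorem BC.neq {f g : St → ℕ} (hf : NC f) (hg : NC g) : BC fun s => f s = g s :=
  ((BC.nle hf hg).and (BC.nle hg hf)).congr fun _ => le_antisymm_iff.symm

/-- The smallest cells of the standard grid can be computed. -/
theorem RC.smallestCell {a b c d : St → ℝ} (ha : RC a) (hb : RC b) (hc : RC c) (hd : RC d)
    (π : ℝ × ℝ × ℝ → ℝ) (o : ℕ) (ho : o < 3)
    (hπ : ∀ x : ℝ × ℝ × ℝ, π x = if o = 0 then x.1 else if o = 1 then x.2.1 else x.2.2) :
    RC fun s => π (smallestCellOp (a s, b s) (c s, d s)) := by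
  intro t ht
  obtain ⟨A, c₁, hA⟩ := ha t ht
  obtain ⟨B, c₂, hB⟩ := hb (t + 1) (by omega)
  obtain ⟨C, c₃, hC⟩ := hc (t + 2) (by omega)
  obtain ⟨D, c₄, hD⟩ := hd (t + 3) (by omega)
  refine ⟨.seq A (.seq B (.seq C (.seq D (.seq
    (.instr (.smallestCell (t + 4) (t + 5) (t + 6) t (t + 1) (t + 2) (t + 3)))
    (.seq (.instr (.rconst t 0)) (.instr (.radd t t (t + 4 + o)))))))),
    c₁ + (c₂ + (c₃ + (c₄ + (1 + (1 + 1))))),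
    fun s => .seq ((hA s).mono le_rfl ?_)⟩
  rintro s₁ ⟨k1, v1⟩
  refine .seq ((hB s₁).mono le_rfl ?_)
  rintro s₂ ⟨k2, v2⟩
  refine .seq ((hC s₂).mono le_rfl ?_)
  rintro s₃ ⟨k3, v3⟩
  refine .seq ((hD s₃).mono le_rfl ?_)
  rintro s₄ ⟨k4, v4⟩
  have h12 := k1.trans k2 (by omega)
  have h13 := h12.trans k3 (by omega)
  have h14 := h13.trans k4 (by omega)
  have h24 := (k2.trans k3 (by omega)).trans k4 (by omega)
  have h34 := k3.trans k4 (by omega)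
  rw [k1.of_eq ht] at v2
  rw [h12.of_eq ht] at v3
  rw [h13.of_eq ht] at v4
  have w1 := (h24.rreg t (by omega)).trans v1
  have w2 := (h34.rreg (t + 1) (by omega)).trans v2
  have w3 := (k4.rreg (t + 2) (by omega)).trans v3
  refine .seq (.instr (.seq (.instr (.instr ?_))))
  simp only [Instr.run, w1, w2, w3, v4]
  refine ⟨h14.trans ⟨fun _ _ => rfl, fun r hr => ?_, rfl, rfl⟩ le_rfl, ?_⟩
  · have e1 : r ≠ t + 4 := by omega
    have e2 : r ≠ t + 5 := by omega
    have e3 : r ≠ t + 6 := by omega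
    have e4 : r ≠ t := by omega
    simp [Function.update_of_ne, e1, e2, e3, e4]
  · rw [hπ]
    interval_cases o <;> simp [Function.update_apply] <;> (intro h; omega)

@[fun_prop]
theorem RC.smallestCell_fst {a b c d : St → ℝ} (ha : RC a) (hb : RC b) (hc : RC c) (hd : RC d) :
    RC fun s => (smallestCellOp (a s, b s) (c s, d s)).1 :=
  .smallestCell ha hb hc hd _ 0 (by omega) fun _ => rfl

@[fun_prop]
theorem RC.smallestCell_snd {a b c d : St → ℝ} (ha : RC a) (hb : RC b) (hc : RC c) (hd : RC d) :
    RC fun s => (smallestCellOp (a s, b s) (c s, d s)).2.1 :=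
  .smallestCell ha hb hc hd _ 1 (by omega) fun _ => rfl

@[fun_prop]
theorem RC.smallestCell_side {a b c d : St → ℝ} (ha : RC a) (hb : RC b) (hc : RC c) (hd : RC d) :
    RC fun s => (smallestCellOp (a s, b s) (c s, d s)).2.2 :=
  .smallestCell ha hb hc hd _ 2 (by omega) fun _ => rfl

@[fun_prop] theorem NC.n : NC fun s => s.n := .of_reg 0 (by omega) fun _ => rfl
@[fun_prop] theorem NC.top : NC fun s => s.top := .of_reg 1 (by omega) fun _ => rfl
@[fun_prop] theorem NC.src : NC fun s => s.src := .of_reg 2 (by omega) fun _ => rfl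
@[fun_prop] theorem NC.k : NC fun s => s.k := .of_reg 3 (by omega) fun _ => rfl
@[fun_prop] theorem NC.i : NC fun s => s.i := .of_reg 4 (by omega) fun _ => rfl
@[fun_prop] theorem NC.j : NC fun s => s.j := .of_reg 5 (by omega) fun _ => rfl
@[fun_prop] theorem NC.m : NC fun s => s.m := .of_reg 6 (by omega) fun _ => rfl
@[fun_prop] theorem NC.e : NC fun s => s.e := .of_reg 7 (by omega) fun _ => rfl
@[fun_prop] theorem NC.w : NC fun s => s.w := .of_reg 8 (by omega) fun _ => rfl
@[fun_prop] theorem NC.N : NC fun s => s.N := .of_reg 9 (by omega) fun _ => rfl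
@[fun_prop] theorem NC.pb : NC fun s => s.pb := .of_reg 10 (by omega) fun _ => rfl
@[fun_prop] theorem NC.rb : NC fun s => s.rb := .of_reg 11 (by omega) fun _ => rfl
@[fun_prop] theorem NC.wb : NC fun s => s.wb := .of_reg 12 (by omega) fun _ => rfl
@[fun_prop] theorem NC.t : NC fun s => s.t := .of_reg 13 (by omega) fun _ => rfl
@[fun_prop] theorem NC.x : NC fun s => s.x := .of_reg 14 (by omega) fun _ => rfl
@[fun_prop] theorem NC.q : NC fun s => s.q := .of_reg 15 (by omega) fun _ => rfl
@[fun_prop] theorem NC.c : NC fun s => s.c := .of_reg 16 (by omega) fun _ => rfl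
@[fun_prop] theorem NC.f : NC fun s => s.f := .of_reg 17 (by omega) fun _ => rfl
@[fun_prop] theorem NC.g : NC fun s => s.g := .of_reg 18 (by omega) fun _ => rfl
@[fun_prop] theorem NC.z : NC fun s => s.z := .of_reg 19 (by omega) fun _ => rfl
@[fun_prop] theorem NC.u : NC fun s => s.u := .of_reg 20 (by omega) fun _ => rfl
@[fun_prop] theorem NC.v : NC fun s => s.v := .of_reg 21 (by omega) fun _ => rfl
@[fun_prop] theorem NC.fl : NC fun s => s.fl := .of_reg 22 (by omega) fun _ => rfl
@[fun_prop] theorem NC.kx : NC fun s => s.kx := .of_reg 23 (by omega) fun _ => rfl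
@[fun_prop] theorem RC.bX : RC fun s => s.bX := .of_reg 0 (by omega) fun _ => rfl
@[fun_prop] theorem RC.bY : RC fun s => s.bY := .of_reg 1 (by omega) fun _ => rfl
@[fun_prop] theorem RC.bS : RC fun s => s.bS := .of_reg 2 (by omega) fun _ => rfl
@[fun_prop] theorem RC.tX : RC fun s => s.tX := .of_reg 3 (by omega) fun _ => rfl
@[fun_prop] theorem RC.tY : RC fun s => s.tY := .of_reg 4 (by omega) fun _ => rfl
@[fun_prop] theorem RC.tS : RC fun s => s.tS := .of_reg 5 (by omega) fun _ => rfl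
@[fun_prop] theorem RC.qX : RC fun s => s.qX := .of_reg 6 (by omega) fun _ => rfl
@[fun_prop] theorem RC.qY : RC fun s => s.qY := .of_reg 7 (by omega) fun _ => rfl
@[fun_prop] theorem RC.qS : RC fun s => s.qS := .of_reg 8 (by omega) fun _ => rfl
@[fun_prop] theorem RC.lev : RC fun s => s.lev := .of_reg 9 (by omega) fun _ => rfl
@[fun_prop] theorem RC.tl : RC fun s => s.tl := .of_reg 10 (by omega) fun _ => rfl
@[fun_prop] theorem RC.ty : RC fun s => s.ty := .of_reg 11 (by omega) fun _ => rfl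
@[fun_prop] theorem RC.ix : RC fun s => s.ix := .of_reg 12 (by omega) fun _ => rfl

end

noncomputable section

/-! ## Constant-time operations on the named registers -/

/-- `F` can be carried out in constant time. -/
def Comp (F : St → St) : Prop := ∃ A c, ∀ s, Halts A s c fun s' => St.of s' = F (.of s)

theorem Comp.id : Comp fun s => s := ⟨.skip, 1, fun s => ⟨1, s, .skip, le_rfl, rfl⟩⟩

theorem Comp.comp {F G : St → St} (hF : Comp F) (hG : Comp G) : Comp fun s => G (F s) := by
  obtain ⟨A, c, hA⟩ := hF
  obtain ⟨B, c', hB⟩ := hG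
  refine ⟨.seq A B, c + c', fun s => .seq ((hA s).mono le_rfl fun s₁ h₁ => ?_)⟩
  exact (hB s₁).mono le_rfl fun s₂ h₂ => by rw [h₂, h₁]

theorem Comp.ite {P : St → Prop} [∀ s, Decidable (P s)] {F G : St → St} (hP : BC P) (hF : Comp F)
    (hG : Comp G) : Comp fun s => if P s then F s else G s := by
  obtain ⟨A, c, hA⟩ := hP.run (b := 24) le_rfl
  obtain ⟨B, c', hB⟩ := hF
  obtain ⟨C, c'', hC⟩ := hG
  refine ⟨.seq A (.ite (.nlt 25 24) B C), c + (max c' c'' + 1), fun s => .seq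
    ((hA s).mono le_rfl ?_)⟩
  rintro s₁ ⟨k1, v1⟩
  refine .ite (fun h => (hB s₁).mono (le_max_left _ _) ?_)
    (fun h => (hC s₁).mono (le_max_right _ _) ?_) <;>
  · intro s₂ h₂
    rw [v1] at h
    simp [h₂, k1.of_eq, h]

/-- The value is computed in scratch register 24 before register `r` is overwritten, so `f` may
depend on the old content of `r`. -/
theorem NC.assign {f : St → ℕ} {F : St → St} (hf : NC f) (r : ℕ)
    (h : ∀ s : RamState, St.of { s with nreg := Function.update s.nreg r (f (.of s)) } = F (.of s)) :
    Comp F := by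
  obtain ⟨A, c, hA⟩ := hf 24 le_rfl
  refine ⟨.seq A (.seq (.instr (.nconst 25 0)) (.instr (.nadd r 24 25))), c + (1 + 1), fun s =>
    .seq ((hA s).mono le_rfl ?_)⟩
  rintro s₁ ⟨k1, v1⟩
  refine .seq (.instr (.instr ?_))
  rw [← h]
  refine Keeps.of_eq (b := 24) ⟨fun r' hr' => ?_, fun r' hr' => k1.rreg r' hr', k1.nmem, k1.rmem⟩
    le_rfl
  simp only [Instr.run, Function.update_self, v1, Function.update_apply]
  split_ifs <;> first | omega | exact k1.nreg r' hr'

theorem RC.assign {f : St → ℝ} {F : St → St} (hf : RC f) (r : ℕ)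
    (h : ∀ s : RamState, St.of { s with rreg := Function.update s.rreg r (f (.of s)) } = F (.of s)) :
    Comp F := by
  obtain ⟨A, c, hA⟩ := hf 24 le_rfl
  refine ⟨.seq A (.seq (.instr (.rconst 25 0)) (.instr (.radd r 24 25))), c + (1 + 1), fun s =>
    .seq ((hA s).mono le_rfl ?_)⟩
  rintro s₁ ⟨k1, v1⟩
  refine .seq (.instr (.instr ?_))
  rw [← h]
  refine Keeps.of_eq (b := 24) ⟨fun r' hr' => k1.nreg r' hr', fun r' hr' => ?_, k1.nmem, k1.rmem⟩
    le_rfl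
  simp only [Instr.run, Function.update_self, v1, Function.update_apply]
  split_ifs <;> first | omega | simp | exact k1.rreg r' hr'

theorem Comp.nstore {f g : St → ℕ} (hf : NC f) (hg : NC g) :
    Comp fun s => { s with nm := Function.update s.nm (f s) (g s) } := by
  obtain ⟨A, c, hA⟩ := hf 24 le_rfl
  obtain ⟨B, c', hB⟩ := hg 25 (by omega)
  refine ⟨.seq A (.seq B (.instr (.nstore 24 25))), c + (c' + 1), fun s =>
    .seq ((hA s).mono le_rfl ?_)⟩
  rintro s₁ ⟨k1, v1⟩
  refine .seq ((hB s₁).mono le_rfl ?_)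
  rintro s₂ ⟨k2, v2⟩
  refine .instr ?_
  rw [k1.of_eq le_rfl] at v2
  have hk := k1.trans k2 (by omega)
  have := Keeps.of_eq (b := 24) (s := { s with nmem := Function.update s.nmem (f (.of s)) (g (.of s)) })
    (s' := Instr.run s₂ (.nstore 24 25)) ⟨hk.nreg, hk.rreg, ?_, hk.rmem⟩ le_rfl
  · rw [this]
    rfl
  · simp [Instr.run, v2, k2.nreg 24 (by omega), v1, hk.nmem]

theorem Comp.rstore {f : St → ℕ} {g : St → ℝ} (hf : NC f) (hg : RC g) :
    Comp fun s => { s with rm := Function.update s.rm (f s) (g s) } := by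
  obtain ⟨A, c, hA⟩ := hf 24 le_rfl
  obtain ⟨B, c', hB⟩ := hg 25 (by omega)
  refine ⟨.seq A (.seq B (.instr (.rstore 24 25))), c + (c' + 1), fun s =>
    .seq ((hA s).mono le_rfl ?_)⟩
  rintro s₁ ⟨k1, v1⟩
  refine .seq ((hB s₁).mono le_rfl ?_)
  rintro s₂ ⟨k2, v2⟩
  refine .instr ?_
  rw [k1.of_eq le_rfl] at v2
  have hk := k1.trans k2 (by omega)
  have := Keeps.of_eq (b := 24) (s := { s with rmem := Function.update s.rmem (f (.of s)) (g (.of s)) })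
    (s' := Instr.run s₂ (.rstore 24 25)) ⟨hk.nreg, hk.rreg, hk.nmem, ?_⟩ le_rfl
  · rw [this]
    rfl
  · simp [Instr.run, v2, k2.nreg 24 (by omega), v1, hk.rmem]

/-- A constant-time operation. -/
structure Op where
  fn : St → St
  comp : Comp fn

namespace Op

/-- Carry out operations one after the other. -/
def block : List Op → Op
  | [] => ⟨fun s => s, .id⟩
  | F :: L => ⟨fun s => (block L).fn (F.fn s), F.comp.comp (block L).comp⟩

open Classical in
/-- Carry out one of two operations. -/
def ite (P : St → Prop) (F G : Op) (hP : BC P := by fun_prop) : Op :=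
  ⟨fun s => if P s then F.fn s else G.fn s, .ite hP F.comp G.comp⟩

theorem block_nil (s : St) : (block []).fn s = s := rfl

theorem block_cons (F : Op) (L : List Op) (s : St) :
    (block (F :: L)).fn s = (block L).fn (F.fn s) := rfl

open Classical in
theorem ite_fn (P : St → Prop) (F G : Op) (hP : BC P) (s : St) :
    (ite P F G hP).fn s = if P s then F.fn s else G.fn s := rfl

/-- Write to the memory of natural numbers. -/
def stN (f g : St → ℕ) (hf : NC f := by fun_prop) (hg : NC g := by fun_prop) : Op :=
  ⟨fun s => { s with nm := Function.update s.nm (f s) (g s) }, .nstore hf hg⟩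

/-- Write to the memory of real numbers. -/
def stR (f : St → ℕ) (g : St → ℝ) (hf : NC f := by fun_prop) (hg : RC g := by fun_prop) : Op :=
  ⟨fun s => { s with rm := Function.update s.rm (f s) (g s) }, .rstore hf hg⟩

/-- Assign to the register `top`. -/
def top (f : St → ℕ) (hf : NC f := by fun_prop) : Op :=
  ⟨fun s => { s with top := f s }, hf.assign 1 fun _ => rfl⟩

/-- Assign to the register `src`. -/
def src (f : St → ℕ) (hf : NC f := by fun_prop) : Op :=
  ⟨fun s => { s with src := f s }, hf.assign 2 fun _ => rfl⟩

/-- Assign to the register `k`. -/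
def k (f : St → ℕ) (hf : NC f := by fun_prop) : Op :=
  ⟨fun s => { s with k := f s }, hf.assign 3 fun _ => rfl⟩

/-- Assign to the register `i`. -/
def i (f : St → ℕ) (hf : NC f := by fun_prop) : Op :=
  ⟨fun s => { s with i := f s }, hf.assign 4 fun _ => rfl⟩

/-- Assign to the register `j`. -/
def j (f : St → ℕ) (hf : NC f := by fun_prop) : Op :=
  ⟨fun s => { s with j := f s }, hf.assign 5 fun _ => rfl⟩

/-- Assign to the register `m`. -/
def m (f : St → ℕ) (hf : NC f := by fun_prop) : Op :=
  ⟨fun s => { s with m := f s }, hf.assign 6 fun _ => rfl⟩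

/-- Assign to the register `e`. -/
def e (f : St → ℕ) (hf : NC f := by fun_prop) : Op :=
  ⟨fun s => { s with e := f s }, hf.assign 7 fun _ => rfl⟩

/-- Assign to the register `w`. -/
def w (f : St → ℕ) (hf : NC f := by fun_prop) : Op :=
  ⟨fun s => { s with w := f s }, hf.assign 8 fun _ => rfl⟩

/-- Assign to the register `N`. -/
def N (f : St → ℕ) (hf : NC f := by fun_prop) : Op :=
  ⟨fun s => { s with N := f s }, hf.assign 9 fun _ => rfl⟩

/-- Assign to the register `pb`. -/
def pb (f : St → ℕ) (hf : NC f := by fun_prop) : Op :=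
  ⟨fun s => { s with pb := f s }, hf.assign 10 fun _ => rfl⟩

/-- Assign to the register `rb`. -/
def rb (f : St → ℕ) (hf : NC f := by fun_prop) : Op :=
  ⟨fun s => { s with rb := f s }, hf.assign 11 fun _ => rfl⟩

/-- Assign to the register `wb`. -/
def wb (f : St → ℕ) (hf : NC f := by fun_prop) : Op :=
  ⟨fun s => { s with wb := f s }, hf.assign 12 fun _ => rfl⟩

/-- Assign to the register `t`. -/
def t (f : St → ℕ) (hf : NC f := by fun_prop) : Op :=
  ⟨fun s => { s with t := f s }, hf.assign 13 fun _ => rfl⟩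

/-- Assign to the register `x`. -/
def x (f : St → ℕ) (hf : NC f := by fun_prop) : Op :=
  ⟨fun s => { s with x := f s }, hf.assign 14 fun _ => rfl⟩

/-- Assign to the register `q`. -/
def q (f : St → ℕ) (hf : NC f := by fun_prop) : Op :=
  ⟨fun s => { s with q := f s }, hf.assign 15 fun _ => rfl⟩

/-- Assign to the register `c`. -/
def c (f : St → ℕ) (hf : NC f := by fun_prop) : Op :=
  ⟨fun s => { s with c := f s }, hf.assign 16 fun _ => rfl⟩

/-- Assign to the register `f`. -/
def f (f : St → ℕ) (hf : NC f := by fun_prop) : Op :=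
  ⟨fun s => { s with f := f s }, hf.assign 17 fun _ => rfl⟩

/-- Assign to the register `g`. -/
def g (f : St → ℕ) (hf : NC f := by fun_prop) : Op :=
  ⟨fun s => { s with g := f s }, hf.assign 18 fun _ => rfl⟩

/-- Assign to the register `z`. -/
def z (f : St → ℕ) (hf : NC f := by fun_prop) : Op :=
  ⟨fun s => { s with z := f s }, hf.assign 19 fun _ => rfl⟩

/-- Assign to the register `u`. -/
def u (f : St → ℕ) (hf : NC f := by fun_prop) : Op :=
  ⟨fun s => { s with u := f s }, hf.assign 20 fun _ => rfl⟩

/-- Assign to the register `v`. -/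
def v (f : St → ℕ) (hf : NC f := by fun_prop) : Op :=
  ⟨fun s => { s with v := f s }, hf.assign 21 fun _ => rfl⟩

/-- Assign to the register `fl`. -/
def fl (f : St → ℕ) (hf : NC f := by fun_prop) : Op :=
  ⟨fun s => { s with fl := f s }, hf.assign 22 fun _ => rfl⟩

/-- Assign to the register `kx`. -/
def kx (f : St → ℕ) (hf : NC f := by fun_prop) : Op :=
  ⟨fun s => { s with kx := f s }, hf.assign 23 fun _ => rfl⟩

/-- Assign to the register `bX`. -/
def bX (f : St → ℝ) (hf : RC f := by fun_prop) : Op :=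
  ⟨fun s => { s with bX := f s }, hf.assign 0 fun _ => rfl⟩

/-- Assign to the register `bY`. -/
def bY (f : St → ℝ) (hf : RC f := by fun_prop) : Op :=
  ⟨fun s => { s with bY := f s }, hf.assign 1 fun _ => rfl⟩

/-- Assign to the register `bS`. -/
def bS (f : St → ℝ) (hf : RC f := by fun_prop) : Op :=
  ⟨fun s => { s with bS := f s }, hf.assign 2 fun _ => rfl⟩

/-- Assign to the register `tX`. -/
def tX (f : St → ℝ) (hf : RC f := by fun_prop) : Op :=
  ⟨fun s => { s with tX := f s }, hf.assign 3 fun _ => rfl⟩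

/-- Assign to the register `tY`. -/
def tY (f : St → ℝ) (hf : RC f := by fun_prop) : Op :=
  ⟨fun s => { s with tY := f s }, hf.assign 4 fun _ => rfl⟩

/-- Assign to the register `tS`. -/
def tS (f : St → ℝ) (hf : RC f := by fun_prop) : Op :=
  ⟨fun s => { s with tS := f s }, hf.assign 5 fun _ => rfl⟩

/-- Assign to the register `qX`. -/
def qX (f : St → ℝ) (hf : RC f := by fun_prop) : Op :=
  ⟨fun s => { s with qX := f s }, hf.assign 6 fun _ => rfl⟩

/-- Assign to the register `qY`. -/
def qY (f : St → ℝ) (hf : RC f := by fun_prop) : Op :=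
  ⟨fun s => { s with qY := f s }, hf.assign 7 fun _ => rfl⟩

/-- Assign to the register `qS`. -/
def qS (f : St → ℝ) (hf : RC f := by fun_prop) : Op :=
  ⟨fun s => { s with qS := f s }, hf.assign 8 fun _ => rfl⟩

/-- Assign to the register `lev`. -/
def lev (f : St → ℝ) (hf : RC f := by fun_prop) : Op :=
  ⟨fun s => { s with lev := f s }, hf.assign 9 fun _ => rfl⟩

/-- Assign to the register `tl`. -/
def tl (f : St → ℝ) (hf : RC f := by fun_prop) : Op :=
  ⟨fun s => { s with tl := f s }, hf.assign 10 fun _ => rfl⟩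

/-- Assign to the register `ty`. -/
def ty (f : St → ℝ) (hf : RC f := by fun_prop) : Op :=
  ⟨fun s => { s with ty := f s }, hf.assign 11 fun _ => rfl⟩

/-- Assign to the register `ix`. -/
def ix (f : St → ℝ) (hf : RC f := by fun_prop) : Op :=
  ⟨fun s => { s with ix := f s }, hf.assign 12 fun _ => rfl⟩

end Op

/-! ## Commands -/

/-- Commands: constant-time operations, sequences and loops. -/
inductive Cmd where
  | op (F : Op)
  | seq (C D : Cmd)
  | loop (P : St → Prop) (hP : BC P) (C : Cmd)

/-- `Cmd.Run C s m s'`: the command `C` takes the state `s` to `s'` with `m` operations. -/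
inductive Cmd.Run : Cmd → St → ℕ → St → Prop
  | op {F : Op} {s : St} : Run (.op F) s 1 (F.fn s)
  | seq {C D : Cmd} {s s₁ s₂ : St} {m₁ m₂ : ℕ} (hC : Run C s m₁ s₁) (hD : Run D s₁ m₂ s₂) :
      Run (.seq C D) s (m₁ + m₂) s₂
  | loop_done {P : St → Prop} {hP : BC P} {C : Cmd} {s : St} (h : ¬ P s) :
      Run (.loop P hP C) s 1 s
  | loop_step {P : St → Prop} {hP : BC P} {C : Cmd} {s s₁ s₂ : St} {m₁ m₂ : ℕ} (h : P s)
      (hC : Run C s m₁ s₁) (hD : Run (.loop P hP C) s₁ m₂ s₂) :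
      Run (.loop P hP C) s (m₁ + m₂ + 1) s₂

/-- Every command can be compiled, with a constant slowdown. -/
theorem Cmd.compile (C : Cmd) : ∃ (A : Prog) (K : ℕ), ∀ (s : RamState) (m : ℕ) (s' : St),
    Cmd.Run C (.of s) m s' → Halts A s (K * m) fun s₁ => St.of s₁ = s' := by
  induction C with
  | op F =>
    obtain ⟨A, c, hA⟩ := F.comp
    refine ⟨A, c, fun s m s' h => ?_⟩
    cases h
    exact (hA s).mono (by simp) fun _ h => h
  | seq C D ihC ihD =>
    obtain ⟨A, K, hA⟩ := ihC
    obtain ⟨B, K', hB⟩ := ihD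
    refine ⟨.seq A B, max K K', fun s m s' h => ?_⟩
    cases h with
    | @seq _ _ _ t₁ _ m₁ m₂ h1 h2 =>
      refine Halts.mono (.seq (c' := K' * m₂) ((hA s _ _ h1).mono le_rfl ?_)) ?_ fun _ h => h
      · rintro s₁ rfl
        exact hB s₁ _ _ h2
      · rw [mul_add]
        exact add_le_add (Nat.mul_le_mul_right _ (le_max_left _ _))
          (Nat.mul_le_mul_right _ (le_max_right _ _))
  | loop P hP C ihC =>
    obtain ⟨A, K, hA⟩ := ihC
    obtain ⟨B, c, hB⟩ := hP.run (b := 24) le_rfl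
    -- The machine loop assumes that its guard has been evaluated into registers 24 and 25, and
    -- evaluates it again at the end of each round. The command is generalized to `D` to permit
    -- induction on the run.
    have key : ∀ (D : Cmd) (s : St) (m : ℕ) (s' : St), Cmd.Run D s m s' → D = .loop P hP C →
        ∀ s₁ : RamState, St.of s₁ = s → ((Test.nlt 25 24).holds s₁ ↔ P s) →
        Halts (.loop (.nlt 25 24) (.seq A B)) s₁ ((K + c + 1) * m) fun s₂ => St.of s₂ = s' := by
      intro D s m s' h
      induction h with
      | op => exact fun h => nomatch h
      | seq => exact fun h => nomatch h
      | loop_done h =>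
        intro he s₁ hs₁ ht
        cases he
        exact ⟨1, s₁, .loop_done (by rwa [ht]), by omega, hs₁⟩
      | @loop_step _ _ _ s t₁ t₂ m₁ m₂ h h1 h2 _ ih =>
        intro he s₁ hs₁ ht
        cases he
        subst hs₁
        obtain ⟨k₁, s₂, e₁, l₁, r₁, ⟨k₂, s₃, e₂, l₂, r₂, r₃⟩⟩ := (hA s₁ _ _ h1).mono le_rfl
          fun s₂ h₂ => (⟨h₂, hB s₂⟩ : _ ∧ Halts B s₂ c _)
        obtain ⟨k₃, s₄, e₃, l₃, r₄⟩ := ih rfl s₃ ((r₂.of_eq le_rfl).trans r₁) (by rw [r₃, r₁])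
        refine ⟨k₁ + k₂ + k₃ + 1, s₄, .loop_step (by rwa [ht]) (.seq e₁ e₂) e₃, ?_, r₄⟩
        have h3 : K * m₁ ≤ (K + c + 1) * m₁ := Nat.mul_le_mul_right _ (by omega)
        have h4 : (K + c + 1) * (m₁ + m₂ + 1) =
          (K + c + 1) * m₁ + (K + c + 1) * m₂ + (K + c + 1) := by ring
        omega
    -- The last `c` pays for the first evaluation of the guard, since every run of a loop has at
    -- least one step.
    refine ⟨.seq B (.loop (.nlt 25 24) (.seq A B)), K + c + 1 + c, fun s m s' h => ?_⟩
    have hm : 1 ≤ m := by cases h <;> omega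
    refine Halts.mono (.seq (c' := (K + c + 1) * m) ((hB s).mono le_rfl ?_)) ?_ fun _ h => h
    · rintro s₁ ⟨r₁, r₂⟩
      exact key _ _ _ _ h rfl s₁ (r₁.of_eq le_rfl) r₂
    · nlinarith

/-- `C` takes `s` with at most `c` operations to a state with the property `Q`. -/
def Cmd.Runs (C : Cmd) (s : St) (c : ℕ) (Q : St → Prop) : Prop :=
  ∃ m s', Cmd.Run C s m s' ∧ m ≤ c ∧ Q s'

theorem Cmd.Runs.mono {C : Cmd} {s : St} {c c' : ℕ} {Q Q' : St → Prop} (h : C.Runs s c Q)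
    (hc : c ≤ c') (hQ : ∀ s', Q s' → Q' s') : C.Runs s c' Q' := by
  obtain ⟨m, s', h1, h2, h3⟩ := h
  exact ⟨m, s', h1, h2.trans hc, hQ s' h3⟩

theorem Cmd.Runs.op {F : Op} {s : St} {Q : St → Prop} (h : Q (F.fn s)) : (Cmd.op F).Runs s 1 Q :=
  ⟨1, _, .op, le_rfl, h⟩

theorem Cmd.Runs.seq {C D : Cmd} {s : St} {c c' : ℕ} {Q Q' : St → Prop} (h : C.Runs s c Q')
    (h' : ∀ s', Q' s' → D.Runs s' c' Q) : (Cmd.seq C D).Runs s (c + c') Q := by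
  obtain ⟨m, s', h1, h2, h3⟩ := h
  obtain ⟨m', s'', h4, h5, h6⟩ := h' s' h3
  exact ⟨m + m', s'', .seq h1 h4, by omega, h6⟩

/-- The rule for loops; the invariant comes with a bound on the remaining number of steps. -/
theorem Cmd.Runs.loop {P : St → Prop} {hP : BC P} {C : Cmd} (I : ℕ → St → Prop)
    (step : ∀ v s, I v s → P s → ∃ c, C.Runs s c fun s' => ∃ v', I v' s' ∧ c + v' + 1 ≤ v)
    {v : ℕ} {s : St} (h : I v s) :
    (Cmd.loop P hP C).Runs s (v + 1) fun s' => ¬ P s' ∧ ∃ v', I v' s' := by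
  induction v using Nat.strong_induction_on generalizing s with
  | _ v ih =>
  by_cases hs : P s
  · obtain ⟨c, m, s₁, h1, h2, v', h3, h4⟩ := step v s h hs
    obtain ⟨m', s₂, h5, h6, h7⟩ := ih v' (by omega) h3
    exact ⟨m + m' + 1, s₂, .loop_step hs h1 h5, by omega, h7⟩
  · exact ⟨1, s, .loop_done hs, by omega, hs, v, h⟩

/-- The rule for loops with `r` rounds of `c` steps. -/
theorem Cmd.Runs.loop_rounds {P : St → Prop} {hP : BC P} {C : Cmd} (I : ℕ → St → Prop) {c : ℕ}
    (step : ∀ r s, I r s → P s → C.Runs s c fun s' => ∃ r' < r, I r' s')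
    {r : ℕ} {s : St} (h : I r s) :
    (Cmd.loop P hP C).Runs s (r * (c + 1) + 1) fun s' => ¬ P s' ∧ ∃ r', I r' s' := by
  refine (Cmd.Runs.loop (fun v s => ∃ r, I r s ∧ v = r * (c + 1)) ?_ ⟨r, h, rfl⟩).mono le_rfl ?_
  · rintro _ s ⟨r, hI, rfl⟩ hs
    refine ⟨c, (step r s hI hs).mono le_rfl ?_⟩
    rintro s' ⟨r', hr', hI'⟩
    refine ⟨_, ⟨r', hI', rfl⟩, ?_⟩
    have := Nat.mul_le_mul_right (c + 1) hr'
    rw [Nat.succ_mul] at this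
    omega
  · rintro s' ⟨h1, _, r', h2, -⟩
    exact ⟨h1, r', h2⟩

end

/-! ### Sorting, and geometric tests by arithmetic -/

noncomputable section

/-! ## Merge sort -/

/-- The multiset of the values of `A` on an interval. -/
def valuesOn (A : ℕ → ℕ) (a b : ℕ) : Multiset ℕ := ∑ x ∈ Finset.Ico a b, {A x}

theorem valuesOn_self (A : ℕ → ℕ) (a : ℕ) : valuesOn A a a = 0 := by simp [valuesOn]

theorem valuesOn_succ (A : ℕ → ℕ) {a b : ℕ} (h : a ≤ b) :
    valuesOn A a (b + 1) = valuesOn A a b + {A b} := Finset.sum_Ico_succ_top h _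

theorem valuesOn_add (A : ℕ → ℕ) {a b c : ℕ} (h : a ≤ b) (h' : b ≤ c) :
    valuesOn A a b + valuesOn A b c = valuesOn A a c := Finset.sum_Ico_consecutive _ h h'

theorem valuesOn_congr {A B : ℕ → ℕ} {a b : ℕ} (h : ∀ x, x < b → A x = B x) :
    valuesOn A a b = valuesOn B a b :=
  Finset.sum_congr rfl fun x hx => by rw [h x (Finset.mem_Ico.1 hx).2]

theorem valuesOn_eq_map (A : ℕ → ℕ) (n : ℕ) : valuesOn A 0 n = (Multiset.range n).map A := by
  induction n with
  | zero => simp [valuesOn]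
  | succ n ih =>
    rw [valuesOn_succ A (Nat.zero_le n), ih, Multiset.range_succ, Multiset.map_cons, add_comm]
    rfl

theorem eq_of_dvd_of_interval {d b c k : ℕ} (hb : d ∣ b) (hc : d ∣ c) (h1 : b ≤ k)
    (h2 : k < b + d) (h3 : c ≤ k) (h4 : k < c + d) : b = c := by
  obtain ⟨b, rfl⟩ := hb
  obtain ⟨c, rfl⟩ := hc
  have e1 : k / d = b := Nat.div_eq_of_lt_le (by linarith) (by linarith)
  have e2 : k / d = c := Nat.div_eq_of_lt_le (by linarith) (by linarith)
  rw [← e1, ← e2]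

/-- `A` is sorted on the interval from `a` to `b`. -/
def SortedOn (le : ℕ → ℕ → Prop) (A : ℕ → ℕ) (a b : ℕ) : Prop :=
  ∀ x y, a ≤ x → x < y → y < b → le (A x) (A y)

/-- The blocks of length `w` of `A` are sorted, up to position `k`. -/
def BlocksSorted (le : ℕ → ℕ → Prop) (A : ℕ → ℕ) (w k : ℕ) : Prop :=
  ∀ c x y, w ∣ c → c ≤ x → x < y → y < c + w → y < k → le (A x) (A y)

theorem BlocksSorted.sortedOn {le : ℕ → ℕ → Prop} {A : ℕ → ℕ} {w k c b : ℕ}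
    (h : BlocksSorted le A w k) (hc : w ∣ c) (h1 : b ≤ c + w) (h2 : b ≤ k) : SortedOn le A c b :=
  fun x y hx hxy hy => h c x y hc hx hxy (by omega) (by omega)

/-- The state of a pass of merge sort: the runs of `A` from `b` to `m` and from `m` to `e` are
being merged into `B`; they have been read up to `i` and `j`, and `B` is written up to `k`. -/
structure MergeInv (le : ℕ → ℕ → Prop) (A B : ℕ → ℕ) (n w b k i j m e : ℕ) : Prop where
  dvd : 2 * w ∣ b
  bi : b ≤ i
  im : i ≤ m
  mj : m ≤ j
  je : j ≤ e
  en : e ≤ n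
  eb : e ≤ b + 2 * w
  ending : 2 * w ∣ e ∨ e = n
  count : k + m = i + j
  left : SortedOn le A b m
  right : SortedOn le A m e
  before : valuesOn B 0 b = valuesOn A 0 b
  vals : valuesOn B b k = valuesOn A b i + valuesOn A m j
  sorted : BlocksSorted le B (2 * w) k
  cross : ∀ x, b ≤ x → x < k → ∀ y, (i ≤ y ∧ y < m) ∨ (j ≤ y ∧ y < e) → le (B x) (A y)

namespace MergeInv

variable {le : ℕ → ℕ → Prop} {A B : ℕ → ℕ} {n w b k i j m e : ℕ}

theorem init : MergeInv le A B n w 0 0 0 0 0 0 where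
  dvd := dvd_zero _
  bi := le_rfl
  im := le_rfl
  mj := le_rfl
  je := le_rfl
  en := Nat.zero_le _
  eb := Nat.zero_le _
  ending := Or.inl (dvd_zero _)
  count := rfl
  left := fun _ _ _ _ h => absurd h (Nat.not_lt_zero _)
  right := fun _ _ _ _ h => absurd h (Nat.not_lt_zero _)
  before := by simp [valuesOn_self]
  vals := by simp [valuesOn_self]
  sorted := fun _ _ _ _ _ _ _ h => absurd h (Nat.not_lt_zero _)
  cross := fun _ _ h => absurd h (Nat.not_lt_zero _)

theorem k_le (h : MergeInv le A B n w b k i j m e) : k ≤ e := by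
  have := h.count
  have := h.im
  have := h.je
  omega

theorem values_eq (h : MergeInv le A B n w b k i j m e) (hk : k = e) :
    valuesOn B 0 k = valuesOn A 0 k := by
  have h1 := h.count
  have h2 := h.im
  have h3 := h.je
  have h4 := h.bi
  have h5 := h.mj
  have hv := h.vals
  obtain rfl : i = m := by omega
  obtain rfl : j = k := by omega
  rw [valuesOn_add A h4 h5] at hv
  rw [← valuesOn_add B (Nat.zero_le b) (by omega), h.before, hv,
    valuesOn_add A (Nat.zero_le b) (by omega)]

/-- A finished pair of runs that ends before `n` ends at a multiple of `2 * w`. The minima cut off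
the last pair at `n`, where the second run may be short or empty. -/
theorem newBlock (h : MergeInv le A B n w b k i j m e) (hA : BlocksSorted le A w n) (hw : 0 < w)
    (hk : k = e) (hkn : k < n) : MergeInv le A B n w k k k (min (k + w) n) (min (k + w) n)
      (min (min (k + w) n + w) n) where
  dvd := hk ▸ h.ending.resolve_right (by omega)
  bi := le_rfl
  im := by omega
  mj := le_rfl
  je := by omega
  en := by omega
  eb := by omega
  ending := by
    have h1 : 2 * w ∣ k := hk ▸ h.ending.resolve_right (by omega)
    rcases Nat.le_total n (k + 2 * w) with h2 | h2
    · right; omega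
    · left
      rw [show min (min (k + w) n + w) n = k + 2 * w by omega]
      exact dvd_add h1 dvd_rfl
  count := rfl
  left := hA.sortedOn ((Dvd.intro_left 2 rfl).trans (hk ▸ h.ending.resolve_right (by omega) :
    2 * w ∣ k)) (by omega) (by omega)
  right := by
    have h1 : w ∣ k := (Dvd.intro_left 2 rfl).trans (hk ▸ h.ending.resolve_right (by omega) :
      2 * w ∣ k)
    rcases Nat.le_total n (k + w) with h2 | h2
    · intro x y hx hxy hy
      omega
    · rw [show min (k + w) n = k + w by omega]
      exact hA.sortedOn (dvd_add h1 dvd_rfl) (by omega) (by omega)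
  before := h.values_eq hk
  vals := by simp [valuesOn_self]
  sorted := h.sorted
  cross := fun x h1 h2 => by omega

/-- By `cross`, everything written in this block precedes every head still unread, so appending a
least head keeps the block sorted. Transitivity is assumed only for the instances that occur,
because it is known only for indices below `n`. -/
theorem emit {B' : ℕ → ℕ} {p i' j' : ℕ} (h : MergeInv le A B n w b k i j m e)
    (hp : (p = i ∧ i < m ∧ i' = i + 1 ∧ j' = j) ∨ (p = j ∧ j < e ∧ i' = i ∧ j' = j + 1))
    (hmin : ∀ y, (i' ≤ y ∧ y < m) ∨ (j' ≤ y ∧ y < e) → le (A p) (A y))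
    (htrans : ∀ x y, b ≤ x → x < k → (i' ≤ y ∧ y < m) ∨ (j' ≤ y ∧ y < e) → le (B x) (A p) →
      le (A p) (A y) → le (B x) (A y))
    (hB : ∀ x < k, B' x = B x) (hk : B' k = A p) :
    MergeInv le A B' n w b (k + 1) i' j' m e := by
  have h1 := h.count
  have h2 := h.im
  have h3 := h.je
  have h4 := h.bi
  have h5 := h.mj
  have h6 := h.eb
  have hbk : b ≤ k := by omega
  have hpc : ∀ x, b ≤ x → x < k → le (B x) (A p) := fun x hx hxk =>
    h.cross x hx hxk p (by omega)
  exact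
  { dvd := h.dvd
    bi := by omega
    im := by omega
    mj := by omega
    je := by omega
    en := h.en
    eb := h.eb
    ending := h.ending
    count := by omega
    left := h.left
    right := h.right
    before := by rw [← h.before]; exact valuesOn_congr fun x hx => hB x (by omega)
    vals := by
      rw [valuesOn_succ _ hbk, hk, valuesOn_congr hB, h.vals]
      rcases hp with ⟨rfl, _, rfl, rfl⟩ | ⟨rfl, _, rfl, rfl⟩
      · rw [valuesOn_succ _ h4, add_right_comm]
      · rw [valuesOn_succ _ h5, add_assoc]
    sorted := by
      intro c x y hc hx hxy hy hyk
      rcases Nat.lt_or_ge y k with hyk' | hyk'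
      · rw [hB x (by omega), hB y hyk']
        exact h.sorted c x y hc hx hxy hy hyk'
      · obtain rfl : y = k := by omega
        have hke : y < e := by omega
        obtain rfl := eq_of_dvd_of_interval h.dvd hc hbk (by omega) (by omega) hy
        rw [hB x hxy, hk]
        exact hpc x hx hxy
    cross := by
      intro x hx hxk y hy
      rcases Nat.lt_or_ge x k with hxk' | hxk'
      · rw [hB x hxk']
        exact htrans x y hx hxk' hy (hpc x hx hxk') (hmin y hy)
      · obtain rfl : x = k := by omega
        rw [hk]
        exact hmin y hy }

end MergeInv

/-- An order relation on indices that may depend on the number of disks and the real memory. -/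
abbrev Key := ℕ → (ℕ → ℝ) → ℕ → ℕ → Prop

variable (lt : Key) (hlt : ∀ f g : St → ℕ, NC f → NC g → BC fun s => lt s.n s.rm (f s) (g s))

/-- Start merging the next two runs, if the previous ones are finished. -/
def mergeStart : Op :=
  .ite (fun s => s.k = s.e)
    (.block [.i fun s => s.k, .m fun s => if s.k + s.w < s.n then s.k + s.w else s.n,
      .j fun s => s.m, .e fun s => if s.m + s.w < s.n then s.m + s.w else s.n])
    (.block [])

/-- Append the next element of one of the two runs. -/
def mergeEmit : Op :=
  .ite (fun s => s.i < s.m ∧ (¬ s.j < s.e ∨ ¬ lt s.n s.rm (s.nm (s.src + s.j)) (s.nm (s.src + s.i))))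
    (.block [.stN (fun s => s.top + s.k) (fun s => s.nm (s.src + s.i)), .i fun s => s.i + 1,
      .k fun s => s.k + 1])
    (.block [.stN (fun s => s.top + s.k) (fun s => s.nm (s.src + s.j)), .j fun s => s.j + 1,
      .k fun s => s.k + 1])
    (.and (by fun_prop) (.or (by fun_prop) (hlt _ _ (by fun_prop) (by fun_prop)).not))

/-- Merge sort of the indices below `n`; the result is found at the address `src`. -/
def sortCmd : Cmd :=
  .seq (.op (.k fun _ => 0)) <|
  .seq (.loop (fun s => s.k < s.n) (by fun_prop)
    (.op (.block [.stN (fun s => s.top + s.k) (fun s => s.k), .k fun s => s.k + 1]))) <|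
  .seq (.op (.block [.src fun s => s.top, .top fun s => s.top + s.n, .w fun _ => 1])) <|
  .loop (fun s => s.w < s.n) (by fun_prop) <|
    .seq (.op (.block [.k fun _ => 0, .i fun _ => 0, .j fun _ => 0, .m fun _ => 0, .e fun _ => 0])) <|
    .seq (.loop (fun s => s.k < s.n) (by fun_prop) (.seq (.op mergeStart) (.op (mergeEmit lt hlt))))
    (.op (.block [.src fun s => s.top, .top fun s => s.top + s.n, .w fun s => s.w + s.w]))

/-- A bound for the number of steps of merge sort. -/
def sortCost (n : ℕ) : ℕ := (Nat.log 2 n + 1) * (3 * n + 4) + 2 * n + 4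

/-- `lt` is a strict weak order on the indices below `n`. -/
structure IsWeakOrder (lt : ℕ → ℕ → Prop) (n : ℕ) : Prop where
  asymm : ∀ a < n, ∀ b < n, lt a b → ¬ lt b a
  trans : ∀ a < n, ∀ b < n, ∀ c < n, ¬ lt b a → ¬ lt c b → ¬ lt c a

/-- What does not change during a sort. -/
structure SortEnv (n : ℕ) (rm : ℕ → ℝ) (top : ℕ) (s : St) : Prop where
  n_eq : s.n = n
  rm_eq : s.rm = rm
  src_le : top ≤ s.src
  top_eq : s.top = s.src + n

/-- `V` lists the indices below `n` in sorted order. -/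
structure IsSortedList (lt : ℕ → ℕ → Prop) (n : ℕ) (V : ℕ → ℕ) : Prop where
  lt_n : ∀ x < n, V x < n
  surj : ∀ a < n, ∃ x < n, V x = a
  inj : ∀ x < n, ∀ y < n, V x = V y → x = y
  sorted : ∀ x y, x < y → y < n → ¬ lt (V y) (V x)

/-- Equality of the multisets of values says that `V` permutes the indices below `n`. -/
theorem isSortedList_of_values {lt : ℕ → ℕ → Prop} {n : ℕ} {V : ℕ → ℕ}
    (hV : valuesOn V 0 n = valuesOn id 0 n) (hs : ∀ x y, x < y → y < n → ¬ lt (V y) (V x)) :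
    IsSortedList lt n V := by
  simp only [valuesOn_eq_map, Multiset.map_id] at hV
  have hmem : ∀ a, a < n ↔ ∃ x < n, V x = a := by
    intro a
    rw [← Multiset.mem_range, ← hV, Multiset.mem_map]
    simp
  refine ⟨fun x hx => (hmem _).2 ⟨x, hx, rfl⟩, fun a ha => (hmem a).1 ha, fun x hx y hy he => ?_, hs⟩
  have hnd : ((Multiset.range n).map V).Nodup := by rw [hV]; exact Multiset.nodup_range n
  exact Multiset.inj_on_of_nodup_map hnd x (Multiset.mem_range.2 hx) y (Multiset.mem_range.2 hy) he

theorem valuesOn_lt {V : ℕ → ℕ} {n x : ℕ} (hV : valuesOn V 0 n = valuesOn id 0 n) (hx : x < n) :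
    V x < n := (isSortedList_of_values (lt := fun _ _ => False) hV (by simp)).lt_n x hx

variable {lt hlt}

/-- The target array starts at `src + n`, so writing to it never disturbs the source. Each round
writes one entry. -/
theorem mergePass_runs {n w src : ℕ} {rm : ℕ → ℝ} {A : ℕ → ℕ} (ho : IsWeakOrder (lt n rm) n)
    (hAv : valuesOn A 0 n = valuesOn id 0 n)
    (hA : BlocksSorted (fun a b => ¬ lt n rm b a) A w n) (hw : 0 < w)
    {top : ℕ} {s : St} (hs : SortEnv n rm top s) (hsrc : s.src = src) (hsw : s.w = w)
    (hsA : ∀ x < n, s.nm (src + x) = A x) (hk : s.k = 0) (hi : s.i = 0) (hj : s.j = 0)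
    (hm : s.m = 0) (he : s.e = 0) :
    (Cmd.loop (fun s => s.k < s.n) (by fun_prop)
      (.seq (.op mergeStart) (.op (mergeEmit lt hlt)))).Runs s (n * 3 + 1) fun s' =>
      SortEnv n rm top s' ∧ s'.src = src ∧ s'.w = w ∧
      valuesOn (fun x => s'.nm (s'.top + x)) 0 n = valuesOn id 0 n ∧
      BlocksSorted (fun a b => ¬ lt n rm b a) (fun x => s'.nm (s'.top + x)) (2 * w) n := by
  set le := fun a b => ¬ lt n rm b a with hle
  let J : St → ℕ → Prop := fun s b => MergeInv le A (fun x => s.nm (s.top + x)) n w b s.k s.i s.j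
    s.m s.e
  let E : St → Prop := fun s => SortEnv n rm top s ∧ s.src = src ∧ s.w = w ∧
    ∀ x < n, s.nm (src + x) = A x
  have hbody : ∀ r s, (E s ∧ (∃ b, J s b) ∧ r + s.k = n) → s.k < s.n →
      (Cmd.seq (.op mergeStart) (.op (mergeEmit lt hlt))).Runs s (1 + 1) fun s' =>
        ∃ r' < r, E s' ∧ (∃ b, J s' b) ∧ r' + s'.k = n := by
    rintro r s ⟨hE, ⟨b, hJ⟩, hr⟩ hkn
    rw [hE.1.n_eq] at hkn
    refine Cmd.Runs.seq (Q' := fun s => (E s ∧ (∃ b, J s b) ∧ r + s.k = n) ∧ s.k < s.e)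
      (.op ?_) ?_
    · have hle := hJ.k_le
      obtain ⟨⟨h1, h2, h3, h4⟩, h5, h6, h7⟩ := hE
      by_cases hke : s.k = s.e
      · have := hJ.newBlock hA hw hke hkn
        have e1 : ∀ a, (if a + s.w < s.n then a + s.w else s.n) = min (a + w) n := by
          intro a
          rw [h1, h6]
          split_ifs <;> omega
        simp only [mergeStart, Op.ite_fn, if_pos hke, Op.block_cons, Op.block_nil, Op.i, Op.m, Op.j,
          Op.e, e1]
        refine ⟨⟨⟨⟨h1, h2, h3, h4⟩, h5, h6, h7⟩, ⟨s.k, this⟩, hr⟩, ?_⟩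
        omega
      · simp only [mergeStart, Op.ite_fn, if_neg hke, Op.block_nil]
        exact ⟨⟨⟨⟨h1, h2, h3, h4⟩, h5, h6, h7⟩, ⟨b, hJ⟩, hr⟩, by omega⟩
    · clear hE hJ hr hkn b s
      rintro s ⟨⟨hE, ⟨b, hJ⟩, hr⟩, hke⟩
      refine .op ?_
      obtain ⟨⟨h1, h2, h3, h4⟩, h5, h6, h7⟩ := hE
      have hen := hJ.en
      have hkm := hJ.count
      have him := hJ.im
      have hje := hJ.je
      have hbi := hJ.bi
      have hmj := hJ.mj
      have hAi : s.i < s.m → s.nm (s.src + s.i) = A s.i := fun h => by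
        rw [h5]; exact h7 _ (by omega)
      have hAj : s.j < s.e → s.nm (s.src + s.j) = A s.j := fun h => by
        rw [h5]; exact h7 _ (by omega)
      have hlt : ∀ x < n, A x < n := fun x hx => valuesOn_lt hAv hx
      -- The entries written so far are values of `A`, hence indices below `n`, to which
      -- transitivity applies.
      have hBn : ∀ x, b ≤ x → x < s.k → s.nm (s.top + x) < n := by
        intro x hx hxk
        have hv := hJ.vals
        have : s.nm (s.top + x) ∈ valuesOn (fun x => s.nm (s.top + x)) b s.k := by
          rw [valuesOn, Multiset.mem_sum]
          exact ⟨x, Finset.mem_Ico.2 ⟨hx, hxk⟩, by simp⟩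
        rw [hv, Multiset.mem_add, valuesOn, valuesOn, Multiset.mem_sum, Multiset.mem_sum] at this
        rcases this with ⟨y, hy, hy'⟩ | ⟨y, hy, hy'⟩ <;>
        · rw [Multiset.mem_singleton.1 hy']
          rw [Finset.mem_Ico] at hy
          exact hlt y (by omega)
      have hkeep : ∀ v x, x < n → Function.update s.nm (s.top + s.k) v (src + x) = A x := by
        intro v x hx
        rw [Function.update_of_ne (by omega)]
        exact h7 x hx
      have hB : ∀ v, ∀ x < s.k, Function.update s.nm (s.top + s.k) v (s.top + x) =
          s.nm (s.top + x) := fun v x hx => Function.update_of_ne (by omega) _ _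
      by_cases hc : s.i < s.m ∧ (¬ s.j < s.e ∨ ¬ lt s.n s.rm (s.nm (s.src + s.j)) (s.nm (s.src + s.i)))
      · simp only [mergeEmit, Op.ite_fn, if_pos hc, Op.block_cons, Op.block_nil, Op.stN, Op.i, Op.k]
        refine ⟨r - 1, by omega, ⟨⟨h1, h2, h3, h4⟩, h5, h6, hkeep _⟩, ⟨b, ?_⟩,
          show r - 1 + (s.k + 1) = n by omega⟩
        obtain ⟨hc1, hc2⟩ := hc
        rw [h1, h2, hAi hc1] at hc2
        have hmin : ∀ y, (s.i + 1 ≤ y ∧ y < s.m) ∨ (s.j ≤ y ∧ y < s.e) → le (A s.i) (A y) := by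
          rintro y (⟨hy1, hy2⟩ | ⟨hy1, hy2⟩)
          · exact hJ.left _ _ hbi hy1 hy2
          · have hj : s.j < s.e := by omega
            rw [hAj hj] at hc2
            have := hc2.resolve_left (not_not_intro hj)
            rcases hy1.eq_or_lt with rfl | hy1
            · exact this
            · exact ho.trans _ (hlt _ (by omega)) _ (hlt s.j (by omega)) _ (hlt _ (by omega)) this
                (hJ.right _ _ hmj hy1 hy2)
        refine hJ.emit (p := s.i) (Or.inl ⟨rfl, hc1, rfl, rfl⟩) hmin ?_ (hB _) ?_
        · intro x y hx hxk hy g1 g2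
          exact ho.trans _ (hBn x hx hxk) _ (hlt s.i (by omega)) _ (hlt y (by omega)) g1 g2
        · exact (Function.update_self (s.top + s.k) _ s.nm).trans (hAi hc1)
      · simp only [mergeEmit, Op.ite_fn, if_neg hc, Op.block_cons, Op.block_nil, Op.stN, Op.j, Op.k]
        have hj : s.j < s.e := by
          by_contra hj
          exact hc ⟨by omega, Or.inl hj⟩
        refine ⟨r - 1, by omega, ⟨⟨h1, h2, h3, h4⟩, h5, h6, hkeep _⟩, ⟨b, ?_⟩,
          show r - 1 + (s.k + 1) = n by omega⟩
        have hmin : ∀ y, (s.i ≤ y ∧ y < s.m) ∨ (s.j + 1 ≤ y ∧ y < s.e) → le (A s.j) (A y) := by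
          rintro y (⟨hy1, hy2⟩ | ⟨hy1, hy2⟩)
          · have hi : s.i < s.m := by omega
            have hlt' : lt n rm (A s.j) (A s.i) := by
              by_contra hn
              refine hc ⟨hi, Or.inr ?_⟩
              rwa [h1, h2, hAi hi, hAj hj]
            have := ho.asymm _ (hlt s.j (by omega)) _ (hlt s.i (by omega)) hlt'
            rcases hy1.eq_or_lt with rfl | hy1
            · exact this
            · exact ho.trans _ (hlt s.j (by omega)) _ (hlt s.i (by omega)) _ (hlt _ (by omega)) this
                (hJ.left _ _ hbi hy1 hy2)
          · exact hJ.right _ _ hmj hy1 hy2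
        refine hJ.emit (p := s.j) (Or.inr ⟨rfl, hj, rfl, rfl⟩) hmin ?_ (hB _) ?_
        · intro x y hx hxk hy g1 g2
          exact ho.trans _ (hBn x hx hxk) _ (hlt s.j (by omega)) _ (hlt y (by omega)) g1 g2
        · exact (Function.update_self (s.top + s.k) _ s.nm).trans (hAj hj)
  refine (Cmd.Runs.loop_rounds (fun r s => E s ∧ (∃ b, J s b) ∧ r + s.k = n) hbody (r := n)
    ⟨⟨hs, hsrc, hsw, hsA⟩, ⟨0, ?_⟩, by omega⟩).mono le_rfl ?_
  · simp only [J, hk, hi, hj, hm, he]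
    exact .init
  · rintro s' ⟨h1, r, ⟨h2, h3, h4, h5⟩, ⟨b, h6⟩, h7⟩
    rw [h2.n_eq] at h1
    have h8 := h6.k_le
    have h9 := h6.en
    have hkn : s'.k = n := by omega
    refine ⟨h2, h3, h4, ?_, ?_⟩
    · rw [← hAv, ← hkn]
      exact h6.values_eq (by omega)
    · have := h6.sorted
      rwa [hkn] at this

/-- Every pass writes to a fresh array, so nothing is copied back. The run length after `a` passes
is `2 ^ a`, and `⌊log₂ n⌋ + 1` passes of at most `3 * n + 4` operations suffice. -/
theorem sort_runs {s : St} (ho : IsWeakOrder (lt s.n s.rm) s.n) :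
    (sortCmd lt hlt).Runs s (sortCost s.n) fun s' => SortEnv s.n s.rm s.top s' ∧
      IsSortedList (lt s.n s.rm) s.n (fun x => s'.nm (s'.src + x)) := by
  set n := s.n with hn
  set rm := s.rm with hrm
  set top := s.top with htop
  set le := fun a b => ¬ lt n rm b a
  have e : sortCost n = 1 + ((n * (1 + 1) + 1) + (1 + ((Nat.log 2 n + 1) *
      ((1 + ((n * 3 + 1) + 1)) + 1) + 1))) := by
    unfold sortCost
    ring
  rw [e]
  refine .seq (Q' := fun s => (s.n = n ∧ s.rm = rm ∧ s.top = top) ∧ s.k = 0)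
    (.op ⟨⟨rfl, rfl, rfl⟩, rfl⟩) ?_
  rintro s₁ ⟨hs₁, hk₁⟩
  refine .seq (Q' := fun s => (s.n = n ∧ s.rm = rm ∧ s.top = top) ∧ ∀ x < n, s.nm (top + x) = x)
    ((Cmd.Runs.loop_rounds (fun r s => (s.n = n ∧ s.rm = rm ∧ s.top = top) ∧ r + s.k = n ∧
      ∀ x < s.k, s.nm (top + x) = x) ?_ (r := n) ⟨hs₁, by omega, by simp [hk₁]⟩).mono le_rfl ?_) ?_
  · rintro r s ⟨⟨h1, h2, h3⟩, h4, h5⟩ hk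
    refine .op ?_
    simp only [Op.block_cons, Op.block_nil, Op.stN, Op.k]
    refine ⟨r - 1, by omega, ⟨h1, h2, h3⟩, show r - 1 + (s.k + 1) = n by omega, fun x hx => ?_⟩
    rcases (Nat.lt_succ_iff.1 hx).lt_or_eq with hx | rfl
    · rw [Function.update_of_ne (by omega), h5 x hx]
    · rw [h3, Function.update_self]
  · rintro s' ⟨h1, r, h2, h3, h4⟩
    exact ⟨h2, fun x hx => h4 x (by have := h2.1; omega)⟩
  · rintro s₂ ⟨⟨h1, h2, h3⟩, h4⟩
    let I : ℕ → St → Prop := fun r s => SortEnv n rm top s ∧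
      (∃ a, s.w = 2 ^ a ∧ r + a = Nat.log 2 n + 1) ∧
      valuesOn (fun x => s.nm (s.src + x)) 0 n = valuesOn id 0 n ∧
      BlocksSorted le (fun x => s.nm (s.src + x)) s.w n
    refine .seq (Q' := I (Nat.log 2 n + 1)) (.op ?_) fun s₃ hs₃ =>
      (Cmd.Runs.loop_rounds I ?_ hs₃).mono le_rfl ?_
    · simp only [Op.block_cons, Op.block_nil, Op.src, Op.top, Op.w]
      refine ⟨⟨h1, h2, h3.ge, by simp only; rw [h1]⟩, ⟨0, rfl, by omega⟩, ?_, ?_⟩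
      · exact valuesOn_congr fun x hx => by rw [h3]; exact h4 x hx
      · intro c x y _ hx hxy hy _
        simp only at hy
        omega
    · rintro r s ⟨hE, ⟨a, ha, hra⟩, hv, hb⟩ hwn
      have hw : 0 < s.w := ha ▸ Nat.two_pow_pos a
      have har : a < Nat.log 2 n + 1 := by
        rw [hE.n_eq, ha] at hwn
        exact (Nat.pow_lt_pow_iff_right (by norm_num)).1
          (hwn.trans (Nat.lt_pow_succ_log_self (b := 2) (by norm_num) n))
      refine .seq (Q' := fun s' => SortEnv n rm top s' ∧ s'.src = s.src ∧ s'.w = s.w ∧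
        s'.nm = s.nm ∧ s'.k = 0 ∧ s'.i = 0 ∧ s'.j = 0 ∧ s'.m = 0 ∧ s'.e = 0)
        (.op ⟨⟨hE.1, hE.2, hE.3, hE.4⟩, rfl, rfl, rfl, rfl, rfl, rfl, rfl, rfl⟩) ?_
      rintro s₄ ⟨g0, g1, g2, g3, g4, g5, g6, g7, g8⟩
      refine .seq (mergePass_runs ho hv hb hw g0 g1 g2 (fun x _ => by rw [g3]) g4 g5 g6 g7 g8) ?_
      rintro s₅ ⟨f1, f2, f3, f4, f5⟩
      refine .op ?_
      simp only [Op.block_cons, Op.block_nil, Op.src, Op.top, Op.w]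
      refine ⟨r - 1, by omega, ⟨f1.1, f1.2, ?_, by simp only; rw [f1.1]⟩, ⟨a + 1, ?_, by omega⟩, f4, ?_⟩
      · have := f1.3
        have := f1.4
        simp only
        omega
      · simp only
        rw [f3, ha, pow_succ]
        ring
      · simp only
        rw [f3, ← two_mul]
        exact f5
    · rintro s' ⟨hwn, r, hE, -, hv, hb⟩
      refine ⟨hE, isSortedList_of_values hv fun x y hxy hy => hb 0 x y (dvd_zero _) (Nat.zero_le _)
        hxy ?_ hy⟩
      rw [hE.n_eq] at hwn
      omega

end

noncomputable section

/-! ## Cells in registers -/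

theorem Cell.sub_mem_toSet {o p : Point} {σ : Cell} : p - o ∈ σ.toSet 0 ↔ p ∈ σ.toSet o := by
  simp only [Cell.mem_toSet, Prod.fst_sub, Prod.snd_sub, Prod.fst_zero, Prod.snd_zero, zero_add]
  constructor <;> rintro ⟨⟨_, _⟩, _, _⟩ <;> refine ⟨⟨?_, ?_⟩, ?_, ?_⟩ <;> linarith

theorem Cell.corner_eq (o : Point) (σ : Cell) : σ.corner o = o + σ.corner 0 := by
  ext <;> simp [Cell.corner]

/-- The machine operation knows only the grid centered at the origin, so the program works
throughout with coordinates relative to `o`. -/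
theorem isSmallestCell_sub {o p q : Point} {τ : Cell} (h : IsSmallestCell o {p, q} τ) :
    IsSmallestCell 0 {p - o, q - o} τ := by
  constructor
  · rintro x (rfl | rfl) <;> rw [Cell.sub_mem_toSet] <;> exact h.1 (by simp)
  · intro τ' h' x hx
    have h1 : ({p, q} : Set Point) ⊆ τ'.toSet o := by
      rintro y (rfl | rfl) <;> rw [← Cell.sub_mem_toSet] <;> exact h' (by simp)
    have h2 := Cell.sub_mem_toSet (o := o) (p := x + o) (σ := τ)
    have h3 := Cell.sub_mem_toSet (o := o) (p := x + o) (σ := τ')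
    rw [add_sub_cancel_right] at h2 h3
    exact h3.2 (h.2 _ h1 (h2.1 hx))

theorem smallestCellOp_sub {o p q : Point} {τ : Cell} (h : IsSmallestCell o {p, q} τ) :
    smallestCellOp (p - o) (q - o) = ((τ.corner 0).1, (τ.corner 0).2, τ.side) := by
  have h' := isSmallestCell_sub h
  have he : ∃ τ, IsSmallestCell 0 {p - o, q - o} τ := ⟨τ, h'⟩
  rw [smallestCellOp, dif_pos he, he.choose_spec.unique h']

/-- Membership of `(a, b)` in the half-open square with corner `(X, Y)` and side `S`. -/
def InBox (X Y S a b : ℝ) : Prop := (¬ a < X ∧ a < X + S) ∧ ¬ b < Y ∧ b < Y + S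

theorem Cell.inBox_iff {o p : Point} {σ : Cell} :
    InBox (σ.corner 0).1 (σ.corner 0).2 σ.side (p.1 - o.1) (p.2 - o.2) ↔ p ∈ σ.toSet o := by
  rw [← Cell.sub_mem_toSet, Cell.mem_iff_corner, InBox]
  simp only [not_lt, Prod.fst_sub, Prod.snd_sub]

/-- Once the cell is known, the quadrant of a point is found by comparing with the two midlines; no
rounding operation is needed. -/
theorem quadOf_box {o p : Point} {τ : Cell} (h : p ∈ τ.toSet o) :
    ((quadOf o τ p).corner 0).1 = (if p.1 - o.1 < (τ.corner 0).1 + τ.side / 2 then (τ.corner 0).1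
      else (τ.corner 0).1 + τ.side / 2) ∧
    ((quadOf o τ p).corner 0).2 = (if p.2 - o.2 < (τ.corner 0).2 + τ.side / 2 then (τ.corner 0).2
      else (τ.corner 0).2 + τ.side / 2) ∧ (quadOf o τ p).side = τ.side / 2 := by
  obtain ⟨a, ha, hp⟩ := exists_quadOf_eq h
  rw [ha]
  rw [← Cell.sub_mem_toSet, Cell.mem_iff_corner] at hp
  have hs := τ.side_quadrant a
  have hpos := τ.side_pos
  have hx : ((τ.quadrant a).corner 0).1 = (τ.corner 0).1 + (![0, 1, 0, 1] a : ℤ) * (τ.side / 2) := by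
    simp only [Cell.corner, hs]
    simp only [Cell.quadrant]
    push_cast
    simp
    ring
  have hy : ((τ.quadrant a).corner 0).2 = (τ.corner 0).2 + (![1, 1, 0, 0] a : ℤ) * (τ.side / 2) := by
    simp only [Cell.corner, hs]
    simp only [Cell.quadrant]
    push_cast
    simp
    ring
  simp only [hx, hy, hs, Prod.fst_sub, Prod.snd_sub] at hp ⊢
  refine ⟨?_, ?_, trivial⟩
  · fin_cases a <;> simp at hp ⊢ <;> intro _ <;> linarith
  · fin_cases a <;> simp at hp ⊢ <;> intro _ <;> linarith

/-! ## Comparing points in the Z-order -/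

/-- The comparison of two points in the Z-order of the standard grid. -/
def ZTest (px py qx qy : ℝ) : Prop :=
  (¬ py < (smallestCellOp (px, py) (qx, qy)).2.1 + (smallestCellOp (px, py) (qx, qy)).2.2 / 2 ∧
    qy < (smallestCellOp (px, py) (qx, qy)).2.1 + (smallestCellOp (px, py) (qx, qy)).2.2 / 2) ∨
  (((py < (smallestCellOp (px, py) (qx, qy)).2.1 + (smallestCellOp (px, py) (qx, qy)).2.2 / 2 ∧
    qy < (smallestCellOp (px, py) (qx, qy)).2.1 + (smallestCellOp (px, py) (qx, qy)).2.2 / 2) ∨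
    (¬ py < (smallestCellOp (px, py) (qx, qy)).2.1 + (smallestCellOp (px, py) (qx, qy)).2.2 / 2 ∧
    ¬ qy < (smallestCellOp (px, py) (qx, qy)).2.1 + (smallestCellOp (px, py) (qx, qy)).2.2 / 2)) ∧
  px < (smallestCellOp (px, py) (qx, qy)).1 + (smallestCellOp (px, py) (qx, qy)).2.2 / 2 ∧
  ¬ qx < (smallestCellOp (px, py) (qx, qy)).1 + (smallestCellOp (px, py) (qx, qy)).2.2 / 2)

/-- A single point has no smallest cell, and the operation returns a default value. The test asks
for different outcomes for its two points, so it fails whatever that value is. -/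
theorem not_zTest_self (a b : ℝ) : ¬ ZTest a b a b := by
  unfold ZTest
  tauto

theorem Cell.quadrant_cases {τ : Cell} {a : Fin 4} {p : Point} (h : p ∈ (τ.quadrant a).toSet 0) :
    (p.2 < (τ.corner 0).2 + τ.side / 2 ↔ 2 ≤ a) ∧
    (p.1 < (τ.corner 0).1 + τ.side / 2 ↔ a = 0 ∨ a = 2) := by
  obtain ⟨h1, h2, -⟩ := quadOf_box (τ.quadrant_subset 0 a h)
  have h3 : quadOf 0 τ p = τ.quadrant a := Cell.mem_iff_cellAt.1 h
  have hs := τ.side_quadrant a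
  have hpos := τ.side_pos
  rw [Cell.mem_toSet, hs] at h
  simp only [Cell.corner, Cell.quadrant] at *
  push_cast at *
  constructor
  · fin_cases a <;> simp at h ⊢ <;> linarith
  · fin_cases a <;> simp at h ⊢ <;> linarith

/-- In the order NW, NE, SW, SE the upper half comes first, and within a half the left quadrant.
Both are read off from the midlines of the smallest cell of the two points. -/
theorem zTest_iff {o p q : Point} {σ : Cell} (hp : p ∈ σ.toSet o) (hq : q ∈ σ.toSet o) :
    ZTest (p.1 - o.1) (p.2 - o.2) (q.1 - o.1) (q.2 - o.2) ↔ ZLt o p q := by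
  by_cases hpq : p = q
  · subst hpq
    exact ⟨fun h => absurd h (not_zTest_self _ _), fun h => absurd rfl h.ne⟩
  have hτ := isSmallestCell_lcc hp hq hpq
  set τ := lcc o p q
  obtain ⟨a, b, ha, hb, hab⟩ := hτ.exists_quadrant_ne
  have hop : smallestCellOp (p.1 - o.1, p.2 - o.2) (q.1 - o.1, q.2 - o.2) =
    ((τ.corner 0).1, (τ.corner 0).2, τ.side) := smallestCellOp_sub hτ
  obtain ⟨h1, h2⟩ := Cell.quadrant_cases (Cell.sub_mem_toSet.2 ha)
  obtain ⟨h3, h4⟩ := Cell.quadrant_cases (Cell.sub_mem_toSet.2 hb)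
  simp only [Prod.fst_sub, Prod.snd_sub] at h1 h2 h3 h4
  have hz : ZLt o p q ↔ a < b := by
    constructor
    · rintro ⟨τ', a', b', hab', ha', hb'⟩
      obtain rfl := hτ.unique (ZLt.isSmallestCell hab'.ne ha' hb')
      obtain rfl := Cell.quadrant_unique ha ha'
      obtain rfl := Cell.quadrant_unique hb hb'
      exact hab'
    · exact fun h => ⟨τ, a, b, h, ha, hb⟩
  rw [hz]
  simp only [ZTest, hop, h1, h2, h3, h4]
  clear h1 h2 h3 h4 ha hb hz hop hτ
  revert hab
  fin_cases a <;> fin_cases b <;> simp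

@[fun_prop]
theorem RC.two : RC fun _ => 2 := by
  have := RC.const_rat 2
  norm_num at this
  exact this

@[fun_prop]
theorem RC.one : RC fun _ => 1 := by
  have := RC.const_rat 1
  norm_num at this
  exact this

@[fun_prop]
theorem RC.zero : RC fun _ => 0 := by
  have := RC.const_rat 0
  norm_num at this
  exact this

@[fun_prop]
theorem BC.zTest {a b c d : St → ℝ} (ha : RC a) (hb : RC b) (hc : RC c) (hd : RC d) :
    BC fun s => ZTest (a s) (b s) (c s) (d s) := by
  unfold ZTest
  fun_prop

@[fun_prop]
theorem BC.inBox {X Y S a b : St → ℝ} (hX : RC X) (hY : RC Y) (hS : RC S) (ha : RC a) (hb : RC b) :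
    BC fun s => InBox (X s) (Y s) (S s) (a s) (b s) := by
  unfold InBox
  fun_prop

/-! ## The input -/

/-- The coordinates of the center of a disk, relative to the center of the grid. -/
def relX (rm : ℕ → ℝ) (a : ℕ) : ℝ := rm (5 + (a + a + a)) - rm 0

/-- The coordinates of the center of a disk, relative to the center of the grid. -/
def relY (rm : ℕ → ℝ) (a : ℕ) : ℝ := rm (6 + (a + a + a)) - rm 1

/-- The radius of a disk. -/
def rad (rm : ℕ → ℝ) (a : ℕ) : ℝ := rm (7 + (a + a + a))

@[fun_prop]
theorem RC.relX {f : St → ℕ} (hf : NC f) : RC fun s => relX s.rm (f s) := by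
  unfold _root_.relX
  fun_prop

@[fun_prop]
theorem RC.relY {f : St → ℕ} (hf : NC f) : RC fun s => relY s.rm (f s) := by
  unfold _root_.relY
  fun_prop

@[fun_prop]
theorem RC.rad {f : St → ℕ} (hf : NC f) : RC fun s => rad s.rm (f s) := by
  unfold _root_.rad
  fun_prop

/-- The disk with a given index. -/
def dk {n : ℕ} (d : Fin n → Disk) (a : ℕ) : Disk := if h : a < n then d ⟨a, h⟩ else ⟨0, 1, one_pos⟩

/-- The real memory contains the input. -/
structure IsInput (o : Point) (σ₀ : Cell) {n : ℕ} (d : Fin n → Disk) (rm : ℕ → ℝ) : Prop where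
  relX : ∀ a < n, relX rm a = (dk d a).center.1 - o.1
  relY : ∀ a < n, relY rm a = (dk d a).center.2 - o.2
  rad : ∀ a < n, rad rm a = (dk d a).radius
  boxX : rm 2 - rm 0 = (σ₀.corner 0).1
  boxY : rm 3 - rm 1 = (σ₀.corner 0).2
  boxS : rm 4 = σ₀.side

theorem getD_flatMap_triple (L : List Disk) (a k : ℕ) (ha : a < L.length) (hk : k < 3) :
    (L.flatMap fun D => [D.center.1, D.center.2, D.radius]).getD (a * 3 + k) 0 =
      [L[a].center.1, L[a].center.2, L[a].radius].getD k 0 := by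
  induction L generalizing a with
  | nil => simp at ha
  | cons D L ih =>
    cases a with
    | zero => interval_cases k <;> simp
    | succ a =>
      have h := ih a (by simpa using ha)
      rw [List.flatMap_cons, List.getD_append_right _ _ _ _ (by simp; omega)]
      rw [show (a + 1) * 3 + k - [D.center.1, D.center.2, D.radius].length = a * 3 + k by
        simp; omega, h]
      rfl

theorem isInput_inputState {o : Point} {σ₀ : Cell} {n : ℕ} {d : Fin n → Disk} :
    IsInput o σ₀ d (inputState o σ₀ d).rmem := by
  have h : ∀ a < n, ∀ k < 3, (inputState o σ₀ d).rmem (5 + k + (a + a + a)) =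
      [(dk d a).center.1, (dk d a).center.2, (dk d a).radius].getD k 0 := by
    intro a ha k hk
    simp only [inputState, inputReals]
    rw [List.getD_append_right _ _ _ _ (by simp; omega)]
    rw [show 5 + k + (a + a + a) -
      [o.1, o.2, (σ₀.corner o).1, (σ₀.corner o).2, σ₀.side].length = a * 3 + k by simp; omega]
    rw [getD_flatMap_triple _ _ _ (by simpa using ha) hk]
    simp [dk, ha]
  have h0 : (inputState o σ₀ d).rmem 0 = o.1 := rfl
  have h1 : (inputState o σ₀ d).rmem 1 = o.2 := rfl
  have h2 : (inputState o σ₀ d).rmem 2 = (σ₀.corner o).1 := rfl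
  have h3 : (inputState o σ₀ d).rmem 3 = (σ₀.corner o).2 := rfl
  refine ⟨fun a ha => ?_, fun a ha => ?_, fun a ha => ?_, ?_, ?_, rfl⟩
  · rw [relX, h0, show 5 + (a + a + a) = 5 + 0 + (a + a + a) by ring, h a ha 0 (by omega)]
    rfl
  · rw [relY, h1, show 6 + (a + a + a) = 5 + 1 + (a + a + a) by ring, h a ha 1 (by omega)]
    rfl
  · rw [rad, show 7 + (a + a + a) = 5 + 2 + (a + a + a) by ring, h a ha 2 (by omega)]
    rfl
  · rw [h2, h0, Cell.corner_eq]
    simp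
  · rw [h3, h1, Cell.corner_eq]
    simp

theorem IsInput.congr {o : Point} {σ₀ : Cell} {n : ℕ} {d : Fin n → Disk} {rm rm' : ℕ → ℝ}
    (h : IsInput o σ₀ d rm) (hrm : ∀ a < 5 + (n + n + n), rm' a = rm a) : IsInput o σ₀ d rm' where
  relX a ha := by rw [← h.relX a ha, _root_.relX, hrm _ (by omega), hrm _ (by omega)]; rfl
  relY a ha := by rw [← h.relY a ha, _root_.relY, hrm _ (by omega), hrm _ (by omega)]; rfl
  rad a ha := by rw [← h.rad a ha, _root_.rad, hrm _ (by omega)]; rfl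
  boxX := by rw [hrm _ (by omega), hrm _ (by omega), h.boxX]
  boxY := by rw [hrm _ (by omega), hrm _ (by omega), h.boxY]
  boxS := by rw [hrm _ (by omega), h.boxS]

/-- The Z-order of the centers, as a relation on the indices of the disks. -/
def zKey : Key := fun _ rm a b => ZTest (relX rm a) (relY rm a) (relX rm b) (relY rm b)

theorem BC.zKey (f g : St → ℕ) (hf : NC f) (hg : NC g) : BC fun s => zKey s.n s.rm (f s) (g s) := by
  unfold _root_.zKey
  fun_prop

theorem zKey_iff {o : Point} {σ₀ : Cell} {n : ℕ} {d : Fin n → Disk} {rm : ℕ → ℝ}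
    (h : IsInput o σ₀ d rm) (hd : ∀ a < n, (dk d a).center ∈ σ₀.toSet o) {a b : ℕ} (ha : a < n)
    (hb : b < n) : zKey n rm a b ↔ ZLt o (dk d a).center (dk d b).center := by
  rw [zKey, h.relX a ha, h.relY a ha, h.relX b hb, h.relY b hb, zTest_iff (hd a ha) (hd b hb)]

/-- The Z-order is total on distinct points of `σ₀`; incomparable indices are exactly disks with
equal centers. -/
theorem isWeakOrder_zKey {o : Point} {σ₀ : Cell} {n : ℕ} {d : Fin n → Disk} {rm : ℕ → ℝ}
    (h : IsInput o σ₀ d rm) (hd : ∀ a < n, (dk d a).center ∈ σ₀.toSet o) :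
    IsWeakOrder (zKey n rm) n := by
  constructor
  · intro a ha b hb
    rw [zKey_iff h hd ha hb, zKey_iff h hd hb ha]
    exact ZLt.asymm
  · intro a ha b hb c hc
    rw [zKey_iff h hd hb ha, zKey_iff h hd hc hb, zKey_iff h hd hc ha]
    intro h1 h2 h3
    rcases eq_or_ne (dk d a).center (dk d b).center with e | e
    · exact h2 (e ▸ h3)
    rcases eq_or_ne (dk d b).center (dk d c).center with e' | e'
    · exact h1 (e' ▸ h3)
    have h4 := (ZLt.total (hd a ha) (hd b hb) e).resolve_right h1
    have h5 := (ZLt.total (hd b hb) (hd c hc) e').resolve_right h2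
    exact (h4.trans h5).asymm h3

end

noncomputable section

/-! ## Tests on disks and cells -/

/-- The test for a disk with center `(a, b)` and radius `r` to lie in a half-open square. -/
def DiskInside (X Y S a b r : ℝ) : Prop :=
  (X ≤ a - r ∧ a + r < X + S) ∧ Y ≤ b - r ∧ b + r < Y + S

theorem diskInside_iff {o : Point} {σ : Cell} {D : Disk} :
    DiskInside (σ.corner 0).1 (σ.corner 0).2 σ.side (D.center.1 - o.1) (D.center.2 - o.2)
      D.radius ↔ D.toSet ⊆ σ.toSet o := by
  rw [Disk.subset_cell_iff, Cell.corner_eq o, DiskInside]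
  simp only [Prod.fst_add, Prod.snd_add]
  constructor <;> rintro ⟨⟨_, _⟩, _, _⟩ <;> refine ⟨⟨?_, ?_⟩, ?_, ?_⟩ <;> linarith

theorem gapTo_sub (t X s a : ℝ) : gapTo X s (a - t) = gapTo (t + X) s a := by
  simp only [gapTo, sub_lt_iff_lt_add', ← add_assoc]
  split_ifs <;> ring

theorem diskMeets_iff {o : Point} {σ : Cell} {D : Disk} :
    DiskMeets (σ.corner 0).1 (σ.corner 0).2 σ.side (D.center.1 - o.1) (D.center.2 - o.2)
      D.radius ↔ (D.toSet ∩ σ.toSet o).Nonempty := by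
  rw [Disk.inter_cell_nonempty_iff, Cell.corner_eq o, DiskMeets, DiskMeets, gapTo_sub, gapTo_sub]
  simp only [Prod.fst_add, Prod.snd_add, sub_lt_iff_lt_add', ← add_assoc]

@[fun_prop]
theorem BC.diskInside {X Y S a b r : St → ℝ} (hX : RC X) (hY : RC Y) (hS : RC S) (ha : RC a)
    (hb : RC b) (hr : RC r) : BC fun s => DiskInside (X s) (Y s) (S s) (a s) (b s) (r s) := by
  unfold DiskInside
  fun_prop

@[fun_prop]
theorem RC.gapTo {X S a : St → ℝ} (hX : RC X) (hS : RC S) (ha : RC a) :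
    RC fun s => gapTo (X s) (S s) (a s) := by
  unfold _root_.gapTo
  exact .ite (by fun_prop) (by fun_prop) (.ite (by fun_prop) (by fun_prop) (by fun_prop))

@[fun_prop]
theorem BC.diskMeets {X Y S a b r : St → ℝ} (hX : RC X) (hY : RC Y) (hS : RC S) (ha : RC a)
    (hb : RC b) (hr : RC r) : BC fun s => DiskMeets (X s) (Y s) (S s) (a s) (b s) (r s) := by
  unfold DiskMeets
  simp only [pow_two]
  fun_prop

/-! ## The tables -/

/-- The coordinates of the point at position `u`, relative to the center of the grid. -/
def ptX (s : St) (u : ℕ) : ℝ := relX s.rm (s.nm (s.rb + u))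

/-- The coordinates of the point at position `u`, relative to the center of the grid. -/
def ptY (s : St) (u : ℕ) : ℝ := relY s.rm (s.nm (s.rb + u))

@[fun_prop]
theorem RC.ptX {f : St → ℕ} (hf : NC f) : RC fun s => ptX s (f s) := by
  unfold _root_.ptX
  fun_prop

@[fun_prop]
theorem RC.ptY {f : St → ℕ} (hf : NC f) : RC fun s => ptY s (f s) := by
  unfold _root_.ptY
  fun_prop

/-- The memory holds the input, the tables of the list `l` of the centers, and the powers
of two. -/
structure HasTables (o : Point) (σ₀ : Cell) {n : ℕ} (d : Fin n → Disk) (l : List Point) (s : St) :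
    Prop where
  n_eq : s.n = n
  input : IsInput o σ₀ d s.rm
  N_eq : s.N = l.length
  rep : ∀ u, 1 ≤ u → u ≤ l.length →
    s.nm (s.rb + u) < n ∧ (dk d (s.nm (s.rb + u))).center = pnt l u
  pos : ∀ a < n, (1 ≤ s.nm (s.pb + a) ∧ s.nm (s.pb + a) ≤ l.length) ∧
    pnt l (s.nm (s.pb + a)) = (dk d a).center
  pow : ∀ i ≤ Nat.log 2 l.length, s.nm (s.wb + i) = 2 ^ i
  t_eq : s.t = Nat.log 2 l.length + 1
  tl_eq : s.tl = s.t

/-- The registers and the memory that stay fixed while a disk is located. -/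
structure LocFrame (s s' : St) : Prop where
  n : s'.n = s.n
  N : s'.N = s.N
  pb : s'.pb = s.pb
  rb : s'.rb = s.rb
  wb : s'.wb = s.wb
  x : s'.x = s.x
  q : s'.q = s.q
  kx : s'.kx = s.kx
  t : s'.t = s.t
  tl : s'.tl = s.tl
  nm : s'.nm = s.nm
  rm : s'.rm = s.rm

theorem LocFrame.refl (s : St) : LocFrame s s := by constructor <;> rfl

theorem LocFrame.trans {s s' s'' : St} (h : LocFrame s s') (h' : LocFrame s' s'') :
    LocFrame s s'' where
  n := h'.n.trans h.n
  N := h'.N.trans h.N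
  pb := h'.pb.trans h.pb
  rb := h'.rb.trans h.rb
  wb := h'.wb.trans h.wb
  x := h'.x.trans h.x
  q := h'.q.trans h.q
  kx := h'.kx.trans h.kx
  t := h'.t.trans h.t
  tl := h'.tl.trans h.tl
  nm := h'.nm.trans h.nm
  rm := h'.rm.trans h.rm

variable {o : Point} {σ₀ : Cell} {n : ℕ} {d : Fin n → Disk} {l : List Point}

theorem HasTables.of_frame {s s' : St} (h : HasTables o σ₀ d l s) (hf : LocFrame s s') :
    HasTables o σ₀ d l s' where
  n_eq := hf.n.trans h.n_eq
  input := hf.rm ▸ h.input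
  N_eq := hf.N.trans h.N_eq
  rep u := by rw [hf.nm, hf.rb]; exact h.rep u
  pos a := by rw [hf.nm, hf.pb]; exact h.pos a
  pow i := by rw [hf.nm, hf.wb]; exact h.pow i
  t_eq := hf.t.trans h.t_eq
  tl_eq := by rw [hf.tl, hf.t, h.tl_eq]

theorem HasTables.ptX {s : St} (h : HasTables o σ₀ d l s) {u : ℕ} (h1 : 1 ≤ u)
    (h2 : u ≤ l.length) : ptX s u = (pnt l u).1 - o.1 := by
  obtain ⟨h3, h4⟩ := h.rep u h1 h2
  rw [_root_.ptX, h.input.relX _ h3, h4]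

theorem HasTables.ptY {s : St} (h : HasTables o σ₀ d l s) {u : ℕ} (h1 : 1 ≤ u)
    (h2 : u ≤ l.length) : ptY s u = (pnt l u).2 - o.2 := by
  obtain ⟨h3, h4⟩ := h.rep u h1 h2
  rw [_root_.ptY, h.input.relY _ h3, h4]

/-- The numbers describe the cell `σ`, relative to the center of the grid. -/
def IsBox (σ : Cell) (X Y S : ℝ) : Prop := X = (σ.corner 0).1 ∧ Y = (σ.corner 0).2 ∧ S = σ.side

theorem IsBox.inBox_pt {s : St} {σ : Cell} {X Y S : ℝ} (h : IsBox σ X Y S)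
    (hs : HasTables o σ₀ d l s) {u : ℕ} (h1 : 1 ≤ u) (h2 : u ≤ l.length) :
    InBox X Y S (ptX s u) (ptY s u) ↔ pnt l u ∈ σ.toSet o := by
  rw [h.1, h.2.1, h.2.2, hs.ptX h1 h2, hs.ptY h1 h2, Cell.inBox_iff]

theorem IsBox.inBox_center {s : St} {σ : Cell} {X Y S : ℝ} (h : IsBox σ X Y S)
    (hs : HasTables o σ₀ d l s) {a : ℕ} (ha : a < n) :
    InBox X Y S (relX s.rm a) (relY s.rm a) ↔ (dk d a).center ∈ σ.toSet o := by
  rw [h.1, h.2.1, h.2.2, hs.input.relX a ha, hs.input.relY a ha, Cell.inBox_iff]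

/-! ## One step of the search -/

/-- Compute the smallest cell containing the points at the positions `u` and `v`. -/
def lccOp : Op := .block [
  .tX fun s => (smallestCellOp (ptX s s.u, ptY s s.u) (ptX s s.v, ptY s s.v)).1,
  .tY fun s => (smallestCellOp (ptX s s.u, ptY s s.u) (ptX s s.v, ptY s s.v)).2.1,
  .tS fun s => (smallestCellOp (ptX s s.u, ptY s s.u) (ptX s s.v, ptY s s.v)).2.2]

/-- Move to the quadrant containing the center of the disk `x`. -/
def quadOp : Op := .block [
  .ite (fun s => relX s.rm s.x < s.tX + s.tS / 2) (.bX fun s => s.tX) (.bX fun s => s.tX + s.tS / 2),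
  .ite (fun s => relY s.rm s.x < s.tY + s.tS / 2) (.bY fun s => s.tY) (.bY fun s => s.tY + s.tS / 2),
  .bS fun s => s.tS / 2]

/-- Insert the point at position `z` into the state of the search. -/
def insOp : Op :=
  .ite (fun s => (1 ≤ s.z ∧ s.z ≤ s.N) ∧ InBox s.bX s.bY s.bS (ptX s s.z) (ptY s s.z))
    (.ite (fun s => s.f = 0) (.block [.f fun s => s.z, .g fun s => s.z])
      (.ite (fun s => s.f ≤ s.z ∧ s.z ≤ s.g) (.block [])
        (.block [
          .ite (fun s => s.f < s.z) (.u fun s => s.f) (.u fun s => s.z),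
          .ite (fun s => s.g < s.z) (.v fun s => s.z) (.v fun s => s.g),
          lccOp,
          .ite (fun s => InBox s.tX s.tY s.tS (relX s.rm s.x) (relY s.rm s.x))
            (.block [quadOp,
              .ite (fun s => InBox s.bX s.bY s.bS (ptX s s.z) (ptY s s.z))
                (.block [.f fun s => s.z, .g fun s => s.z])
                (.ite (fun s => InBox s.bX s.bY s.bS (ptX s s.f) (ptY s s.f)) (.block [])
                  (.block [.f fun _ => 0, .g fun _ => 0]))])
            (.block [.f fun s => s.u, .g fun s => s.v])])))
    (.block [])

/-- The registers describe the state `st` of the search. -/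
structure PathRep (s : St) (st : PathState) : Prop where
  f : s.f = st.f
  g : s.g = st.g
  box : IsBox st.cell s.bX s.bY s.bS

/-- The registers that stay fixed under an insertion. -/
structure InsFrame (s s' : St) : Prop extends LocFrame s s' where
  i : s'.i = s.i
  j : s'.j = s.j
  m : s'.m = s.m
  w : s'.w = s.w
  c : s'.c = s.c
  lev : s'.lev = s.lev

theorem lccOp_spec {s : St} (hl : l.Pairwise (ZLt o)) (hs : HasTables o σ₀ d l s) {σ : Cell}
    (hu : PosIn o l σ s.u) (hv : PosIn o l σ s.v) (huv : s.u < s.v) :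
    InsFrame s (lccOp.fn s) ∧ (lccOp.fn s).f = s.f ∧ (lccOp.fn s).g = s.g ∧
    (lccOp.fn s).z = s.z ∧ (lccOp.fn s).u = s.u ∧ (lccOp.fn s).v = s.v ∧
    (lccOp.fn s).bX = s.bX ∧ (lccOp.fn s).bY = s.bY ∧ (lccOp.fn s).bS = s.bS ∧
    IsBox (lcc o (pnt l s.u) (pnt l s.v)) (lccOp.fn s).tX (lccOp.fn s).tY (lccOp.fn s).tS := by
  refine ⟨⟨by constructor <;> rfl, rfl, rfl, rfl, rfl, rfl, rfl⟩, rfl, rfl, rfl, rfl, rfl, rfl, rfl,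
    rfl, ?_⟩
  have h := smallestCellOp_sub (isSmallestCell_lcc_pnt hl hu hv huv)
  have hx := hs.ptX hu.1 hu.2.1
  have hy := hs.ptY hu.1 hu.2.1
  have hx' := hs.ptX hv.1 hv.2.1
  have hy' := hs.ptY hv.1 hv.2.1
  have he : smallestCellOp (ptX s s.u, ptY s s.u) (ptX s s.v, ptY s s.v) =
      (((lcc o (pnt l s.u) (pnt l s.v)).corner 0).1, ((lcc o (pnt l s.u) (pnt l s.v)).corner 0).2,
        (lcc o (pnt l s.u) (pnt l s.v)).side) := by
    rw [hx, hy, hx', hy']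
    exact h
  change IsBox _ (smallestCellOp (ptX s s.u, ptY s s.u) (ptX s s.v, ptY s s.v)).1
    (smallestCellOp (ptX s s.u, ptY s s.u) (ptX s s.v, ptY s s.v)).2.1
    (smallestCellOp (ptX s s.u, ptY s s.u) (ptX s s.v, ptY s s.v)).2.2
  rw [he]
  exact ⟨rfl, rfl, rfl⟩

theorem quadOp_spec {s : St} (hs : HasTables o σ₀ d l s) (hx : s.x < n) {τ : Cell}
    (hτ : IsBox τ s.tX s.tY s.tS) (hp : (dk d s.x).center ∈ τ.toSet o) :
    InsFrame s (quadOp.fn s) ∧ (quadOp.fn s).f = s.f ∧ (quadOp.fn s).g = s.g ∧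
    (quadOp.fn s).z = s.z ∧
    IsBox (quadOf o τ (dk d s.x).center) (quadOp.fn s).bX (quadOp.fn s).bY (quadOp.fn s).bS := by
  obtain ⟨h1, h2, h3⟩ := quadOf_box hp
  rw [← hτ.1, ← hτ.2.1, ← hτ.2.2] at *
  rw [← hs.input.relX _ hx] at h1
  rw [← hs.input.relY _ hx] at h2
  simp only [quadOp, Op.block_cons, Op.block_nil, Op.ite_fn]
  by_cases c1 : relX s.rm s.x < s.tX + s.tS / 2 <;>
    by_cases c2 : relY s.rm s.x < s.tY + s.tS / 2 <;>
    simp only [c1, c2, if_true, if_false] at h1 h2 ⊢ <;>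
    simp only [Op.bX, Op.bY, Op.bS, c2, if_true, if_false] <;>
    exact ⟨⟨by constructor <;> rfl, rfl, rfl, rfl, rfl, rfl, rfl⟩, trivial, trivial, trivial,
      h1.symm, h2.symm, h3.symm⟩

theorem insOp_spec {s : St} (hl : l.Pairwise (ZLt o)) (hs : HasTables o σ₀ d l s) (hx : s.x < n)
    {U : Set ℕ} {st : PathState} (hst : PathRep s st)
    (hv : st.Valid o l σ₀ (dk d s.x).center U) :
    InsFrame s (insOp.fn s) ∧ PathRep (insOp.fn s) (st.ins o l (dk d s.x).center s.z) := by
  set p := (dk d s.x).center with hp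
  have hrefl : InsFrame s s := ⟨.refl s, rfl, rfl, rfl, rfl, rfl, rfl⟩
  unfold PathState.ins
  simp only [insOp, Op.ite_fn]
  by_cases hz : 1 ≤ s.z ∧ s.z ≤ l.length ∧ pnt l s.z ∈ st.cell.toSet o
  swap
  · rw [if_neg hz, if_neg]
    · exact ⟨hrefl, hst⟩
    · rintro ⟨⟨h1, h2⟩, h3⟩
      rw [hs.N_eq] at h2
      exact hz ⟨h1, h2, (hst.box.inBox_pt hs h1 h2).1 h3⟩
  rw [if_pos hz, if_pos ⟨⟨hz.1, hs.N_eq.symm ▸ hz.2.1⟩, (hst.box.inBox_pt hs hz.1 hz.2.1).2 hz.2.2⟩]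
  by_cases hf0 : st.f = 0
  · rw [if_pos hf0, if_pos (hst.f.trans hf0)]
    exact ⟨⟨by constructor <;> rfl, rfl, rfl, rfl, rfl, rfl, rfl⟩, rfl, rfl, hst.box⟩
  rw [if_neg hf0, if_neg (by rwa [hst.f])]
  by_cases hb : st.f ≤ s.z ∧ s.z ≤ st.g
  · rw [if_pos hb, if_pos (by rwa [hst.f, hst.g])]
    exact ⟨hrefl, hst⟩
  rw [if_neg hb, if_neg (by rwa [hst.f, hst.g])]
  simp only [Op.block_cons]
  set s₁ := (Op.ite (fun s => s.f < s.z) (Op.u fun s => s.f) (Op.u fun s => s.z)).fn s with hs₁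
  set s₂ := (Op.ite (fun s => s.g < s.z) (Op.v fun s => s.z) (Op.v fun s => s.g)).fn s₁ with hs₂
  have ef := hst.f
  have eg := hst.g
  have e₁ : s₁ = { s with u := min st.f s.z } := by
    rw [hs₁, Op.ite_fn]
    split_ifs with h <;> simp only [Op.u]
    · rw [ef, min_eq_left (by omega)]
    · rw [min_eq_right (by omega)]
  have e₂ : s₂ = { s with u := min st.f s.z, v := max st.g s.z } := by
    rw [hs₂, Op.ite_fn]
    split_ifs with h <;> simp only [Op.v]
    · rw [e₁] at h ⊢
      simp only at h ⊢
      rw [max_eq_right (by omega)]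
    · rw [e₁] at h ⊢
      simp only at h ⊢
      rw [max_eq_left (by omega), hst.g]
  have f₂ : InsFrame s s₂ := by
    rw [e₂]
    exact ⟨by constructor <;> rfl, rfl, rfl, rfl, rfl, rfl, rfl⟩
  have t₂ := hs.of_frame f₂.toLocFrame
  obtain ⟨hfU, hgU, hf, hg, hfg⟩ := hv.ends.resolve_left fun h1 => hf0 h1.1
  have hfI := hv.posIn hfU hf
  have hgI := hv.posIn hgU hg
  have hf'I : PosIn o l st.cell (min st.f s.z) := by
    rcases min_choice st.f s.z with e | e <;> rw [e]
    exacts [hfI, hz]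
  have hg'I : PosIn o l st.cell (max st.g s.z) := by
    rcases max_choice st.g s.z with e | e <;> rw [e]
    exacts [hgI, hz]
  have hu₂ : s₂.u = min st.f s.z := by rw [e₂]
  have hv₂ : s₂.v = max st.g s.z := by rw [e₂]
  obtain ⟨f₃, r1, r2, r3, r4, r5, r6, r7, r8, r9⟩ := lccOp_spec hl t₂ (hu₂ ▸ hf'I) (hv₂ ▸ hg'I)
    (by rw [hu₂, hv₂]; omega)
  rw [hu₂, hv₂] at r9
  set s₃ := lccOp.fn s₂ with hs₃
  set τ := lcc o (pnt l (min st.f s.z)) (pnt l (max st.g s.z))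
  have t₃ := t₂.of_frame f₃.toLocFrame
  have hx₃ : s₃.x = s.x := f₃.x.trans f₂.x
  have tr : ∀ {s'}, InsFrame s₃ s' → InsFrame s s' := fun h =>
    ⟨f₂.toLocFrame.trans (f₃.toLocFrame.trans h.toLocFrame), h.i.trans (f₃.i.trans f₂.i),
      h.j.trans (f₃.j.trans f₂.j), h.m.trans (f₃.m.trans f₂.m), h.w.trans (f₃.w.trans f₂.w),
      h.c.trans (f₃.c.trans f₂.c), h.lev.trans (f₃.lev.trans f₂.lev)⟩
  have hz₃ : s₃.z = s.z := by rw [r3, e₂]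
  have hf₃ : s₃.f = st.f := by rw [r1, e₂]; exact hst.f
  have hg₃ : s₃.g = st.g := by rw [r2, e₂]; exact hst.g
  simp only [Op.ite_fn, Op.block_nil]
  by_cases hpτ : p ∈ τ.toSet o
  swap
  · rw [if_neg hpτ, if_neg (by rwa [r9.inBox_center t₃ (hx₃.symm ▸ hx), hx₃])]
    refine ⟨tr ⟨by constructor <;> rfl, rfl, rfl, rfl, rfl, rfl, rfl⟩, ?_, ?_, ?_⟩
    · exact r4.trans hu₂
    · exact r5.trans hv₂
    · have e := hst.box
      refine ⟨?_, ?_, ?_⟩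
      · exact r6.trans (by rw [e₂]; exact e.1)
      · exact r7.trans (by rw [e₂]; exact e.2.1)
      · exact r8.trans (by rw [e₂]; exact e.2.2)
  rw [if_pos hpτ, if_pos (by rwa [r9.inBox_center t₃ (hx₃.symm ▸ hx), hx₃])]
  simp only [Op.block_cons, Op.ite_fn, Op.block_nil]
  obtain ⟨f₄, q1, q2, q3, q4⟩ := quadOp_spec t₃ (hx₃.symm ▸ hx) r9 (hx₃.symm ▸ hpτ)
  rw [hx₃, ← hp] at q4
  set s₄ := quadOp.fn s₃ with hs₄
  have t₄ := t₃.of_frame f₄.toLocFrame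
  have hz₄ : s₄.z = s.z := q3.trans hz₃
  have hf₄ : s₄.f = st.f := q1.trans hf₃
  by_cases hzσ : pnt l s.z ∈ (quadOf o τ p).toSet o
  · rw [if_pos hzσ, if_pos (by rwa [hz₄, q4.inBox_pt t₄ hz.1 hz.2.1])]
    exact ⟨tr ⟨⟨f₄.1.1, f₄.1.2, f₄.1.3, f₄.1.4, f₄.1.5, f₄.1.6, f₄.1.7, f₄.1.8, f₄.1.9, f₄.1.10,
      f₄.1.11, f₄.1.12⟩, f₄.i, f₄.j, f₄.m, f₄.w, f₄.c, f₄.lev⟩, hz₄, hz₄, q4⟩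
  rw [if_neg hzσ, if_neg (by rwa [hz₄, q4.inBox_pt t₄ hz.1 hz.2.1])]
  by_cases hfσ : pnt l st.f ∈ (quadOf o τ p).toSet o
  · rw [if_pos hfσ, if_pos (by rwa [hf₄, q4.inBox_pt t₄ hfI.1 hfI.2.1])]
    exact ⟨tr f₄, hf₄, q2.trans hg₃, q4⟩
  · rw [if_neg hfσ, if_neg (by rwa [hf₄, q4.inBox_pt t₄ hfI.1 hfI.2.1])]
    exact ⟨tr ⟨⟨f₄.1.1, f₄.1.2, f₄.1.3, f₄.1.4, f₄.1.5, f₄.1.6, f₄.1.7, f₄.1.8, f₄.1.9, f₄.1.10,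
      f₄.1.11, f₄.1.12⟩, f₄.i, f₄.j, f₄.m, f₄.w, f₄.c, f₄.lev⟩, rfl, rfl, q4⟩

end

/-! ### The program: locating, labelling and numbering the disks -/

noncomputable section

/-! ## Locating a disk -/

/-- The disk `x` lies in the current cell. -/
def InsideCell (s : St) : Prop :=
  DiskInside s.bX s.bY s.bS (relX s.rm s.x) (relY s.rm s.x) (rad s.rm s.x)

/-- The disk `x` meets the current hole. -/
def MeetsHole (s : St) : Prop :=
  DiskMeets s.tX s.tY s.tS (relX s.rm s.x) (relY s.rm s.x) (rad s.rm s.x)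

@[fun_prop]
theorem BC.insideCell : BC InsideCell := by
  unfold InsideCell
  fun_prop

@[fun_prop]
theorem BC.meetsHole : BC MeetsHole := by
  unfold MeetsHole
  fun_prop

/-- Go down one level. -/
def descendOp : Op := .block [
  .block [.i fun s => s.i - 1, .lev fun s => s.lev - 1, .w fun s => s.nm (s.wb + s.i),
    .j fun s => s.g + s.w, .m fun s => s.c + s.w, .z fun s => s.f - s.w],
  insOp, .z fun s => s.j, insOp, .z fun s => s.m, insOp,
  .ite (fun s => s.c + s.w ≤ s.q) (.c fun s => s.c + s.w) (.block [])]

/-- Compute the hole, and test whether the disk `x` lies in the current region. -/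
def testOp : Op :=
  .ite (fun s => s.f < s.g)
    (.block [.u fun s => s.f, .v fun s => s.g, lccOp,
      .ite (fun s => InsideCell s ∧ ¬ MeetsHole s) (.fl fun _ => 0) (.fl fun _ => 1)])
    (.ite (fun s => InsideCell s) (.fl fun _ => 0) (.fl fun _ => 1))

variable {o : Point} {σ₀ : Cell} {n : ℕ} {d : Fin n → Disk} {l : List Point}

/-- The search for the node of the disk `x` has reached the level `s.i`, with the state `st`. -/
structure Searching (o : Point) (σ₀ : Cell) {n : ℕ} (d : Fin n → Disk) (l : List Point) (s : St)
    (st : PathState) : Prop where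
  tables : HasTables o σ₀ d l s
  x_lt : s.x < n
  q_eq : s.q = s.nm (s.pb + s.x)
  rep : PathRep s st
  valid : st.Valid o l σ₀ (dk d s.x).center (mults l (2 ^ s.i))
  i_le : s.i ≤ Nat.log 2 l.length + 1
  lev_eq : s.lev = s.i
  c_dvd : 2 ^ s.i ∣ s.c
  c_le : s.c ≤ s.q
  lt_c : s.q < s.c + 2 ^ s.i

theorem InsFrame.trans {s s' s'' : St} (h : InsFrame s s') (h' : InsFrame s' s'') :
    InsFrame s s'' :=
  ⟨h.toLocFrame.trans h'.toLocFrame, h'.i.trans h.i, h'.j.trans h.j, h'.m.trans h.m,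
    h'.w.trans h.w, h'.c.trans h.c, h'.lev.trans h.lev⟩

theorem InsFrame.setZ (s : St) (z : ℕ) : InsFrame s { s with z := z } :=
  ⟨by constructor <;> rfl, rfl, rfl, rfl, rfl, rfl, rfl⟩

theorem PathRep.setZ {s : St} {st : PathState} (h : PathRep s st) (z : ℕ) :
    PathRep { s with z := z } st := ⟨h.f, h.g, h.box⟩

/-- The three candidates are computed before the first insertion, since insertions overwrite `f` and
`g`. Afterwards `c` is raised by the new width if possible, so that it stays the largest multiple of
`2 ^ i` not exceeding the position `q` of the center. -/
theorem Searching.descend {s : St} {st : PathState} (hl : l.Pairwise (ZLt o))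
    (h : Searching o σ₀ d l s st) (hi : 0 < s.i) : LocFrame s (descendOp.fn s) ∧
    (descendOp.fn s).i = s.i - 1 ∧ ∃ st', Searching o σ₀ d l (descendOp.fn s) st' := by
  obtain ⟨i, hi'⟩ : ∃ i, s.i = i + 1 := ⟨s.i - 1, by omega⟩
  have hiN : i ≤ Nat.log 2 l.length := by have := h.i_le; omega
  have hw : s.nm (s.wb + (s.i - 1)) = 2 ^ i := by
    rw [hi', Nat.add_sub_cancel]
    exact h.tables.pow i hiN
  have hpos := h.tables.pos s.x h.x_lt
  rw [← h.q_eq] at hpos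
  simp only [descendOp, Op.block_cons, Op.block_nil]
  set s₀ := (Op.z fun s => s.f - s.w).fn _ with hs₀
  have e₀ : s₀ = { s with
      i := s.i - 1, lev := s.lev - 1, w := s.nm (s.wb + (s.i - 1)),
      j := s.g + s.nm (s.wb + (s.i - 1)), m := s.c + s.nm (s.wb + (s.i - 1)),
      z := s.f - s.nm (s.wb + (s.i - 1)) } := rfl
  rw [hw] at e₀
  have f₀ : LocFrame s s₀ := by
    rw [e₀]
    constructor <;> rfl
  have t₀ := h.tables.of_frame f₀
  have x₀ : s₀.x < n := f₀.x ▸ h.x_lt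
  have p₀ : PathRep s₀ st := by
    rw [e₀]
    exact ⟨h.rep.f, h.rep.g, h.rep.box⟩
  have hv := h.valid
  rw [← f₀.x] at hv
  set p := (dk d s₀.x).center with hp
  obtain ⟨f₁, p₁⟩ := insOp_spec hl t₀ x₀ p₀ hv
  obtain ⟨v₁, -⟩ := hv.ins hl s₀.z
  set s₁ := insOp.fn s₀ with hs₁
  have g₁ := f₁.trans (.setZ s₁ s₁.j)
  have t₁ := t₀.of_frame g₁.toLocFrame
  have x₁ : s₁.x = s₀.x := f₁.x
  obtain ⟨f₂, p₂⟩ := insOp_spec hl t₁ (g₁.x ▸ x₀) (p₁.setZ s₁.j) (by rw [g₁.x]; exact v₁)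
  obtain ⟨v₂, -⟩ := v₁.ins hl s₁.j
  change InsFrame _ (insOp.fn ((Op.z fun s => s.j).fn s₁)) at f₂
  change PathRep (insOp.fn ((Op.z fun s => s.j).fn s₁)) _ at p₂
  rw [g₁.x] at p₂
  set s₂ := insOp.fn ((Op.z fun s => s.j).fn s₁) with hs₂
  have g₂ := (g₁.trans f₂).trans (.setZ s₂ s₂.m)
  have t₂ := t₀.of_frame g₂.toLocFrame
  obtain ⟨f₃, p₃⟩ := insOp_spec hl t₂ (g₂.x ▸ x₀) (p₂.setZ s₂.m) (by rw [g₂.x]; exact v₂)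
  change InsFrame _ (insOp.fn ((Op.z fun s => s.m).fn s₂)) at f₃
  change PathRep (insOp.fn ((Op.z fun s => s.m).fn s₂)) _ at p₃
  rw [g₂.x] at p₃
  set s₃ := insOp.fn ((Op.z fun s => s.m).fn s₂) with hs₃
  have g₃ := g₂.trans f₃
  have hz₀ : s₀.z = st.f - 2 ^ i := by rw [e₀, ← h.rep.f]
  have hj₁ : s₁.j = st.g + 2 ^ i := by rw [f₁.j, e₀, ← h.rep.g]
  have hm₂ : s₂.m = s.c + 2 ^ i := by rw [f₂.m, g₁.m, e₀]
  have hnext : PathRep s₃ (st.next o l p (2 ^ i) s.c) := by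
    have := p₃
    simp only [hz₀, hj₁, hm₂] at this
    exact this
  have hv₃ : (st.next o l p (2 ^ i) s.c).Valid o l σ₀ p (mults l (2 ^ i)) := by
    rw [hi', pow_succ, mul_comm] at hv
    have h1 := h.c_dvd
    have h2 := h.lt_c
    rw [hi', pow_succ, mul_comm] at h1 h2
    refine hv.next hl hpos.1 ?_ h1 h.c_le h2
    rw [hpos.2, hp, f₀.x]
  have hs₃i : s₃.i = i := by rw [g₃.i, e₀]; simp only; omega
  have hs₃w : s₃.w = 2 ^ i := by rw [g₃.w, e₀]
  have hs₃c : s₃.c = s.c := by rw [g₃.c, e₀]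
  have hs₃q : s₃.q = s.q := g₃.q.trans f₀.q
  have hlev : s₃.lev = (i : ℝ) := by
    rw [g₃.lev, e₀]
    simp only
    rw [h.lev_eq, hi']
    push_cast
    ring
  have hcd : 2 ^ i ∣ s.c := (pow_dvd_pow 2 (by omega)).trans h.c_dvd
  have F := f₀.trans g₃.toLocFrame
  have X : s₃.x = s₀.x := g₃.x
  have hlt := h.lt_c
  rw [hi', pow_succ] at hlt
  have hcle := h.c_le
  have hxq : s₃.q = s₃.nm (s₃.pb + s₃.x) := by
    rw [F.q, F.nm, F.pb, F.x]
    exact h.q_eq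
  rw [Op.ite_fn]
  split_ifs with hc
  · rw [hs₃c, hs₃w, hs₃q] at hc
    refine ⟨⟨F.1, F.2, F.3, F.4, F.5, F.6, F.7, F.8, F.9, F.10, F.11, F.12⟩,
      by rw [hi']; exact hs₃i, st.next o l p (2 ^ i) s.c, ?_⟩
    have hframe : LocFrame s₃ { s₃ with c := s₃.c + s₃.w } := by constructor <;> rfl
    exact {
      tables := (h.tables.of_frame F).of_frame hframe
      x_lt := X ▸ x₀
      q_eq := hxq
      rep := ⟨hnext.f, hnext.g, hnext.box⟩
      valid := by
        change PathState.Valid o l σ₀ (dk d s₃.x).center (mults l (2 ^ s₃.i)) _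
        rw [hs₃i, X]
        exact hv₃
      i_le := by change s₃.i ≤ _; omega
      lev_eq := by change s₃.lev = (s₃.i : ℝ); rw [hs₃i, hlev]
      c_dvd := by
        change 2 ^ s₃.i ∣ s₃.c + s₃.w
        rw [hs₃i, hs₃c, hs₃w]
        exact dvd_add hcd dvd_rfl
      c_le := by change s₃.c + s₃.w ≤ s₃.q; rw [hs₃c, hs₃w, hs₃q]; exact hc
      lt_c := by
        change s₃.q < s₃.c + s₃.w + 2 ^ s₃.i
        rw [hs₃c, hs₃w, hs₃q, hs₃i]
        omega }
  · rw [hs₃c, hs₃w, hs₃q] at hc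
    refine ⟨F, by rw [hi']; exact hs₃i, st.next o l p (2 ^ i) s.c, ?_⟩
    exact {
      tables := h.tables.of_frame F
      x_lt := X ▸ x₀
      q_eq := hxq
      rep := hnext
      valid := by
        change PathState.Valid o l σ₀ (dk d s₃.x).center (mults l (2 ^ s₃.i)) _
        rw [hs₃i, X]
        exact hv₃
      i_le := by change s₃.i ≤ _; omega
      lev_eq := by change s₃.lev = (s₃.i : ℝ); rw [hs₃i, hlev]
      c_dvd := by
        change 2 ^ s₃.i ∣ s₃.c
        rw [hs₃i, hs₃c]
        exact hcd
      c_le := by change s₃.c ≤ s₃.q; rw [hs₃c, hs₃q]; exact hcle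
      lt_c := by
        change s₃.q < s₃.c + 2 ^ s₃.i
        rw [hs₃c, hs₃q, hs₃i]
        omega }

theorem Searching.congr {s s' : St} {st : PathState} (h : Searching o σ₀ d l s st)
    (hf : InsFrame s s') (e1 : s'.f = s.f) (e2 : s'.g = s.g) (e3 : s'.bX = s.bX)
    (e4 : s'.bY = s.bY) (e5 : s'.bS = s.bS) : Searching o σ₀ d l s' st where
  tables := h.tables.of_frame hf.toLocFrame
  x_lt := hf.x ▸ h.x_lt
  q_eq := by rw [hf.q, hf.nm, hf.pb, hf.x]; exact h.q_eq
  rep := ⟨e1.trans h.rep.f, e2.trans h.rep.g, by rw [e3, e4, e5]; exact h.rep.box⟩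
  valid := by rw [hf.x, hf.i]; exact h.valid
  i_le := hf.i ▸ h.i_le
  lev_eq := by rw [hf.lev, hf.i]; exact h.lev_eq
  c_dvd := by rw [hf.i, hf.c]; exact h.c_dvd
  c_le := by rw [hf.q, hf.c]; exact h.c_le
  lt_c := by rw [hf.q, hf.c, hf.i]; exact h.lt_c

theorem Searching.insideCell_iff {s : St} {st : PathState} (h : Searching o σ₀ d l s st) :
    InsideCell s ↔ (dk d s.x).toSet ⊆ st.cell.toSet o := by
  obtain ⟨b1, b2, b3⟩ := h.rep.box
  rw [InsideCell, b1, b2, b3, h.tables.input.relX _ h.x_lt, h.tables.input.relY _ h.x_lt,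
    h.tables.input.rad _ h.x_lt, diskInside_iff]

theorem meetsHole_iff {s : St} {τ : Cell} (h : IsInput o σ₀ d s.rm) (hx : s.x < n)
    (hτ : IsBox τ s.tX s.tY s.tS) :
    MeetsHole s ↔ ((dk d s.x).toSet ∩ τ.toSet o).Nonempty := by
  obtain ⟨b1, b2, b3⟩ := hτ
  rw [MeetsHole, b1, b2, b3, h.relX _ hx, h.relY _ hx, h.rad _ hx, diskMeets_iff]

/-- The search has reached a node and examined its region. -/
structure Examined (o : Point) (σ₀ : Cell) {n : ℕ} (d : Fin n → Disk) (l : List Point) (s : St)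
    (st : PathState) : Prop extends Searching o σ₀ d l s st where
  fl_eq : s.fl = 0 ↔ (dk d s.x).toSet ⊆ (st.region o l).toSet o
  hole : st.f < st.g → IsBox (lcc o (pnt l st.f) (pnt l st.g)) s.tX s.tY s.tS

theorem Searching.test {s : St} {st : PathState} (hl : l.Pairwise (ZLt o))
    (h : Searching o σ₀ d l s st) : LocFrame s (testOp.fn s) ∧ (testOp.fn s).i = s.i ∧
    Examined o σ₀ d l (testOp.fn s) st := by
  simp only [testOp, Op.ite_fn]
  by_cases hfg : st.f < st.g
  · rw [if_pos (by rwa [h.rep.f, h.rep.g])]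
    simp only [Op.block_cons, Op.block_nil]
    set s₁ := (Op.v fun s => s.g).fn ((Op.u fun s => s.f).fn s) with hs₁
    have e₁ : s₁ = { s with u := s.f, v := s.g } := rfl
    have f₁ : InsFrame s s₁ := by
      rw [e₁]
      exact ⟨by constructor <;> rfl, rfl, rfl, rfl, rfl, rfl, rfl⟩
    have h₁ : Searching o σ₀ d l s₁ st := h.congr f₁ rfl rfl rfl rfl rfl
    obtain ⟨hfU, hgU, hf, hg, -⟩ := h.valid.ends.resolve_left fun h1 => by omega
    have hu : s₁.u = st.f := h.rep.f
    have hv : s₁.v = st.g := h.rep.g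
    obtain ⟨f₂, r1, r2, r3, r4, r5, r6, r7, r8, r9⟩ := lccOp_spec hl h₁.tables
      (hu ▸ h.valid.posIn hfU hf) (hv ▸ h.valid.posIn hgU hg) (by rwa [hu, hv])
    rw [hu, hv] at r9
    set s₂ := lccOp.fn s₁ with hs₂
    have h₂ := h₁.congr f₂ r1 r2 r6 r7 r8
    have hfr := f₁.trans f₂
    have hreg : st.region o l = .donut st.cell (lcc o (pnt l st.f) (pnt l st.g)) := by
      rw [PathState.region, if_pos hfg]
    have hiff : (InsideCell s₂ ∧ ¬ MeetsHole s₂) ↔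
        (dk d s₂.x).toSet ⊆ (st.region o l).toSet o := by
      rw [hreg, h₂.insideCell_iff, meetsHole_iff h₂.tables.input h₂.x_lt r9, Region.toSet,
        Set.subset_sdiff, Set.not_nonempty_iff_eq_empty, Set.disjoint_iff_inter_eq_empty]
    rw [Op.ite_fn]
    have key : ∀ v : ℕ, (v = 0 ↔ (InsideCell s₂ ∧ ¬ MeetsHole s₂)) →
        LocFrame s { s₂ with fl := v } ∧ s₂.i = s.i ∧ Examined o σ₀ d l { s₂ with fl := v } st := by
      intro v hv
      refine ⟨?_, hfr.i, ?_, ?_, ?_⟩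
      · exact ⟨hfr.1.1, hfr.1.2, hfr.1.3, hfr.1.4, hfr.1.5, hfr.1.6, hfr.1.7, hfr.1.8, hfr.1.9,
          hfr.1.10, hfr.1.11, hfr.1.12⟩
      · exact h₂.congr ⟨by constructor <;> rfl, rfl, rfl, rfl, rfl, rfl, rfl⟩ rfl rfl rfl rfl rfl
      · exact hv.trans hiff
      · exact fun _ => r9
    split_ifs with hc
    · exact key 0 (by simp [hc])
    · exact key 1 (by simp [hc])
  · rw [if_neg (by rwa [h.rep.f, h.rep.g])]
    have hreg : st.region o l = .cell st.cell := by
      rw [PathState.region, if_neg hfg]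
    have key : ∀ v : ℕ, (v = 0 ↔ InsideCell s) →
        LocFrame s { s with fl := v } ∧ s.i = s.i ∧ Examined o σ₀ d l { s with fl := v } st := by
      intro v hv
      refine ⟨by constructor <;> rfl, rfl, ?_, ?_, fun h => absurd h hfg⟩
      · exact h.congr ⟨by constructor <;> rfl, rfl, rfl, rfl, rfl, rfl, rfl⟩ rfl rfl rfl rfl rfl
      · rw [hreg]
        exact hv.trans h.insideCell_iff
    split_ifs with hc
    · exact key 0 (by simp [hc])
    · exact key 1 (by simp [hc])

/-- Start the search for the disk `x`. -/
def startOp : Op := .block [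
  .q fun s => s.nm (s.pb + s.x), .i fun s => s.t, .lev fun s => s.tl, .c fun _ => 0,
  .f fun _ => 0, .g fun _ => 0, .fl fun _ => 0,
  .bX fun s => s.rm 2 - s.rm 0, .bY fun s => s.rm 3 - s.rm 1, .bS fun s => s.rm 4]

/-- Search the node of the disk `x`. -/
def locateCmd : Cmd := .seq (.op startOp)
  (.loop (fun s => 0 < s.i ∧ s.fl = 0) (by fun_prop) (.op (.block [descendOp, testOp])))

/-- The registers and the memory that stay fixed while a disk is located, except `q`. -/
structure DiskFrame (s s' : St) : Prop where
  n : s'.n = s.n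
  N : s'.N = s.N
  pb : s'.pb = s.pb
  rb : s'.rb = s.rb
  wb : s'.wb = s.wb
  x : s'.x = s.x
  kx : s'.kx = s.kx
  t : s'.t = s.t
  tl : s'.tl = s.tl
  nm : s'.nm = s.nm
  rm : s'.rm = s.rm

/-- The disk has been located. -/
structure Located (o : Point) (σ₀ : Cell) {n : ℕ} (d : Fin n → Disk) (l : List Point) (s : St)
    (st : PathState) : Prop extends Examined o σ₀ d l s st where
  assigned : IsAssigned o σ₀ l (dk d s.x) s.i (st.region o l)

theorem startOp_spec {s : St} (hs : HasTables o σ₀ d l s) (hx : s.x < n)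
    (hc : (dk d s.x).center ∈ σ₀.toSet o) : DiskFrame s (startOp.fn s) ∧
    (startOp.fn s).i = Nat.log 2 l.length + 1 ∧ (startOp.fn s).fl = 0 ∧
    Searching o σ₀ d l (startOp.fn s) ⟨σ₀, 0, 0⟩ := by
  have hpos := hs.pos s.x hx
  have e : startOp.fn s = { s with
      q := s.nm (s.pb + s.x), i := s.t, lev := s.tl, c := 0, f := 0, g := 0, fl := 0,
      bX := s.rm 2 - s.rm 0, bY := s.rm 3 - s.rm 1, bS := s.rm 4 } := by
    simp only [startOp, Op.block_cons, Op.block_nil, Op.q, Op.i, Op.lev, Op.c, Op.f, Op.g, Op.fl,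
      Op.bX, Op.bY, Op.bS]
  rw [e]
  refine ⟨by constructor <;> rfl, hs.t_eq, rfl,
    ⟨⟨hs.n_eq, hs.input, hs.N_eq, hs.rep, hs.pos, hs.pow, hs.t_eq, hs.tl_eq⟩, hx, rfl,
    ⟨rfl, rfl, hs.input.boxX, hs.input.boxY, hs.input.boxS⟩, ?_, hs.t_eq.le, hs.tl_eq, dvd_zero _,
    Nat.zero_le _, ?_⟩⟩
  · change PathState.Valid o l σ₀ _ (mults l (2 ^ s.t)) _
    rw [hs.t_eq]
    exact PathState.valid_init hc
  · change s.nm (s.pb + s.x) < 0 + 2 ^ s.t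
    have := Nat.lt_pow_succ_log_self (b := 2) (by norm_num) l.length
    have := hs.t_eq
    rw [this]
    omega

/-- The invariant of the search. -/
structure LocateInv (o : Point) (σ₀ : Cell) {n : ℕ} (d : Fin n → Disk) (l : List Point) (s s' : St)
    : Prop where
  frame : DiskFrame s s'
  search : ∃ st, Searching o σ₀ d l s' st ∧
    (s'.i ≤ Nat.log 2 l.length → Examined o σ₀ d l s' st)
  start : s'.i = Nat.log 2 l.length + 1 → s'.fl = 0
  passed : ∀ i' R', s'.i < i' → IsSkipNode o σ₀ l i' R' → (dk d s.x).center ∈ R'.toSet o →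
    (dk d s.x).toSet ⊆ R'.toSet o

/-- A zero flag certifies that the region just left contains the disk. Uniqueness of the region
around the center extends `passed` by that level. -/
theorem LocateInv.step (hl : l.Pairwise (ZLt o)) (hσ₀ : ∀ p ∈ l, p ∈ σ₀.toSet o) {s s₁ : St}
    (h : LocateInv o σ₀ d l s s₁) (hi0 : 0 < s₁.i) (hfl : s₁.fl = 0) :
    LocateInv o σ₀ d l s (testOp.fn (descendOp.fn s₁)) ∧
      (testOp.fn (descendOp.fn s₁)).i = s₁.i - 1 := by
  obtain ⟨st, hst, hex⟩ := h.search
  obtain ⟨f₂, i₂, st', h₂⟩ := hst.descend hl hi0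
  obtain ⟨f₃, i₃, h₃⟩ := h₂.test hl
  have f₄ := f₂.trans f₃
  have hf := h.frame
  refine ⟨⟨?_, ⟨st', h₃.toSearching, fun _ => h₃⟩, ?_, ?_⟩, by rw [i₃, i₂]⟩
  · exact ⟨f₄.n.trans hf.n, f₄.N.trans hf.N, f₄.pb.trans hf.pb, f₄.rb.trans hf.rb,
      f₄.wb.trans hf.wb, f₄.x.trans hf.x, f₄.kx.trans hf.kx, f₄.t.trans hf.t,
      f₄.tl.trans hf.tl, f₄.nm.trans hf.nm, f₄.rm.trans hf.rm⟩
  · intro h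
    have := hst.i_le
    omega
  · intro i' R' hi' hR' hcR
    rcases Nat.lt_or_ge s₁.i i' with h' | h'
    · exact h.passed i' R' h' hR' hcR
    · obtain rfl : i' = s₁.i := by omega
      have hE := hex hR'.1
      have hL := hE.valid.isLeafRegion hl hσ₀
      rw [hf.x] at hL
      rw [hR'.2.unique (levelPoints_subset hσ₀ _) hL.1 hcR hL.2]
      have := hE.fl_eq.1 hfl
      rwa [hf.x] at this

theorem LocateInv.located (hl : l.Pairwise (ZLt o)) (hσ₀ : ∀ p ∈ l, p ∈ σ₀.toSet o) {s s₁ : St}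
    (h : LocateInv o σ₀ d l s s₁) (hex : ¬ (0 < s₁.i ∧ s₁.fl = 0)) :
    ∃ st, Located o σ₀ d l s₁ st := by
  obtain ⟨st, hst, hE⟩ := h.search
  -- The search starts one level above the top, where no region has been tested; the flag is zero
  -- there, so the loop cannot stop.
  have hile : s₁.i ≤ Nat.log 2 l.length := by
    by_contra hlt
    have := hst.i_le
    have h1 : s₁.i = Nat.log 2 l.length + 1 := by omega
    exact hex ⟨by omega, h.start h1⟩
  have hE := hE hile
  have hL := hE.valid.isLeafRegion hl hσ₀
  refine ⟨st, hE, ⟨hile, hL.1⟩, hL.2, ?_, ?_⟩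
  · by_contra! hcon
    exact hex ⟨by omega, hE.fl_eq.2 hcon.2⟩
  · rw [h.frame.x]
    exact h.passed

theorem locateCmd_runs (hl : l.Pairwise (ZLt o)) (hσ₀ : ∀ p ∈ l, p ∈ σ₀.toSet o) {s : St}
    (hs : HasTables o σ₀ d l s) (hx : s.x < n) (hc : (dk d s.x).center ∈ σ₀.toSet o) :
    locateCmd.Runs s (2 * Nat.log 2 l.length + 4) fun s' => DiskFrame s s' ∧
      ∃ st, Located o σ₀ d l s' st := by
  obtain ⟨h1, h2, h3, h4⟩ := startOp_spec hs hx hc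
  refine Cmd.Runs.mono (.seq (Q' := fun s' => s'.i = Nat.log 2 l.length + 1 ∧
    LocateInv o σ₀ d l s s') (.op ⟨h2, h1, ⟨_, h4, fun hi => ?_⟩, fun _ => h3, ?_⟩)
    fun s₁ hs₁ => (Cmd.Runs.loop_rounds (fun r s' => s'.i = r ∧ LocateInv o σ₀ d l s s') (c := 1)
    ?_ hs₁).mono le_rfl ?_) ?_ (fun _ h => h)
  · exact absurd (h2.symm.trans_le hi) (Nat.not_succ_le_self _)
  · intro i' R' hi' hR'
    exact absurd ((h2.symm.trans_lt hi').trans_le hR'.1) (by simp)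
  · rintro r s₁ ⟨hi, hI⟩ ⟨hi0, hfl⟩
    obtain ⟨e1, e2⟩ := hI.step hl hσ₀ hi0 hfl
    exact .op ⟨r - 1, by omega, e2.trans (by rw [hi]), e1⟩
  · rintro s₁ ⟨hex, r, hi, hI⟩
    exact ⟨hI.frame, hI.located hl hσ₀ hex⟩
  · omega

end

noncomputable section

/-! ## The labels of the disks -/

/-- The hole of a donut. -/
def Region.hole : Region → Cell
  | .cell σ => σ
  | .donut _ τ => τ

/-- The grid points that are used to stab the disks at a node. -/
def stabPt (o : Point) (R : Region) (ty ix : ℕ) : Point :=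
  o + gridPoint ((if ty = 1 then R.hole else R.outer).corner 0).1
    ((if ty = 1 then R.hole else R.outer).corner 0).2 (if ty = 1 then R.hole else R.outer).side ix

/-- The test for a grid point of the square with corner `(X, Y)` and side `S` to lie in the disk
with center `(a, b)` and radius `r`. -/
def GridIn (X Y S a b r : ℝ) (t : ℕ) : Prop :=
  ((gridPoint X Y S t).1 - a) * ((gridPoint X Y S t).1 - a) +
    ((gridPoint X Y S t).2 - b) * ((gridPoint X Y S t).2 - b) ≤ r * r

theorem gridIn_iff {o : Point} {X Y S : ℝ} {D : Disk} {t : ℕ} :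
    GridIn X Y S (D.center.1 - o.1) (D.center.2 - o.2) D.radius t ↔
      o + gridPoint X Y S t ∈ D.toSet := by
  simp only [GridIn, Disk.toSet, Set.mem_ofPred_eq, Prod.fst_add, Prod.snd_add, ← pow_two]
  rw [show (gridPoint X Y S t).1 - (D.center.1 - o.1) = o.1 + (gridPoint X Y S t).1 - D.center.1 by
    ring, show (gridPoint X Y S t).2 - (D.center.2 - o.2) =
    o.2 + (gridPoint X Y S t).2 - D.center.2 by ring]

theorem add_gridPoint (o : Point) (X Y S : ℝ) (t : ℕ) :
    o + gridPoint X Y S t = gridPoint (o.1 + X) (o.2 + Y) S t := by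
  ext <;> simp only [gridPoint, Prod.fst_add, Prod.snd_add] <;> ring

theorem Disk.exists_gridIn {o : Point} {σ : Cell} {D : Disk} {X Y S : ℝ} (hb : IsBox σ X Y S)
    (hal : IsAligned 6 o D.toSet) (h1 : (D.toSet ∩ σ.toSet o).Nonempty)
    (h2 : ¬ D.toSet ⊆ σ.toSet o) :
    ∃ t < 81, GridIn X Y S (D.center.1 - o.1) (D.center.2 - o.2) D.radius t := by
  have hs := D.side_le_of_crosses hal h1 h2
  obtain ⟨p, hp, hpσ⟩ := h1
  obtain ⟨⟨p1, p2⟩, p3, p4⟩ := Cell.mem_iff_corner.1 hpσ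
  obtain ⟨t, ht, hmem⟩ := Disk.exists_gridPoint_mem hp ⟨p1, p2.le⟩ ⟨p3, p4.le⟩ σ.side_pos hs
  refine ⟨t, ht, gridIn_iff.2 ?_⟩
  rw [Cell.corner_eq o] at hmem
  rw [add_gridPoint, hb.1, hb.2.1, hb.2.2]
  exact hmem

@[fun_prop]
theorem BC.gridIn {X Y S a b r : St → ℝ} (hX : RC X) (hY : RC Y) (hS : RC S) (ha : RC a)
    (hb : RC b) (hr : RC r) (t : ℕ) :
    BC fun s => GridIn (X s) (Y s) (S s) (a s) (b s) (r s) t := by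
  have h12 : RC fun _ => 12 := by
    have := RC.const_rat 12
    norm_num at this
    exact this
  have h1 := RC.const_rat (2 * ((t / 9 : ℕ) : ℚ) - 1)
  have h2 := RC.const_rat (2 * ((t % 9 : ℕ) : ℚ) - 1)
  unfold GridIn gridPoint
  simp only
  fun_prop

open Classical in
/-- The largest index below `m` of a grid point in the disk, or `0`. -/
def gridSearch (X Y S a b r : ℝ) : ℕ → ℝ
  | 0 => 0
  | m + 1 => if GridIn X Y S a b r m then (((m : ℕ) : ℚ) : ℝ) else gridSearch X Y S a b r m

theorem gridSearch_spec {X Y S a b r : ℝ} (m : ℕ) : ∃ t < m + 1,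
    gridSearch X Y S a b r m = t ∧ t ≤ m - 1 ∧
      ((∃ t < m, GridIn X Y S a b r t) → GridIn X Y S a b r t) := by
  induction m with
  | zero => exact ⟨0, by omega, by simp [gridSearch], by omega, fun ⟨t, ht, _⟩ => by omega⟩
  | succ m ih =>
    obtain ⟨t, h1, h2, h3, h4⟩ := ih
    rw [gridSearch]
    split_ifs with h
    · exact ⟨m, by omega, by push_cast; rfl, by omega, fun _ => h⟩
    · refine ⟨t, by omega, h2, by omega, fun ⟨t', h5, h6⟩ => h4 ⟨t', ?_, h6⟩⟩
      rcases Nat.lt_succ_iff_lt_or_eq.1 h5 with h7 | rfl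
      · exact h7
      · exact absurd h6 h

theorem RC.gridSearch {X Y S a b r : St → ℝ} (hX : RC X) (hY : RC Y) (hS : RC S) (ha : RC a)
    (hb : RC b) (hr : RC r) (m : ℕ) :
    RC fun s => gridSearch (X s) (Y s) (S s) (a s) (b s) (r s) m := by
  classical
  induction m with
  | zero =>
    simp only [_root_.gridSearch]
    exact .zero
  | succ m ih =>
    simp only [_root_.gridSearch]
    exact .ite (by fun_prop) (RC.const_rat (m : ℚ)) ih

/-- The address of the `k`-th component of the label of the disk `a`. -/
def keyAddr (n a k : ℕ) : ℕ := 5 + (n + n + n) + (a + a + a + a + a + a) + k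

/-- The memory holds a label of the disk `a`, which describes the node and the clique to which the
disk is assigned. -/
structure HasLabel (o : Point) (σ₀ : Cell) {n : ℕ} (d : Fin n → Disk) (l : List Point)
    (rm : ℕ → ℝ) (a L : ℕ) (R : Region) (ty ix : ℕ) : Prop where
  assigned : IsAssigned o σ₀ l (dk d a) L R
  region : IsRegionOf o (levelPoints l L) R.outer R
  box : IsBox R.outer (rm (keyAddr n a 0)) (rm (keyAddr n a 1)) (rm (keyAddr n a 2))
  lev_eq : rm (keyAddr n a 3) = L
  ty_eq : rm (keyAddr n a 4) = ty
  ix_eq : rm (keyAddr n a 5) = ix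
  ty_lt : ty < 2
  ix_lt : ix < 81
  zero : L = 0 → ty = 0 ∧ ix = 0
  meet : ∀ ρ τ, R = .donut ρ τ → ty = 1 → ((dk d a).toSet ∩ τ.toSet o).Nonempty
  disj : ∀ ρ τ, R = .donut ρ τ → L ≠ 0 → ty = 0 → Disjoint (dk d a).toSet (τ.toSet o)
  stab : L ≠ 0 → stabPt o R ty ix ∈ (dk d a).toSet

/-- Determine whether the disk `x` is treated with the disks that meet the hole. -/
def typeOp : Op :=
  .ite (fun s => 0 < s.i ∧ s.f < s.g ∧ MeetsHole s)
    (.block [.ty fun _ => 1, .qX fun s => s.tX, .qY fun s => s.tY, .qS fun s => s.tS])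
    (.block [.ty fun _ => 0, .qX fun s => s.bX, .qY fun s => s.bY, .qS fun s => s.bS])

/-- Find a grid point in the disk `x`. -/
def gridOp : Op :=
  .ite (fun s => 0 < s.i)
    (.ix (fun s => gridSearch s.qX s.qY s.qS (relX s.rm s.x) (relY s.rm s.x) (rad s.rm s.x) 81)
      (by apply RC.gridSearch <;> fun_prop))
    (.ix fun _ => 0)

/-- Store the label of the disk `x`. -/
def storeOp : Op := .block [
  .stR (fun s => s.kx) (fun s => s.bX), .stR (fun s => s.kx + 1) (fun s => s.bY),
  .stR (fun s => s.kx + 2) (fun s => s.bS), .stR (fun s => s.kx + 3) (fun s => s.lev),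
  .stR (fun s => s.kx + 4) (fun s => s.ty), .stR (fun s => s.kx + 5) (fun s => s.ix),
  .kx fun s => s.kx + 6, .x fun s => s.x + 1]

variable {o : Point} {σ₀ : Cell} {n : ℕ} {d : Fin n → Disk} {l : List Point}

theorem storeOp_spec (s : St) : ∃ rm', storeOp.fn s =
      { s with rm := rm', kx := s.kx + 6, x := s.x + 1 } ∧
    (∀ a, a < s.kx → rm' a = s.rm a) ∧ rm' s.kx = s.bX ∧ rm' (s.kx + 1) = s.bY ∧
    rm' (s.kx + 2) = s.bS ∧ rm' (s.kx + 3) = s.lev ∧ rm' (s.kx + 4) = s.ty ∧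
    rm' (s.kx + 5) = s.ix := by
  simp only [storeOp, Op.block_cons, Op.block_nil, Op.stR, Op.kx, Op.x]
  refine ⟨_, rfl, ?_, ?_, ?_, ?_, ?_, ?_, ?_⟩
  · intro a ha
    have h0 : a ≠ s.kx := by omega
    have h1 : a ≠ s.kx + 1 := by omega
    have h2 : a ≠ s.kx + 2 := by omega
    have h3 : a ≠ s.kx + 3 := by omega
    have h4 : a ≠ s.kx + 4 := by omega
    have h5 : a ≠ s.kx + 5 := by omega
    simp [Function.update_of_ne, *]
  all_goals simp

/-- The type and the grid index of a located disk. -/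
structure Classified (o : Point) (σ₀ : Cell) {n : ℕ} (d : Fin n → Disk) (l : List Point) (s : St)
    (st : PathState) (ty ix : ℕ) : Prop where
  ty_eq : s.ty = ty
  ix_eq : s.ix = ix
  ty_lt : ty < 2
  ix_lt : ix < 81
  zero : s.i = 0 → ty = 0 ∧ ix = 0
  meet : ∀ ρ τ, st.region o l = .donut ρ τ → ty = 1 → ((dk d s.x).toSet ∩ τ.toSet o).Nonempty
  disj : ∀ ρ τ, st.region o l = .donut ρ τ → s.i ≠ 0 → ty = 0 →
    Disjoint (dk d s.x).toSet (τ.toSet o)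
  stab : s.i ≠ 0 → stabPt o (st.region o l) ty ix ∈ (dk d s.x).toSet

/-- A disk of type 0 leaves the region without touching a hole, so it crosses the boundary of the
outer cell. A disk of type 1 meets the hole while its center lies outside, so it crosses the
boundary of the hole. In both cases it is large compared to the cell whose grid is searched. -/
theorem IsAssigned.grid_aux {D : Disk} {i : ℕ} {R : Region} (h : IsAssigned o σ₀ l D i R)
    (hal : IsAligned 6 o D.toSet) (hi : i ≠ 0) {ty : ℕ} (hty : ty < 2)
    (hmeet : ty = 1 → (D.toSet ∩ R.hole.toSet o).Nonempty ∧ D.center ∉ R.hole.toSet o)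
    (hdisj : ∀ ρ τ, R = .donut ρ τ → ty = 0 → Disjoint D.toSet (τ.toSet o)) {X Y S : ℝ}
    (hb : IsBox (if ty = 1 then R.hole else R.outer) X Y S) :
    ∃ t < 81, GridIn X Y S (D.center.1 - o.1) (D.center.2 - o.2) D.radius t := by
  rcases Nat.lt_or_ge ty 1 with h0 | h1
  · rw [if_neg (by omega)] at hb
    have hnot := h.2.2.1.resolve_left hi
    have hcen := h.2.1
    refine Disk.exists_gridIn hb hal ⟨D.center, D.center_mem, ?_⟩ ?_
    · cases R with
      | cell σ => exact hcen
      | donut ρ τ => exact hcen.1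
    · cases R with
      | cell σ => exact hnot
      | donut ρ τ =>
        exact fun hsub => hnot (Set.subset_sdiff.2 ⟨hsub, hdisj ρ τ rfl (by omega)⟩)
  · rw [if_pos (by omega)] at hb
    obtain ⟨h2, h3⟩ := hmeet (by omega)
    exact Disk.exists_gridIn hb hal h2 fun hsub => h3 (hsub D.center_mem)

theorem Located.classify {s : St} {st : PathState} (h : Located o σ₀ d l s st)
    (hal : IsAligned 6 o (dk d s.x).toSet) :
    LocFrame s (gridOp.fn (typeOp.fn s)) ∧ (gridOp.fn (typeOp.fn s)).bX = s.bX ∧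
    (gridOp.fn (typeOp.fn s)).bY = s.bY ∧ (gridOp.fn (typeOp.fn s)).bS = s.bS ∧
    (gridOp.fn (typeOp.fn s)).lev = s.lev ∧ (gridOp.fn (typeOp.fn s)).i = s.i ∧
    ∃ ty ix, Classified o σ₀ d l (gridOp.fn (typeOp.fn s)) st ty ix := by
  have hx := h.x_lt
  have hin := h.tables.input
  have hass := h.assigned
  -- the effect of the two operations
  obtain ⟨ty, X, Y, S, hty, e₁, h0, hmeet, hdisj, hbox⟩ : ∃ (ty : ℕ) (X Y S : ℝ), ty < 2 ∧
      typeOp.fn s = { s with ty := ty, qX := X, qY := Y, qS := S } ∧ (s.i = 0 → ty = 0) ∧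
      (ty = 1 → ((dk d s.x).toSet ∩ (st.region o l).hole.toSet o).Nonempty ∧
        (dk d s.x).center ∉ (st.region o l).hole.toSet o) ∧
      (∀ ρ τ, st.region o l = .donut ρ τ → s.i ≠ 0 → ty = 0 →
        Disjoint (dk d s.x).toSet (τ.toSet o)) ∧
      IsBox (if ty = 1 then (st.region o l).hole else (st.region o l).outer) X Y S := by
    have hout : (st.region o l).outer = st.cell := by
      unfold PathState.region
      split_ifs <;> rfl
    simp only [typeOp, Op.ite_fn]
    split_ifs with hc
    · have hfg : st.f < st.g := by rw [← h.rep.f, ← h.rep.g]; exact hc.2.1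
      have hreg : st.region o l = .donut st.cell (lcc o (pnt l st.f) (pnt l st.g)) := by
        rw [PathState.region, if_pos hfg]
      refine ⟨1, s.tX, s.tY, s.tS, by omega, ?_, by omega, fun _ => ?_, fun _ _ _ _ h => by omega,
        ?_⟩
      · simp only [Op.block_cons, Op.block_nil, Op.ty, Op.qX, Op.qY, Op.qS, Nat.cast_one]
      · rw [hreg]
        exact ⟨(meetsHole_iff hin hx (h.hole hfg)).1 hc.2.2, h.valid.hole hfg⟩
      · rw [if_pos rfl, hreg]
        exact h.hole hfg
    · refine ⟨0, s.bX, s.bY, s.bS, by omega, ?_, fun _ => rfl, by omega, ?_, ?_⟩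
      · simp only [Op.block_cons, Op.block_nil, Op.ty, Op.qX, Op.qY, Op.qS, Nat.cast_zero]
      · intro ρ τ hR hi _
        have hfg : st.f < st.g := by
          by_contra hfg
          rw [PathState.region, if_neg hfg] at hR
          cases hR
        rw [PathState.region, if_pos hfg] at hR
        cases hR
        rw [Set.disjoint_iff_inter_eq_empty, ← Set.not_nonempty_iff_eq_empty,
          ← meetsHole_iff hin hx (h.hole hfg)]
        exact fun hm => hc ⟨by omega, by rwa [h.rep.f, h.rep.g], hm⟩
      · rw [if_neg (by omega), hout]
        exact h.rep.box
  obtain ⟨ix, hix, e₂, h0', hstab⟩ : ∃ ix : ℕ, ix < 81 ∧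
      gridOp.fn (typeOp.fn s) = { s with ty := ty, qX := X, qY := Y, qS := S, ix := ix } ∧
      (s.i = 0 → ix = 0) ∧ (s.i ≠ 0 → stabPt o (st.region o l) ty ix ∈ (dk d s.x).toSet) := by
    rw [e₁]
    simp only [gridOp, Op.ite_fn]
    split_ifs with hc
    · obtain ⟨t, h1, h2, h3, h4⟩ := gridSearch_spec (X := X) (Y := Y) (S := S)
        (a := relX s.rm s.x) (b := relY s.rm s.x) (r := rad s.rm s.x) 81
      refine ⟨t, by omega, ?_, by omega, fun hi => ?_⟩
      · simp only [Op.ix, h2]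
      · rw [hin.relX _ hx, hin.relY _ hx, hin.rad _ hx] at h4
        have h5 := h4 (hass.grid_aux hal hi hty hmeet (fun ρ τ hR => hdisj ρ τ hR hi) hbox)
        rw [gridIn_iff, hbox.1, hbox.2.1, hbox.2.2] at h5
        exact h5
    · exact ⟨0, by omega, by simp only [Op.ix, Nat.cast_zero], fun _ => rfl, by omega⟩
  rw [e₂]
  refine ⟨by constructor <;> rfl, rfl, rfl, rfl, rfl, rfl, ty, ix, rfl, rfl, hty, hix,
    fun hi => ⟨h0 hi, h0' hi⟩, ?_, hdisj, hstab⟩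
  intro ρ τ hR h1
  have := (hmeet h1).1
  rw [hR] at this
  exact this

end

noncomputable section

/-! ## Labelling all disks -/

variable {o : Point} {σ₀ : Cell} {n : ℕ} {d : Fin n → Disk} {l : List Point}

theorem HasLabel.congr {rm rm' : ℕ → ℝ} {a L : ℕ} {R : Region} {ty ix : ℕ}
    (h : HasLabel o σ₀ d l rm a L R ty ix)
    (hrm : ∀ k < 6, rm' (keyAddr n a k) = rm (keyAddr n a k)) :
    HasLabel o σ₀ d l rm' a L R ty ix where
  assigned := h.assigned
  region := h.region
  box := by rw [hrm 0 (by omega), hrm 1 (by omega), hrm 2 (by omega)]; exact h.box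
  lev_eq := (hrm 3 (by omega)).trans h.lev_eq
  ty_eq := (hrm 4 (by omega)).trans h.ty_eq
  ix_eq := (hrm 5 (by omega)).trans h.ix_eq
  ty_lt := h.ty_lt
  ix_lt := h.ix_lt
  zero := h.zero
  meet := h.meet
  disj := h.disj
  stab := h.stab

theorem Located.label {s : St} {st : PathState} (hl : l.Pairwise (ZLt o))
    (h : Located o σ₀ d l s st) (hal : IsAligned 6 o (dk d s.x).toSet)
    (hkx : s.kx = keyAddr n s.x 0) :
    ∃ rm', storeOp.fn (gridOp.fn (typeOp.fn s)) =
      { gridOp.fn (typeOp.fn s) with rm := rm', kx := s.kx + 6, x := s.x + 1 } ∧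
    LocFrame s (gridOp.fn (typeOp.fn s)) ∧ (∀ a < s.kx, rm' a = s.rm a) ∧
    ∃ L R ty ix, HasLabel o σ₀ d l rm' s.x L R ty ix := by
  obtain ⟨hf, b1, b2, b3, b4, b5, ty, ix, hc⟩ := h.classify hal
  obtain ⟨rm', e, k1, k2, k3, k4, k5, k6, k7⟩ := storeOp_spec (gridOp.fn (typeOp.fn s))
  generalize gridOp.fn (typeOp.fn s) = s₁ at *
  refine ⟨rm', by rw [e, hf.kx, hf.x], hf, fun a ha => ?_, s.i, st.region o l, ty, ix, ?_⟩
  · rw [k1 a (by rwa [hf.kx]), hf.rm]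
  have hreg := (h.valid.isRegionOf hl).1
  rw [image_mults] at hreg
  have hk : ∀ k, keyAddr n s.x k = s₁.kx + k := fun k => by
    rw [hf.kx, hkx, keyAddr, keyAddr, add_zero]
  have hmeet := hc.meet
  have hdisj := hc.disj
  have hstab := hc.stab
  rw [hf.x] at hmeet hdisj hstab
  rw [b5] at hdisj hstab
  exact {
    assigned := h.assigned
    region := by rw [hreg.outer_eq]; exact hreg
    box := by
      rw [hreg.outer_eq, hk, hk, hk, add_zero, k2, k3, k4, b1, b2, b3]
      exact h.rep.box
    lev_eq := by rw [hk, k5, b4, h.lev_eq]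
    ty_eq := by rw [hk, k6, hc.ty_eq]
    ix_eq := by rw [hk, k7, hc.ix_eq]
    ty_lt := hc.ty_lt
    ix_lt := hc.ix_lt
    zero := by rw [← b5]; exact hc.zero
    meet := hmeet
    disj := hdisj
    stab := hstab }

/-- Compute the labels of all disks. -/
def labelCmd : Cmd :=
  .seq (.op (.block [.x fun _ => 0, .kx fun s => 5 + (s.n + s.n + s.n)])) <|
  .loop (fun s => s.x < s.n) (by fun_prop) (.seq locateCmd (.op (.block [typeOp, gridOp, storeOp])))

theorem labelCmd_runs (hl : l.Pairwise (ZLt o)) (hσ₀ : ∀ p ∈ l, p ∈ σ₀.toSet o)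
    (hal : ∀ a < n, IsAligned 6 o (dk d a).toSet) (hcen : ∀ a < n, (dk d a).center ∈ σ₀.toSet o)
    {s : St} (hs : HasTables o σ₀ d l s) :
    labelCmd.Runs s (n * (2 * Nat.log 2 l.length + 6) + 2) fun s' => s'.n = n ∧
      ∀ a < n, ∃ L R ty ix, HasLabel o σ₀ d l s'.rm a L R ty ix := by
  let I : ℕ → St → Prop := fun r s' => HasTables o σ₀ d l s' ∧ s'.x + r = n ∧
    s'.kx = keyAddr n s'.x 0 ∧ ∀ a < s'.x, ∃ L R ty ix, HasLabel o σ₀ d l s'.rm a L R ty ix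
  refine Cmd.Runs.mono (.seq (Q' := I n) (.op ?_) fun s₁ hs₁ => (Cmd.Runs.loop_rounds I
    (c := 2 * Nat.log 2 l.length + 4 + 1) ?_ hs₁).mono le_rfl ?_) (le_of_eq (by ring)) (fun _ h => h)
  · simp only [Op.block_cons, Op.block_nil, Op.x, Op.kx]
    refine ⟨⟨hs.n_eq, hs.input, hs.N_eq, hs.rep, hs.pos, hs.pow, hs.t_eq, hs.tl_eq⟩,
      by simp, ?_, fun a ha => absurd ha (Nat.not_lt_zero _)⟩
    simp only [keyAddr, hs.n_eq]
    omega
  · rintro r s₁ ⟨h1, h2, h3, h4⟩ hlt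
    rw [h1.n_eq] at hlt
    refine .seq (locateCmd_runs hl hσ₀ h1 hlt (hcen _ hlt)) ?_
    rintro s₂ ⟨hf, st, hst⟩
    refine .op ?_
    simp only [Op.block_cons, Op.block_nil]
    have hx : s₂.x = s₁.x := hf.x
    have hkx : s₂.kx = s₁.kx := hf.kx
    obtain ⟨rm', e, hf', hrm, L, R, ty, ix, hlab⟩ := hst.label hl (hal _ (hx ▸ hlt))
      (by rw [hkx, h3, hx])
    rw [e]
    have hT := hst.tables.of_frame hf'
    -- Labels are stored above the input in the real memory, so the input survives.
    have hrm2 := hst.tables.input.congr (rm' := rm') fun a ha => hrm a (by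
      rw [hkx, h3, keyAddr]
      omega)
    refine ⟨r - 1, by omega, ⟨hT.n_eq, hrm2, hT.N_eq, hT.rep, hT.pos, hT.pow, hT.t_eq, hT.tl_eq⟩,
      ?_, ?_, ?_⟩
    · change s₂.x + 1 + (r - 1) = n
      omega
    · change s₂.kx + 6 = keyAddr n (s₂.x + 1) 0
      rw [hkx, h3, hx, keyAddr, keyAddr]
      omega
    · intro a ha
      change a < s₂.x + 1 at ha
      rcases Nat.lt_succ_iff_lt_or_eq.1 ha with h | rfl
      · obtain ⟨L, R, ty, ix, h5⟩ := h4 a (hx ▸ h)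
        refine ⟨L, R, ty, ix, h5.congr fun k hk => ?_⟩
        change rm' _ = _
        rw [hrm, hf.rm]
        rw [hkx, h3, keyAddr, keyAddr]
        omega
      · exact ⟨L, R, ty, ix, hlab⟩
  · rintro s' ⟨h, r, h1, h2, h3, h4⟩
    rw [h1.n_eq] at h
    exact ⟨h1.n_eq, fun a ha => h4 a (by omega)⟩

end

noncomputable section

/-! ## Computing the tables -/

/-- Remove duplicates from the sorted list of the indices of the disks. -/
def dedupOp : Op := .block [
  .ite (fun s => s.N = 0 ∨ zKey s.n s.rm (s.nm (s.rb + s.N)) (s.nm (s.src + s.k)))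
    (.block [.stN (fun s => s.rb + (s.N + 1)) (fun s => s.nm (s.src + s.k)), .N fun s => s.N + 1])
    (.block []) (.or (by fun_prop) (BC.zKey _ _ (by fun_prop) (by fun_prop))),
  .stN (fun s => s.pb + s.nm (s.src + s.k)) (fun s => s.N),
  .k fun s => s.k + 1]

variable {o : Point} {σ₀ : Cell} {n : ℕ} {d : Fin n → Disk} {l : List Point}

/-- The first `k` entries of the sorted list `V` of the indices of the disks have been put into
the tables. -/
structure DedupInv (o : Point) {n : ℕ} (d : Fin n → Disk) (rm : ℕ → ℝ) (V : ℕ → ℕ) (s : St) :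
    Prop where
  n_eq : s.n = n
  rm_eq : s.rm = rm
  pb_eq : s.pb = s.src + n
  rb_eq : s.rb = s.pb + n
  wb_eq : s.wb = s.rb + n + 1
  k_le : s.k ≤ n
  src_eq : ∀ x < n, s.nm (s.src + x) = V x
  N_le : s.N ≤ s.k
  rep_lt : ∀ u, 1 ≤ u → u ≤ s.N → s.nm (s.rb + u) < n
  rep_sorted : ∀ u v, 1 ≤ u → u < v → v ≤ s.N →
    ZLt o (dk d (s.nm (s.rb + u))).center (dk d (s.nm (s.rb + v))).center
  pos : ∀ x < s.k, (1 ≤ s.nm (s.pb + V x) ∧ s.nm (s.pb + V x) ≤ s.N) ∧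
    (dk d (s.nm (s.rb + s.nm (s.pb + V x)))).center = (dk d (V x)).center
  last : 0 < s.k → (dk d (s.nm (s.rb + s.N))).center = (dk d (V (s.k - 1))).center

/-- Covers both outcomes: `N' = s.N` if the next center repeats the last one, and `N' = s.N + 1` if
it is new. -/
theorem DedupInv.step_aux {rm : ℕ → ℝ} {V : ℕ → ℕ} {lt : ℕ → ℕ → Prop}
    (hV : IsSortedList lt n V) {s : St} (h : DedupInv o d rm V s) (hk : s.k < n) {N' : ℕ}
    {nm' : ℕ → ℕ} (hsrc : ∀ x < n, nm' (s.src + x) = s.nm (s.src + x))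
    (hrep : ∀ u, 1 ≤ u → u ≤ s.N → nm' (s.rb + u) = s.nm (s.rb + u))
    (hpos : ∀ a < n, a ≠ V s.k → nm' (s.pb + a) = s.nm (s.pb + a))
    (hpos' : nm' (s.pb + V s.k) = N') (hN' : 0 < N') (hlt : nm' (s.rb + N') < n)
    (hcen : (dk d (nm' (s.rb + N'))).center = (dk d (V s.k)).center)
    (hcase : N' = s.N ∨ (N' = s.N + 1 ∧ ∀ u, 1 ≤ u → u ≤ s.N →
      ZLt o (dk d (s.nm (s.rb + u))).center (dk d (V s.k)).center)) :
    DedupInv o d rm V { s with k := s.k + 1, N := N', nm := nm' } := by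
  have hNk := h.N_le
  exact {
    n_eq := h.n_eq
    rm_eq := h.rm_eq
    pb_eq := h.pb_eq
    rb_eq := h.rb_eq
    wb_eq := h.wb_eq
    k_le := hk
    src_eq := fun x hx => (hsrc x hx).trans (h.src_eq x hx)
    N_le := by
      change N' ≤ s.k + 1
      omega
    rep_lt := by
      intro u h1 h2
      change u ≤ N' at h2
      change nm' (s.rb + u) < n
      rcases Nat.lt_or_ge s.N u with h3 | h3
      · obtain rfl : u = N' := by omega
        exact hlt
      · rw [hrep u h1 h3]
        exact h.rep_lt u h1 h3
    rep_sorted := by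
      intro u v h1 h2 h3
      change v ≤ N' at h3
      change ZLt o (dk d (nm' (s.rb + u))).center (dk d (nm' (s.rb + v))).center
      rcases Nat.lt_or_ge s.N v with h4 | h4
      · obtain ⟨e, h5⟩ := hcase.resolve_left (by omega)
        obtain rfl : v = N' := by omega
        rw [hrep u h1 (by omega), hcen]
        exact h5 u h1 (by omega)
      · rw [hrep u h1 (by omega), hrep v (by omega) h4]
        exact h.rep_sorted u v h1 h2 h4
    pos := by
      intro x hx
      change x < s.k + 1 at hx
      change (1 ≤ nm' (s.pb + V x) ∧ nm' (s.pb + V x) ≤ N') ∧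
        (dk d (nm' (s.rb + nm' (s.pb + V x)))).center = (dk d (V x)).center
      rcases Nat.lt_succ_iff_lt_or_eq.1 hx with h1 | rfl
      · rw [hpos _ (hV.lt_n x (by omega)) fun e => by
          have := hV.inj x (by omega) s.k hk e
          omega]
        obtain ⟨⟨h2, h3⟩, h4⟩ := h.pos x h1
        rw [hrep _ h2 h3]
        exact ⟨⟨h2, by omega⟩, h4⟩
      · rw [hpos']
        exact ⟨⟨hN', le_rfl⟩, hcen⟩
    last := fun _ => hcen }

theorem DedupInv.step {rm : ℕ → ℝ} {V : ℕ → ℕ} (hin : IsInput o σ₀ d rm)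
    (hcen : ∀ a < n, (dk d a).center ∈ σ₀.toSet o) (hV : IsSortedList (zKey n rm) n V) {s : St}
    (h : DedupInv o d rm V s) (hk : s.k < n) :
    DedupInv o d rm V (dedupOp.fn s) ∧ (dedupOp.fn s).k = s.k + 1 := by
  have hVk := hV.lt_n s.k hk
  have e1 := h.pb_eq
  have e2 := h.rb_eq
  have hNk := h.N_le
  simp only [dedupOp, Op.block_cons, Op.block_nil, Op.ite_fn]
  rw [h.src_eq _ hk, h.n_eq, h.rm_eq]
  by_cases hc : s.N = 0 ∨ zKey n rm (s.nm (s.rb + s.N)) (V s.k)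
  · rw [if_pos hc]
    simp only [Op.stN, Op.N, Op.k]
    refine ⟨?_, trivial⟩
    have hread : ∀ b, b < s.rb + 1 → Function.update s.nm (s.rb + (s.N + 1))
        (s.nm (s.src + s.k)) b = s.nm b := fun b hb => Function.update_of_ne (by omega) _ _
    rw [hread (s.src + s.k) (by omega), h.src_eq _ hk]
    have hread' : ∀ b, s.rb < b → Function.update (Function.update s.nm (s.rb + (s.N + 1)) (V s.k))
        (s.pb + V s.k) (s.N + 1) b = Function.update s.nm (s.rb + (s.N + 1)) (V s.k) b := fun b hb =>
      Function.update_of_ne (by omega) _ _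
    refine h.step_aux hV hk (N' := s.N + 1) ?_ ?_ ?_ ?_ ?_ ?_ ?_ (Or.inr ⟨rfl, ?_⟩)
    · intro x hx
      rw [Function.update_of_ne (by omega), Function.update_of_ne (by omega)]
    · intro u h1 h2
      rw [Function.update_of_ne (by omega), Function.update_of_ne (by omega)]
    · intro a ha hne
      rw [Function.update_of_ne (by omega), Function.update_of_ne (by omega)]
    · rw [Function.update_self]
    · omega
    · rw [hread' _ (by omega), Function.update_self]
      exact hVk
    · rw [hread' _ (by omega), Function.update_self]
    · intro u h1 h2
      have h3 := hc.resolve_left (by omega)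
      have hr := h.rep_lt s.N (by omega) le_rfl
      rw [zKey_iff hin hcen hr hVk] at h3
      rcases h2.lt_or_eq with h4 | rfl
      · exact (h.rep_sorted u s.N h1 h4 le_rfl).trans h3
      · exact h3
  · rw [if_neg hc]
    simp only [Op.stN, Op.k]
    refine ⟨?_, trivial⟩
    rw [h.src_eq _ hk]
    push Not at hc
    have hr := h.rep_lt s.N (by omega) le_rfl
    have hk0 : 0 < s.k := by omega
    have hpr := hV.lt_n (s.k - 1) (by omega)
    -- The new center does not come after the last one, by the test, nor before it, as the indices
    -- are sorted. Totality leaves equality.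
    have hsame : (dk d (s.nm (s.rb + s.N))).center = (dk d (V s.k)).center := by
      by_contra hne
      rcases ZLt.total (hcen _ hr) (hcen _ hVk) hne with h1 | h1
      · exact hc.2 ((zKey_iff hin hcen hr hVk).2 h1)
      · refine hV.sorted (s.k - 1) s.k (by omega) hk ((zKey_iff hin hcen hVk hpr).2 ?_)
        rwa [← h.last hk0]
    have hread' : ∀ b, s.rb < b → Function.update s.nm (s.pb + V s.k) s.N b = s.nm b :=
      fun b hb => Function.update_of_ne (by omega) _ _
    refine h.step_aux hV hk (N' := s.N) ?_ ?_ ?_ ?_ ?_ ?_ ?_ (Or.inl rfl)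
    · intro x hx
      rw [Function.update_of_ne (by omega)]
    · intro u h1 h2
      rw [Function.update_of_ne (by omega)]
    · intro a ha hne
      rw [Function.update_of_ne (by omega)]
    · rw [Function.update_self]
    · omega
    · rwa [hread' _ (by omega)]
    · rwa [hread' _ (by omega)]

/-- The sorted list of the centers. -/
def repList {n : ℕ} (d : Fin n → Disk) (s : St) : List Point :=
  (List.range s.N).map fun u => (dk d (s.nm (s.rb + (u + 1)))).center

theorem length_repList (d : Fin n → Disk) (s : St) : (repList d s).length = s.N := by
  simp [repList]

theorem pnt_repList (d : Fin n → Disk) (s : St) {u : ℕ} (h1 : 1 ≤ u) (h2 : u ≤ s.N) :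
    pnt (repList d s) u = (dk d (s.nm (s.rb + u))).center := by
  obtain ⟨u, rfl⟩ : ∃ v, u = v + 1 := ⟨u - 1, by omega⟩
  simp [pnt, repList, List.getD_eq_getElem?_getD, List.getElem?_range (show u < s.N by omega)]

theorem DedupInv.repList_pairwise {rm : ℕ → ℝ} {V : ℕ → ℕ} {s : St} (h : DedupInv o d rm V s) :
    (repList d s).Pairwise (ZLt o) := by
  rw [repList, List.pairwise_map]
  refine (List.pairwise_lt_range (n := s.N)).imp_of_mem fun ha hb hab => ?_
  rw [List.mem_range] at ha hb
  exact h.rep_sorted _ _ (by omega) (by omega) (by omega)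

theorem DedupInv.mem_repList {rm : ℕ → ℝ} {V : ℕ → ℕ} {lt : ℕ → ℕ → Prop}
    (hV : IsSortedList lt n V) {s : St} (h : DedupInv o d rm V s) (hk : n ≤ s.k) (p : Point) :
    p ∈ repList d s ↔ ∃ a < n, (dk d a).center = p := by
  simp only [repList, List.mem_map, List.mem_range]
  constructor
  · rintro ⟨u, hu, rfl⟩
    exact ⟨_, h.rep_lt (u + 1) (by omega) (by omega), rfl⟩
  · rintro ⟨a, ha, rfl⟩
    obtain ⟨x, hx, rfl⟩ := hV.surj a ha
    obtain ⟨⟨h1, h2⟩, h3⟩ := h.pos x (by omega)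
    refine ⟨s.nm (s.pb + V x) - 1, by omega, ?_⟩
    rw [Nat.sub_add_cancel h1, h3]

/-- Compute the tables from the sorted list of the indices. -/
def tableCmd : Cmd :=
  .seq (.op (.block [.pb fun s => s.top, .rb fun s => s.top + s.n,
    .wb fun s => s.top + s.n + s.n + 1, .N fun _ => 0, .k fun _ => 0])) <|
  .seq (.loop (fun s => s.k < s.n) (by fun_prop) (.op dedupOp)) <|
  .seq (.op (.block [.stN (fun s => s.wb) (fun _ => 1), .i fun _ => 1, .w fun _ => 2,
    .tl fun _ => 1])) <|
  .seq (.loop (fun s => s.w ≤ s.N) (by fun_prop)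
    (.op (.block [.stN (fun s => s.wb + s.i) (fun s => s.w), .i fun s => s.i + 1,
      .w fun s => s.w + s.w, .tl fun s => s.tl + 1]))) <|
  .op (.t fun s => s.i)

/-- The table of the powers of two has been computed up to the index `i`. -/
structure PowInv {n : ℕ} (d : Fin n → Disk) (s₀ s : St) : Prop where
  n_eq : s.n = s₀.n
  rm_eq : s.rm = s₀.rm
  N_eq : s.N = s₀.N
  pb_eq : s.pb = s₀.pb
  rb_eq : s.rb = s₀.rb
  wb_eq : s.wb = s₀.wb
  nm_eq : ∀ a < s₀.wb, s.nm a = s₀.nm a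
  i_pos : 1 ≤ s.i
  w_eq : s.w = 2 ^ s.i
  tl_eq : s.tl = s.i
  pow : ∀ i < s.i, s.nm (s.wb + i) = 2 ^ i
  le : ∀ i < s.i, 1 ≤ i → 2 ^ i ≤ s₀.N

/-- Register `tl` counts levels in the reals alongside `i`: no instruction converts natural numbers
to reals, and labels store the level as a real. Doubling `w` until it exceeds `N` yields the number
of levels. -/
theorem tableCmd_runs {rm : ℕ → ℝ} {top : ℕ} {s : St} (hs : SortEnv n rm top s)
    (hV : IsSortedList (zKey n rm) n fun x => s.nm (s.src + x)) (hin : IsInput o σ₀ d rm)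
    (hcen : ∀ a < n, (dk d a).center ∈ σ₀.toSet o) :
    tableCmd.Runs s (4 * n + 5) fun s' => ∃ l : List Point, l.Pairwise (ZLt o) ∧
      (∀ p, p ∈ l ↔ ∃ a < n, (dk d a).center = p) ∧ l.length ≤ n ∧ HasTables o σ₀ d l s' := by
  set V := fun x => s.nm (s.src + x) with hVdef
  let I : ℕ → St → Prop := fun r s' => DedupInv o d rm V s' ∧ s'.k + r = n
  refine Cmd.Runs.mono (.seq (c' := (n * (1 + 1) + 1) + (1 + ((n * (1 + 1) + 1) + 1)))
    (Q' := I n) (.op ?_) fun s₁ hs₁ => .seq (.loop_rounds (c := 1) I ?_ hs₁) fun s₂ hs₂ =>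
    .seq (Q' := PowInv d s₂) (.op ?_) fun s₃ hs₃ => .seq (.loop_rounds (c := 1) (r := n)
    (fun r s' => PowInv d s₂ s' ∧ n - s'.i ≤ r) ?_ ⟨hs₃, by omega⟩) fun s₄ hs₄ => .op ?_) (by omega) (fun _ h => h)
  · simp only [Op.block_cons, Op.block_nil, Op.pb, Op.rb, Op.wb, Op.N, Op.k]
    have h1 := hs.top_eq
    have h2 := hs.n_eq
    exact ⟨{
      n_eq := hs.n_eq
      rm_eq := hs.rm_eq
      pb_eq := h1
      rb_eq := by simp only; rw [h2]
      wb_eq := by simp only; rw [h2]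
      k_le := Nat.zero_le _
      src_eq := fun x _ => rfl
      N_le := le_rfl
      rep_lt := by intro u h3 h4; simp only at h4; omega
      rep_sorted := by intro u v h3 h4 h5; simp only at h5; omega
      pos := fun x hx => absurd hx (Nat.not_lt_zero _)
      last := fun h => absurd h (lt_irrefl _) }, by simp⟩
  · rintro r s' ⟨h1, h2⟩ hk
    rw [h1.n_eq] at hk
    obtain ⟨h3, h4⟩ := h1.step hin hcen hV hk
    exact .op ⟨r - 1, by omega, h3, by rw [h4]; omega⟩
  · simp only [Op.block_cons, Op.block_nil, Op.stN, Op.i, Op.w, Op.tl]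
    exact {
      n_eq := rfl
      rm_eq := rfl
      N_eq := rfl
      pb_eq := rfl
      rb_eq := rfl
      wb_eq := rfl
      nm_eq := fun a ha => Function.update_of_ne ha.ne _ _
      i_pos := le_rfl
      w_eq := by simp
      tl_eq := by simp
      pow := by
        intro i hi
        obtain rfl : i = 0 := by simp only at hi; omega
        simp
      le := by intro i hi h1; simp only at hi; omega }
  · rintro r s' ⟨h, hr⟩ hw
    obtain ⟨_, hD, -⟩ := hs₂.2
    have hNn : s₂.N ≤ n := hD.N_le.trans hD.k_le
    have hlt : 2 ^ s'.i ≤ s₂.N := by rw [← h.w_eq, ← h.N_eq]; exact hw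
    -- A linear bound on the number of rounds is enough here, and `i < 2 ^ i ≤ n` provides it.
    have hi : s'.i < n := (Nat.lt_two_pow_self).trans_le (hlt.trans hNn)
    refine .op ?_
    simp only [Op.block_cons, Op.block_nil, Op.stN, Op.i, Op.w, Op.tl]
    refine ⟨r - 1, by omega, ?_, by omega⟩
    exact {
      n_eq := h.n_eq
      rm_eq := h.rm_eq
      N_eq := h.N_eq
      pb_eq := h.pb_eq
      rb_eq := h.rb_eq
      wb_eq := h.wb_eq
      nm_eq := fun a ha => (Function.update_of_ne (by rw [h.wb_eq]; omega) _ _).trans (h.nm_eq a ha)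
      i_pos := by simp
      w_eq := by simp only; rw [h.w_eq, pow_succ]; ring
      tl_eq := by simp only; rw [h.tl_eq]; push_cast; ring
      pow := by
        intro i hi
        simp only at hi ⊢
        rcases Nat.lt_succ_iff_lt_or_eq.1 hi with h1 | rfl
        · rw [Function.update_of_ne (by omega)]
          exact h.pow i h1
        · rw [Function.update_self, h.w_eq]
      le := by
        intro i hi h1
        simp only at hi
        rcases Nat.lt_succ_iff_lt_or_eq.1 hi with h2 | rfl
        · exact h.le i h2 h1
        · exact hlt }
  · obtain ⟨hk, r, hD, -⟩ := hs₂
    obtain ⟨hw, r', hP, -⟩ := hs₄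
    rw [hD.n_eq] at hk
    have hlog : s₄.i = Nat.log 2 s₂.N + 1 := by
      rw [hP.w_eq, hP.N_eq] at hw
      rcases hP.i_pos.lt_or_eq with h1 | h1
      · have h2 := hP.le (s₄.i - 1) (by omega) (by omega)
        have : Nat.log 2 s₂.N = s₄.i - 1 := by
          rw [Nat.log_eq_iff (Or.inl (by omega))]
          refine ⟨h2, ?_⟩
          rw [Nat.sub_add_cancel (by omega)]
          omega
        omega
      · rw [← h1, pow_one] at hw
        rw [Nat.log_of_lt (by omega), ← h1]
    have hlen := length_repList d s₂
    have hNn : s₂.N ≤ n := hD.N_le.trans hD.k_le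
    have e1 := hD.wb_eq
    have e2 := hD.rb_eq
    refine ⟨repList d s₂, hD.repList_pairwise, hD.mem_repList hV (by omega), by omega, ?_⟩
    exact {
      n_eq := hP.n_eq.trans hD.n_eq
      input := by
        change IsInput o σ₀ d s₄.rm
        rw [hP.rm_eq, hD.rm_eq]
        exact hin
      N_eq := by rw [hlen]; exact hP.N_eq
      rep := by
        intro u h1 h2
        rw [hlen] at h2
        change s₄.nm (s₄.rb + u) < n ∧ (dk d (s₄.nm (s₄.rb + u))).center = _
        rw [hP.rb_eq, hP.nm_eq _ (by omega), pnt_repList d s₂ h1 h2]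
        exact ⟨hD.rep_lt u h1 h2, rfl⟩
      pos := by
        intro a ha
        change (1 ≤ s₄.nm (s₄.pb + a) ∧ s₄.nm (s₄.pb + a) ≤ _) ∧ pnt _ (s₄.nm (s₄.pb + a)) = _
        rw [hP.pb_eq, hP.nm_eq _ (by omega), hlen]
        obtain ⟨x, hx, rfl⟩ := hV.surj a ha
        obtain ⟨h1, h2⟩ := hD.pos x (by omega)
        exact ⟨h1, (pnt_repList d s₂ h1.1 h1.2).trans h2⟩
      pow := by
        intro i hi
        rw [hlen] at hi
        exact hP.pow i (by omega)
      t_eq := by rw [hlen]; exact hlog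
      tl_eq := hP.tl_eq }

end

noncomputable section

/-! ## Numbering the cliques -/

/-- The lexicographic comparison of the first components of two vectors. -/
def LexLt (u v : ℕ → ℝ) : ℕ → Prop
  | 0 => False
  | m + 1 => LexLt u v m ∨ (¬ LexLt v u m ∧ u m < v m)

theorem LexLt.asymm {u v : ℕ → ℝ} {m : ℕ} : LexLt u v m → ¬ LexLt v u m := by
  induction m with
  | zero => exact fun h => h.elim
  | succ m ih =>
    rintro (h | ⟨h, h'⟩) (h₁ | ⟨h₁, h₁'⟩)
    · exact ih h h₁
    · exact h₁ h
    · exact h h₁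
    · exact lt_asymm h' h₁'

theorem not_lexLt_trans {u v w : ℕ → ℝ} {m : ℕ} (h : ¬ LexLt v u m) (h' : ¬ LexLt w v m) :
    ¬ LexLt w u m := by
  induction m generalizing u v w with
  | zero => exact id
  | succ m ih =>
    simp only [LexLt, not_or, not_and, not_lt] at h h' ⊢
    exact ⟨ih h.1 h'.1, fun h₁ => (h.2 (ih h'.1 h₁)).trans (h'.2 (ih h₁ h.1))⟩

theorem not_lexLt_iff {u v : ℕ → ℝ} {m : ℕ} :
    ¬ LexLt u v m ∧ ¬ LexLt v u m ↔ ∀ k < m, u k = v k := by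
  induction m with
  | zero => simp [LexLt]
  | succ m ih =>
    simp only [LexLt, not_or, not_and, not_lt, Nat.forall_lt_succ_right, ← ih]
    constructor
    · rintro ⟨⟨h1, h2⟩, h3, h4⟩
      exact ⟨⟨h1, h3⟩, le_antisymm (h4 h1) (h2 h3)⟩
    · rintro ⟨⟨h1, h2⟩, h3⟩
      exact ⟨⟨h1, fun _ => h3.ge⟩, h2, fun _ => h3.le⟩

/-- The comparison of the labels of two disks. -/
def labelKey : Key := fun n rm a b =>
  LexLt (fun k => rm (keyAddr n a k)) (fun k => rm (keyAddr n b k)) 6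

theorem BC.lexLt {f g : St → ℕ → ℝ} (hf : ∀ k, RC fun s => f s k) (hg : ∀ k, RC fun s => g s k)
    (m : ℕ) : (BC fun s => LexLt (f s) (g s) m) ∧ BC fun s => LexLt (g s) (f s) m := by
  induction m with
  | zero =>
    have : BC fun _ => False := (BC.nlt (.const 0) (.const 0)).congr fun _ => by simp
    exact ⟨this, this⟩
  | succ m ih =>
    obtain ⟨h1, h2⟩ := ih
    have h3 := hf m
    have h4 := hg m
    simp only [LexLt]
    exact ⟨.or h1 (.and h2.not (.rlt h3 h4)), .or h2 (.and h1.not (.rlt h4 h3))⟩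

theorem BC.labelKey (f g : St → ℕ) (hf : NC f) (hg : NC g) :
    BC fun s => labelKey s.n s.rm (f s) (g s) := by
  unfold _root_.labelKey keyAddr
  exact (BC.lexLt (fun k => by fun_prop) (fun k => by fun_prop) 6).1

theorem isWeakOrder_labelKey (n : ℕ) (rm : ℕ → ℝ) : IsWeakOrder (labelKey n rm) n :=
  ⟨fun _ _ _ _ => LexLt.asymm, fun _ _ _ _ _ _ => not_lexLt_trans⟩

variable {lt : Key} (hlt : ∀ f g, NC f → NC g → BC fun s => lt s.n s.rm (f s) (g s))

/-- Number the classes of equivalent indices in a sorted list. -/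
def numberCmd : Cmd :=
  .seq (.op (.block [.k fun _ => 0, .N fun _ => 0])) <|
  .loop (fun s => s.k < s.n) (by fun_prop) <| .op <| .block [
    .ite (fun s => 0 < s.k ∧ lt s.n s.rm (s.nm (s.src + (s.k - 1))) (s.nm (s.src + s.k)))
      (.N fun s => s.N + 1) (.block [])
      (.and (by fun_prop) (hlt _ _ (by fun_prop) (by fun_prop))),
    .stN (fun s => s.nm (s.src + s.k)) (fun s => s.N), .k fun s => s.k + 1]

/-- The classes of the first `k` entries of the sorted list `V` have been numbered. -/
structure NumberInv (n : ℕ) (rm : ℕ → ℝ) (lt : ℕ → ℕ → Prop) (V : ℕ → ℕ) (s : St) : Prop where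
  n_eq : s.n = n
  rm_eq : s.rm = rm
  k_le : s.k ≤ n
  le_src : n ≤ s.src
  src_eq : ∀ x < n, s.nm (s.src + x) = V x
  N_lt : 0 < s.k → s.N < s.k
  N_zero : s.k = 0 → s.N = 0
  le_N : ∀ x < s.k, s.nm (V x) ≤ s.N
  last : 0 < s.k → s.nm (V (s.k - 1)) = s.N
  iff : ∀ x < s.k, ∀ y < s.k, s.nm (V x) = s.nm (V y) ↔ ¬ lt (V x) (V y) ∧ ¬ lt (V y) (V x)

/-- In a sorted list equivalent elements are consecutive, so the comparison with the predecessor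
decides whether a new class begins. -/
theorem NumberInv.step_aux {n : ℕ} {rm : ℕ → ℝ} {lt : ℕ → ℕ → Prop} {V : ℕ → ℕ}
    (ho : IsWeakOrder lt n) (hV : IsSortedList lt n V) {s : St} (h : NumberInv n rm lt V s)
    (hk : s.k < n) {N' : ℕ} (hN : (N' = s.N + 1 ∧ 0 < s.k ∧ lt (V (s.k - 1)) (V s.k)) ∨
      (N' = s.N ∧ ¬ (0 < s.k ∧ lt (V (s.k - 1)) (V s.k)))) :
    NumberInv n rm lt V
      { s with N := N', k := s.k + 1, nm := Function.update s.nm (V s.k) N' } := by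
  have hVk := hV.lt_n _ hk
  have hread : ∀ x < s.k, Function.update s.nm (V s.k) N' (V x) = s.nm (V x) := fun x hx =>
    Function.update_of_ne (fun e => by
      have := hV.inj x (by omega) s.k hk e
      omega) _ _
  have hz := h.N_zero
  have hp := h.N_lt
  have hNk : N' < s.k + 1 := by omega
  have key : ∀ x < s.k, s.nm (V x) = N' ↔ ¬ lt (V x) (V s.k) ∧ ¬ lt (V s.k) (V x) := by
    intro x hx
    have hVx := hV.lt_n x (by omega)
    have hVl := hV.lt_n (s.k - 1) (by omega)
    have hle : ¬ lt (V s.k) (V x) := hV.sorted x s.k hx hk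
    have hle' : ¬ lt (V s.k) (V (s.k - 1)) := hV.sorted (s.k - 1) s.k (by omega) hk
    have hle2 : ¬ lt (V (s.k - 1)) (V x) := by
      rcases Nat.lt_or_ge x (s.k - 1) with h1 | h1
      · exact hV.sorted x (s.k - 1) h1 (by omega)
      · obtain rfl : x = s.k - 1 := by omega
        exact fun h2 => ho.asymm _ hVx _ hVx h2 h2
    rcases hN with ⟨rfl, h1, h2⟩ | ⟨rfl, h1⟩
    · have h3 := h.le_N x hx
      constructor
      · intro h4
        omega
      · rintro ⟨h4, -⟩
        exact absurd h2 (ho.trans _ hVk _ hVx _ hVl h4 hle2)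
    · have h2 : ¬ lt (V (s.k - 1)) (V s.k) := fun h3 => h1 ⟨by omega, h3⟩
      rw [← h.last (by omega), h.iff x hx (s.k - 1) (by omega)]
      constructor
      · rintro ⟨h3, h4⟩
        exact ⟨ho.trans _ hVk _ hVl _ hVx h2 h3, hle⟩
      · rintro ⟨h3, -⟩
        exact ⟨ho.trans _ hVl _ hVk _ hVx hle' h3, hle2⟩
  exact {
    n_eq := h.n_eq
    rm_eq := h.rm_eq
    k_le := hk
    le_src := h.le_src
    src_eq := fun x hx => by
      have := h.le_src
      change Function.update s.nm (V s.k) N' (s.src + x) = V x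
      rw [Function.update_of_ne (by omega)]
      exact h.src_eq x hx
    N_lt := fun _ => hNk
    N_zero := fun h => absurd h (Nat.succ_ne_zero _)
    le_N := by
      intro x hx
      simp only at hx ⊢
      rcases Nat.lt_succ_iff_lt_or_eq.1 hx with h1 | rfl
      · rw [hread x h1]
        have := h.le_N x h1
        omega
      · rw [Function.update_self]
    last := fun _ => Function.update_self _ _ _
    iff := by
      intro x hx y hy
      simp only at hx hy ⊢
      rcases Nat.lt_succ_iff_lt_or_eq.1 hx with h1 | rfl <;>
        rcases Nat.lt_succ_iff_lt_or_eq.1 hy with h2 | rfl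
      · rw [hread x h1, hread y h2]
        exact h.iff x h1 y h2
      · rw [hread x h1, Function.update_self]
        exact key x h1
      · rw [hread y h2, Function.update_self, eq_comm, and_comm]
        exact key y h2
      · have := fun h => ho.asymm _ hVk _ hVk h h
        exact ⟨fun _ => ⟨this, this⟩, fun _ => rfl⟩ }

theorem numberCmd_runs {n : ℕ} {rm : ℕ → ℝ} {top : ℕ} {s : St} (ho : IsWeakOrder (lt n rm) n)
    (hs : SortEnv n rm top s) (hn : n ≤ top)
    (hV : IsSortedList (lt n rm) n fun x => s.nm (s.src + x)) :
    (numberCmd hlt).Runs s (2 * n + 2) fun s' => (∀ a < n, s'.nm a < n) ∧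
      ∀ a < n, ∀ b < n, s'.nm a = s'.nm b ↔ ¬ lt n rm a b ∧ ¬ lt n rm b a := by
  set V := fun x => s.nm (s.src + x) with hVdef
  let I : ℕ → St → Prop := fun r s' => NumberInv n rm (lt n rm) V s' ∧ s'.k + r = n
  refine Cmd.Runs.mono (.seq (Q' := I n) (.op ?_) fun s₁ hs₁ =>
    (Cmd.Runs.loop_rounds (c := 1) I ?_ hs₁).mono le_rfl ?_) (by omega) (fun _ h => h)
  · simp only [Op.block_cons, Op.block_nil, Op.k, Op.N]
    exact ⟨{
      n_eq := hs.n_eq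
      rm_eq := hs.rm_eq
      k_le := Nat.zero_le _
      le_src := hn.trans hs.src_le
      src_eq := fun x _ => rfl
      N_lt := fun h => h
      N_zero := fun _ => rfl
      le_N := fun x hx => absurd hx (Nat.not_lt_zero _)
      last := fun h => absurd h (lt_irrefl _)
      iff := fun x hx => absurd hx (Nat.not_lt_zero _) }, by simp⟩
  · rintro r s' ⟨h1, h2⟩ hk
    rw [h1.n_eq] at hk
    refine .op ?_
    have e1 := h1.src_eq _ hk
    have e2 := h1.src_eq (s'.k - 1) (by omega)
    simp only [Op.block_cons, Op.block_nil, Op.ite_fn]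
    rw [e1, e2, h1.n_eq, h1.rm_eq]
    split_ifs with hc
    · simp only [Op.stN, Op.k, Op.N]
      rw [e1]
      exact ⟨r - 1, by omega, h1.step_aux ho hV hk (Or.inl ⟨rfl, hc⟩), by simp only; omega⟩
    · simp only [Op.stN, Op.k]
      rw [e1]
      exact ⟨r - 1, by omega, h1.step_aux ho hV hk (N' := s'.N) (Or.inr ⟨rfl, hc⟩),
        by simp only; omega⟩
  · rintro s' ⟨hk, r, h, -⟩
    rw [h.n_eq] at hk
    have hk' : s'.k = n := by
      have := h.k_le
      omega
    constructor
    · intro a ha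
      obtain ⟨x, hx, rfl⟩ := hV.surj a ha
      have h1 := h.le_N x (by omega)
      have h2 := h.N_lt (by omega)
      change s'.nm (V x) < n
      omega
    · intro a ha b hb
      obtain ⟨x, hx, rfl⟩ := hV.surj a ha
      obtain ⟨y, hy, rfl⟩ := hV.surj b hb
      exact h.iff x (by omega) y (by omega)

end

noncomputable section

/-! ## The program -/

/-- Compute the clique construction. -/
def mainCmd : Cmd :=
  .seq (.op (.top fun s => s.n)) <| .seq (sortCmd zKey BC.zKey) <| .seq tableCmd <|
  .seq labelCmd <| .seq (.op (.top fun s => s.n)) <| .seq (sortCmd labelKey BC.labelKey) <|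
  numberCmd BC.labelKey

variable {o : Point} {σ₀ : Cell} {n : ℕ} {d : Fin n → Disk}

theorem dk_coe (d : Fin n → Disk) (x : Fin n) : dk d x = d x := by
  simp [dk]

theorem forall_dk {P : Disk → Prop} (h : ∀ x, P (d x)) : ∀ a < n, P (dk d a) := by
  intro a ha
  simpa [dk, ha] using h ⟨a, ha⟩

theorem mainCost_le (n L : ℕ) (hL : L ≤ n) :
    1 + (sortCost n + ((4 * n + 5) + ((n * (2 * Nat.log 2 L + 6) + 2) + (1 + (sortCost n +
      (2 * n + 2)))))) ≤ 40 * ((n + 1) * (Nat.log 2 n + 1)) := by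
  have h := Nat.log_mono_right (b := 2) hL
  have h1 := Nat.mul_le_mul_left n h
  unfold sortCost
  nlinarith [Nat.zero_le (n * Nat.log 2 n)]

/-- The memory holds labels for all disks, and the numbers of the classes of equal labels. -/
theorem mainCmd_runs (had : IsAdmissible o σ₀ d) {s : St} (hn : s.n = n)
    (hin : IsInput o σ₀ d s.rm) :
    mainCmd.Runs s (40 * ((n + 1) * (Nat.log 2 n + 1))) fun s' => (∀ a < n, s'.nm a < n) ∧
      ∃ l : List Point, l.Pairwise (ZLt o) ∧ (∀ p, p ∈ l ↔ ∃ x, (d x).center = p) ∧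
      ∃ rm : ℕ → ℝ, (∀ a < n, ∃ L R ty ix, HasLabel o σ₀ d l rm a L R ty ix) ∧
      ∀ a < n, ∀ b < n, s'.nm a = s'.nm b ↔
        ¬ labelKey n rm a b ∧ ¬ labelKey n rm b a := by
  have hcen : ∀ a < n, (dk d a).center ∈ σ₀.toSet o :=
    forall_dk (P := fun D => D.center ∈ σ₀.toSet o) fun x => (had x).1 (d x).center_mem
  have hal : ∀ a < n, IsAligned 6 o (dk d a).toSet :=
    forall_dk (P := fun D => IsAligned 6 o D.toSet) fun x => (had x).2
  obtain ⟨rm, hrm⟩ : ∃ rm, s.rm = rm := ⟨_, rfl⟩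
  rw [hrm] at hin
  refine Cmd.Runs.mono (.seq (Q' := fun s' => s'.n = n ∧ s'.rm = rm) (.op ⟨hn, hrm⟩) fun s₁ h₁ =>
    .seq (Q' := fun s' => SortEnv n rm s₁.top s' ∧
      IsSortedList (zKey n rm) n fun x => s'.nm (s'.src + x))
      (c := sortCost n) (c' := (4 * n + 5) + ((n * (2 * Nat.log 2 n + 6) + 2) + (1 + (sortCost n +
      (2 * n + 2))))) ?_ fun s₂ h₂ =>
    .seq (tableCmd_runs h₂.1 h₂.2 hin hcen) ?_) (mainCost_le n n le_rfl) (fun _ h => h)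
  · have := sort_runs (lt := zKey) (hlt := BC.zKey) (s := s₁) (by
      rw [h₁.1, h₁.2]
      exact isWeakOrder_zKey hin hcen)
    rwa [h₁.1, h₁.2] at this
  · rintro s₃ ⟨l, hl, hmem, hlen, hT⟩
    have hmem' : ∀ p, p ∈ l ↔ ∃ x, (d x).center = p := by
      intro p
      rw [hmem]
      constructor
      · rintro ⟨a, ha, rfl⟩
        exact ⟨⟨a, ha⟩, by simp [dk, ha]⟩
      · rintro ⟨x, rfl⟩
        exact ⟨x, x.2, by rw [dk_coe]⟩
    have hσ₀ : ∀ p ∈ l, p ∈ σ₀.toSet o := by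
      intro p hp
      obtain ⟨a, ha, rfl⟩ := (hmem p).1 hp
      exact hcen a ha
    have hlog := Nat.log_mono_right (b := 2) hlen
    refine .seq ((labelCmd_runs hl hσ₀ hal hcen hT).mono (by gcongr) fun _ h => h) ?_
    rintro s₄ ⟨hn₄, hlab⟩
    -- With `top = n` the second sort leaves the addresses below `n` to the clique numbers. It may
    -- overwrite the tables, since only the labels in the real memory are still needed.
    refine .seq (Q' := fun s' => s'.n = n ∧ s'.rm = s₄.rm ∧ s'.top = n) (.op ⟨hn₄, rfl, hn₄⟩) ?_
    rintro s₅ ⟨hn₅, hrm₅, htop₅⟩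
    have hsort := sort_runs (lt := labelKey) (hlt := BC.labelKey) (s := s₅)
      (isWeakOrder_labelKey _ _)
    rw [hn₅, hrm₅, htop₅] at hsort
    refine .seq hsort ?_
    rintro s₆ ⟨hE, hV⟩
    refine (numberCmd_runs BC.labelKey (isWeakOrder_labelKey n s₄.rm) hE le_rfl hV).mono le_rfl ?_
    rintro s₇ ⟨h1, h2⟩
    exact ⟨h1, l, hl, hmem', s₄.rm, hlab, h2⟩

theorem IsBox.unique {σ τ : Cell} {X Y S : ℝ} (h : IsBox σ X Y S) (h' : IsBox τ X Y S) : σ = τ := by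
  refine Cell.toSet_injective 0 ?_
  ext p
  rw [Cell.mem_iff_corner, Cell.mem_iff_corner, ← h.1, ← h.2.1, ← h.2.2, h'.1, h'.2.1, h'.2.2]

/-- Labels omit the hole: at a given level the outer cell determines the region, and corner and side
determine the cell. -/
theorem HasLabel.equiv_iff {l : List Point} {rm : ℕ → ℝ} {a b L L' : ℕ} {R R' : Region}
    {ty ty' ix ix' : ℕ} (h : HasLabel o σ₀ d l rm a L R ty ix)
    (h' : HasLabel o σ₀ d l rm b L' R' ty' ix') :
    (¬ labelKey n rm a b ∧ ¬ labelKey n rm b a) ↔ L = L' ∧ R = R' ∧ ty = ty' ∧ ix = ix' := by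
  rw [labelKey, labelKey, not_lexLt_iff]
  constructor
  · intro hk
    have hL : L = L' := by
      have := hk 3 (by omega)
      rw [h.lev_eq, h'.lev_eq] at this
      exact_mod_cast this
    have hty : ty = ty' := by
      have := hk 4 (by omega)
      rw [h.ty_eq, h'.ty_eq] at this
      exact_mod_cast this
    have hix : ix = ix' := by
      have := hk 5 (by omega)
      rw [h.ix_eq, h'.ix_eq] at this
      exact_mod_cast this
    subst hL
    have hb := h.box
    rw [hk 0 (by omega), hk 1 (by omega), hk 2 (by omega)] at hb
    have hout := hb.unique h'.box
    have hR' := h'.region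
    rw [← hout] at hR'
    exact ⟨rfl, h.region.unique hR', hty, hix⟩
  · rintro ⟨rfl, rfl, rfl, rfl⟩ k hk
    obtain ⟨x1, x2, x3⟩ := h.box
    obtain ⟨y1, y2, y3⟩ := h'.box
    interval_cases k
    · exact x1.trans y1.symm
    · exact x2.trans y2.symm
    · exact x3.trans y3.symm
    · exact h.lev_eq.trans h'.lev_eq.symm
    · exact h.ty_eq.trans h'.ty_eq.symm
    · exact h.ix_eq.trans h'.ix_eq.symm

theorem exists_finpartition {n : ℕ} (f : Fin n → ℕ) :
    ∃ C : Finpartition (Finset.univ : Finset (Fin n)), ∀ x y, C.part x = C.part y ↔ f x = f y := by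
  classical
  refine ⟨Finpartition.ofSetoid (Setoid.ker f), fun x y => ?_⟩
  rw [← Finpartition.mem_part_iff_part_eq_part _ (Finset.mem_univ x) (Finset.mem_univ y),
    Finpartition.mem_part_ofSetoid_iff_rel, eq_comm]
  rfl

theorem exists_program : ∃ (k : ℕ) (A : Prog) (T : ℕ → ℕ),
    (fun n : ℕ => (T n : ℝ)) =O[atTop] (fun n : ℕ => (n : ℝ) * Real.log n) ∧
    ∀ (n : ℕ) (o : Point) (σ₀ : Cell) (d : Fin n → Disk), IsAdmissible o σ₀ d →
      ∃ (C : Finpartition (Finset.univ : Finset (Fin n))) (m : ℕ) (s : RamState),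
        IsCliqueConstruction k o σ₀ d C ∧
        Exec A (inputState o σ₀ d) m s ∧ m ≤ T n ∧ Represents s C := by
  obtain ⟨A, K, hA⟩ := mainCmd.compile
  refine ⟨162, A, fun n => K * (40 * ((n + 1) * (Nat.log 2 n + 1))), ?_, ?_⟩
  · have h1 : (fun n : ℕ => (n : ℝ) + 1) =O[atTop] fun n : ℕ => (n : ℝ) := by
      refine (isBigO_refl _ _).add (IsBigO.of_bound 1 ?_)
      filter_upwards [eventually_ge_atTop 1] with n hn
      simpa using hn
    refine ((h1.mul isBigO_natLog).const_mul_left (K * 40)).congr_left fun n => ?_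
    push_cast
    ring
  · intro n o σ₀ d had
    obtain ⟨m, s', hrun, hm, hlt, l, hl, hmem, rm, hlab, hnum⟩ :=
      mainCmd_runs had (s := St.of (inputState o σ₀ d)) (by simp [St.of, inputState])
        isInput_inputState
    obtain ⟨m', s₁, hex, hm', rfl⟩ := hA _ _ _ hrun
    obtain ⟨C, hC⟩ := exists_finpartition fun x : Fin n => s₁.nmem x
    choose L R ty ix hLx using fun x : Fin n => hlab x x.2
    refine ⟨C, m', s₁, ?_, hex, hm'.trans (Nat.mul_le_mul_left K hm), fun x => hlt x x.2,
      fun x y => (hC x y).symm⟩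
    have hd : ∀ x : Fin n, dk d x = d x := dk_coe d
    refine isCliqueConstruction_of_labels had hl hmem (lev := L) (reg := R)
      (ty := ty) (idx := ix) (fun x => hd x ▸ (hLx x).assigned)
      (fun x => (hLx x).ty_lt) (fun x => (hLx x).ix_lt) (fun x => (hLx x).zero)
      (fun x => hd x ▸ (hLx x).meet) (fun x => hd x ▸ (hLx x).disj) (stabPt o)
      (fun x => hd x ▸ (hLx x).stab) fun x y => ?_
    rw [hC, ← (hLx x).equiv_iff (hLx y)]
    exact hnum x x.2 y y.2

end

theorem lemma2 :
    -- the construction can be carried out on the extended real RAM in `O(n log n)` time,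
    -- with `O(1)` cliques per node of the skip quadtree
    (∃ (k : ℕ) (A : Prog) (T : ℕ → ℕ),
      (fun n : ℕ => (T n : ℝ)) =O[atTop] (fun n : ℕ => (n : ℝ) * Real.log n) ∧
      ∀ (n : ℕ) (o : Point) (σ₀ : Cell) (d : Fin n → Disk), IsAdmissible o σ₀ d →
        ∃ (C : Finpartition (Finset.univ : Finset (Fin n))) (m : ℕ) (s : RamState),
          IsCliqueConstruction k o σ₀ d C ∧
          Exec A (inputState o σ₀ d) m s ∧ m ≤ T n ∧ Represents s C) ∧
    -- whatever choices are made, the result is a partition into stabbed cliques whose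
    -- flowers have ply `O(log n)`
    (∀ k : ℕ, ∃ L : ℕ → ℕ,
      (fun n : ℕ => (L n : ℝ)) =O[atTop] (fun n : ℕ => Real.log n) ∧
      ∀ (n : ℕ) (o : Point) (σ₀ : Cell) (d : Fin n → Disk), IsAdmissible o σ₀ d →
        ∀ C : Finpartition (Finset.univ : Finset (Fin n)), IsCliqueConstruction k o σ₀ d C →
          (∀ c ∈ C.parts, IsStabbed d c) ∧
          ply (fun c : C.parts => flower d c) ≤ L n) := ⟨exists_program, ply_part⟩
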